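/- All objects are real and smooth, and the statement is local: $M$ is an open subset of $\mathbb R^4$. A *para-Kähler–Einstein (pKE) structure* $(g,K)$ on $M$ consists of a pseudo-Riemannian metric $g$ and an endomorphism field $K$ with $K^2=\mathrm{id}$, $g(KX,KY)=-g(X,Y)$, such that both eigendistributions of $K$ are integrable, $\rho(X,Y)=g(KX,Y)$ is closed, and $g$ is Einstein. A coframe $(\theta^1,\theta^2,\theta^3,\theta^4)=(\alpha^1,\alpha^2,\bar\alpha^1,\bar\alpha^2)$ with dual frame $(e_a)$ is *adapted* if $g=2\theta^1\theta^3+2\theta^2\theta^4$ (where $\theta^a\theta^b=\tfrac12(\theta^a\otimes\theta^b+\theta^b\otimes\theta^a)$) and $Ke_1=e_1$, $Ke_2=e_2$, $Ke_3=-e_3$, $Ke_4=-e_4$. Let $\Gamma^a{}_b$ be the Levi-Civita connection forms, $d\theta^a+\Gamma^a{}_b\wedge\theta^b=0$, let $d\Gamma^a{}_b+\Gamma^a{}_c\wedge\Gamma^c{}_b=\tfrac12R^a{}_{bcd}\theta^c\wedge\theta^d$, let $C_{abcd}$ be the Weyl tensor, and put $$\Psi_0=C_{1414},\quad \Psi_1=C_{2414},\quad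 \Psi_2=-C_{1423},\quad \Psi_3=C_{1323},\quad \Psi_4=C_{2323},\quad \Psi_2'=C_{1234}.$$ It is assumed throughout that $\Psi_2'\neq0$. The structure has *Petrov type II* if the quartic $\Psi_4\lambda^4+4\Psi_3\lambda^3+6\Psi_2\lambda^2+4\Psi_1\lambda+\Psi_0$ has one double root and two simple roots in $\mathbb{CP}^1$ at every point. In that case let $\mathcal F^6\to M$ be the bundle of adapted coframes with $\Psi_0=\Psi_1=\Psi_3=0$, $\Psi_2\ne0$; its structure group is the torus of diagonal matrices $\mathrm{diag}(t_1,t_2)$, $t_1t_2\neq0$, acting by $(t_1\alpha^1,t_2\alpha^2,t_1^{-1}\bar\alpha^1,t_2^{-1}\bar\alpha^2)$. With $s=\sqrt{\tfrac32|\Psi_2'|}$ and $\epsilon=\operatorname{sgn}\Psi_2'$, define on $\mathcal F^6$ the $\mathfrak{so}_{2,2}$-valued Cartan connection and its curvature $$\mathcal B=\begin{pmatrix}\tfrac12\Gamma^1{}_1&s\,\alpha^1&0&0\\ \epsilon s\,\bar\alpha^1&-\tfrac12\Gamma^1{}_1&0&0\\0&0&\tfrac12\Gamma^2{}_2&s\,\alpha^2\\0&0&\epsilon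 s\,\bar\alpha^2&-\tfrac12\Gamma^2{}_2\end{pmatrix},\qquad K_{\mathcal B}=d\mathcal B+\mathcal B\wedge\mathcal B .$$ The Yang–Mills equations are $D{*}K_{\mathcal B}=0$, where $DS=dS+\mathcal B\wedge S-S\wedge\mathcal B$ and $*$ is the Hodge star of $g$ on horizontal 2-forms, oriented by $\theta^1\wedge\theta^2\wedge\theta^3\wedge\theta^4$. **Theorem.** (1) Let $(g,K)$ be a pKE structure of Petrov type II with $\Psi_2'\ne0$. For every local section of $\mathcal F^6$ one has $$\Gamma^2{}_1=J_1\alpha^2+J_2\bar\alpha^1,\qquad \Gamma^1{}_2=-J_3\alpha^1+J_6\alpha^2+J_5\bar\alpha^1+J_4\bar\alpha^2$$ for some functions $J_1,\dots,J_6$, and, over the domain of the section, $\mathcal B$ satisfies the Yang–Mills equations $D{*}K_{\mathcal B}=0$ if and only if $$\Psi_2=\Psi_2'\quad\text{and}\quad J_1=J_2=J_3=J_4=0 .$$ (2) Let $c\neq0$ be a constant, $A,B\subseteq\mathbb R$ open, $f_1,f_4$ smooth on $A$, $f_2,f_3$ smooth on $B$, with $f_2'$ and $f_4'$ nowhere zero.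 On $\{(x,y,a,b): a\in A,\ b\in B\}$ put $$\theta^1=dx-\tfrac32c\,(x^2+xf_1(a)+f_2(b))\,da,\quad \theta^2=db,\quad \theta^3=da,\quad \theta^4=dy-\tfrac32c\,(y^2+yf_3(b)+f_4(a))\,db .$$ Then $g=2\theta^1\theta^3+2\theta^2\theta^4$, with the $K$ to which this coframe is adapted, is a pKE structure with $\Psi_2'=c$; in this coframe $\Psi_0=\Psi_1=\Psi_3=0$, $\Psi_2=\Psi_2'$ and $J_1=J_2=J_3=J_4=0$; the connection $\mathcal B$ satisfies $D{*}K_{\mathcal B}=0$; and the set of points at which the structure has Petrov type II is open and dense. -/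

import Mathlib

open scoped ContDiff

set_option maxSynthPendingDepth 3

noncomputable section

namespace PKE

/-! ### Para-Kähler-Einstein structures on open subsets of `ℝ⁴`

Everything is local, so the underlying manifold is an open set `U ⊆ ℝ⁴`.  Indices `1, 2, 3, 4` of
the mathematics are `0, 1, 2, 3 : Fin 4` here; a null frame is `(e₁, e₂, e₃, e₄)` with dual coframe
`(θ¹, θ², θ³, θ⁴) = (α¹, α², ᾱ¹, ᾱ²)`. -/

abbrev R4 : Type := Fin 4 → ℝ

/-- A field of bilinear forms on `ℝ⁴`. -/
abbrev MetricField : Type := R4 → R4 →L[ℝ] R4 →L[ℝ] ℝ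

/-- A field of endomorphisms of the tangent spaces of `ℝ⁴`. -/
abbrev EndField : Type := R4 → R4 →L[ℝ] R4

/-- Four vector fields on `ℝ⁴`. -/
abbrev FrameField : Type := Fin 4 → R4 → R4

/-- The involution `1 ↔ 3`, `2 ↔ 4` of the index set. -/
def dualIdx : Fin 4 → Fin 4 := ![2, 3, 0, 1]

/-- The constant components `g₁₃ = g₃₁ = g₂₄ = g₄₂ = 1` of the metric in a null frame
(this matrix is its own inverse). -/
def eta (a b : Fin 4) : ℝ := if b = dualIdx a then 1 else 0

/-- The eigenvalues of the paracomplex structure on the vectors of an adapted frame. -/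
def paraSign : Fin 4 → ℝ := ![1, 1, -1, -1]

/-- `(g, K)` is an almost para-Hermitian structure on `U`: a smooth pseudo-Riemannian metric `g` and
a smooth field `K` with `K² = id`, `g(KX, KY) = -g(X, Y)`.  The two eigenspaces of `K` are then
complementary null subspaces for the nondegenerate form `g`, hence both have rank two and `g`
has signature `(2, 2)`. -/
structure IsAlmostParaHermitian (g : MetricField) (K : EndField) (U : Set R4) : Prop where
  smooth_g : ContDiffOn ℝ ∞ g U
  smooth_K : ContDiffOn ℝ ∞ K U
  symm : ∀ x ∈ U, ∀ u v : R4, g x u v = g x v u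
  nondegenerate : ∀ x ∈ U, ∀ u : R4, (∀ v : R4, g x u v = 0) → u = 0
  involutive : ∀ x ∈ U, ∀ u : R4, K x (K x u) = u
  compatible : ∀ x ∈ U, ∀ u v : R4, g x (K x u) (K x v) = -g x u v

/-- The eigendistribution of `K` for the eigenvalue `s` is integrable on `U`: the Lie bracket of two
local sections is again a section. -/
def EigenIntegrable (K : EndField) (s : ℝ) (U : Set R4) : Prop :=
  ∀ (V : Set R4) (X Y : R4 → R4), IsOpen V → V ⊆ U →
    ContDiffOn ℝ ∞ X V → ContDiffOn ℝ ∞ Y V →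
    (∀ x ∈ V, K x (X x) = s • X x) → (∀ x ∈ V, K x (Y x) = s • Y x) →
    ∀ x ∈ V, K x (VectorField.lieBracket ℝ X Y x) = s • VectorField.lieBracket ℝ X Y x

/-- The two-form `ρ(X, Y) = g(KX, Y)` is closed on `U`. -/
def FundamentalFormClosed (g : MetricField) (K : EndField) (U : Set R4) : Prop :=
  ∀ x ∈ U, ∀ u v w : R4,
    fderiv ℝ (fun y => g y (K y v) w) x u - fderiv ℝ (fun y => g y (K y u) w) x v
      + fderiv ℝ (fun y => g y (K y u) v) x w = 0

/-! ### Levi-Civita connection and curvature -/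

/-- The Koszul expression: `koszul g x u v w` is
`½ (∂_u g(v, w) + ∂_v g(u, w) - ∂_w g(u, v))` at `x`. -/
def koszul (g : MetricField) (x : R4) : R4 →L[ℝ] R4 →L[ℝ] R4 →L[ℝ] ℝ :=
  (1 / 2 : ℝ) • (fderiv ℝ g x + (fderiv ℝ g x).flip
    - (ContinuousLinearMap.flipₗᵢ ℝ R4 R4 ℝ).toContinuousLinearEquiv.toContinuousLinearMap.comp
        (fderiv ℝ g x).flip)

theorem koszul_apply (g : MetricField) (x u v w : R4) :
    koszul g x u v w =
      1 / 2 * (fderiv ℝ g x u v w + fderiv ℝ g x v u w - fderiv ℝ g x w u v) := by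
  simp [koszul]

/-- The Christoffel symbols of `g` as a bilinear map, `g(Γ(u, v), w) = koszul g x u v w`. -/
def christoffel (g : MetricField) (x : R4) : R4 →L[ℝ] R4 →L[ℝ] R4 :=
  (ContinuousLinearMap.compL ℝ R4 (R4 →L[ℝ] ℝ) R4 (g x).inverse).comp (koszul g x)

/-- The Riemann curvature operator `R(u, v) w` of the Levi-Civita connection at `x`. -/
def riem (g : MetricField) (x u v w : R4) : R4 :=
  fderiv ℝ (fun y => christoffel g y v w) x u - fderiv ℝ (fun y => christoffel g y u w) x v
    + christoffel g x u (christoffel g x v w) - christoffel g x v (christoffel g x u w)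

/-- The Ricci tensor, `Ric(v, w) = tr (u ↦ R(u, w) v)`. -/
def ricci (g : MetricField) (x v w : R4) : ℝ :=
  ∑ i : Fin 4, riem g x (Pi.single i 1) w v i

/-- `g` is Einstein on `U`: the trace-free part of its Ricci tensor vanishes. -/
def IsEinstein (g : MetricField) (U : Set R4) : Prop :=
  ∀ x ∈ U, ∃ r : ℝ, ∀ v w : R4, ricci g x v w = r * g x v w

/-- `f` is a null frame at `x` adapted to `(g, K)`: `g = 2α¹ᾱ¹ + 2α²ᾱ²` and
`K = α¹⊗∂₁ + α²⊗∂₂ - ᾱ¹⊗∂₃ - ᾱ²⊗∂₄` in the dual coframe. -/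
def IsAdaptedAt (g : MetricField) (K : EndField) (x : R4) (f : Fin 4 → R4) : Prop :=
  (∀ a b, g x (f a) (f b) = eta a b) ∧ ∀ a, K x (f a) = paraSign a • f a

/-- `R_{abcd}` in the frame `f`, where `R^a_{bcd} = θ^a(R(e_c, e_d) e_b)`. -/
def riemComp (g : MetricField) (x : R4) (f : Fin 4 → R4) (a b c d : Fin 4) : ℝ :=
  g x (riem g x (f c) (f d) (f b)) (f a)

/-- `R_{ab} = R^c_{acb}` in the null frame `f`. -/
def ricciComp (g : MetricField) (x : R4) (f : Fin 4 → R4) (a b : Fin 4) : ℝ :=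
  ∑ c, riemComp g x f (dualIdx c) a c b

/-- The scalar curvature `R = g^{ab} R_{ab}`, computed in the null frame `f`. -/
def scalComp (g : MetricField) (x : R4) (f : Fin 4 → R4) : ℝ :=
  ∑ a, ricciComp g x f a (dualIdx a)

/-- The Schouten tensor `P_{ab} = ½ R_{ab} - (1/12) R g_{ab}` in the null frame `f`. -/
def schoutenComp (g : MetricField) (x : R4) (f : Fin 4 → R4) (a b : Fin 4) : ℝ :=
  1 / 2 * ricciComp g x f a b - 1 / 12 * scalComp g x f * eta a b

/-- The Weyl tensor `C_{abcd}` in the null frame `f`. -/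
def weylComp (g : MetricField) (x : R4) (f : Fin 4 → R4) (a b c d : Fin 4) : ℝ :=
  riemComp g x f a b c d + eta a d * schoutenComp g x f c b - eta a c * schoutenComp g x f d b
    + eta b c * schoutenComp g x f d a - eta b d * schoutenComp g x f c a

/-- The anti-self-dual Weyl components `Ψ₀ = C₁₄₁₄`, `Ψ₁ = C₂₄₁₄`, `Ψ₂ = -C₁₄₂₃`, `Ψ₃ = C₁₃₂₃`,
`Ψ₄ = C₂₃₂₃` in the frame `f`. -/
def psi (g : MetricField) (x : R4) (f : Fin 4 → R4) : Fin 5 → ℝ :=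
  ![weylComp g x f 0 3 0 3, weylComp g x f 1 3 0 3, -weylComp g x f 0 3 1 2,
    weylComp g x f 0 2 1 2, weylComp g x f 1 2 1 2]

/-- The self-dual Weyl component `Ψ₂' = C₁₂₃₄` in the frame `f`. -/
def psi2' (g : MetricField) (x : R4) (f : Fin 4 → R4) : ℝ := weylComp g x f 0 1 2 3

/-- A para-Kähler-Einstein structure on `U` with nonzero scalar curvature: both eigendistributions
of `K` are integrable, `ρ` is closed, the metric is Einstein, and `Ψ₂' ≠ 0` (the standing
assumption). -/
structure IsPKE (g : MetricField) (K : EndField) (U : Set R4) : Prop where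
  almost : IsAlmostParaHermitian g K U
  integrable_pos : EigenIntegrable K 1 U
  integrable_neg : EigenIntegrable K (-1) U
  closed : FundamentalFormClosed g K U
  einstein : IsEinstein g U
  psi2'_ne_zero : ∀ x ∈ U, ∀ f : Fin 4 → R4, IsAdaptedAt g K x f → psi2' g x f ≠ 0

/-- The binary quartic `c₄ X⁴ + 4 c₃ X³Y + 6 c₂ X²Y² + 4 c₁ XY³ + c₀ Y⁴` has exactly one double root
and two simple roots on the complex projective line. -/
def HasRootTypeII (c : Fin 5 → ℝ) : Prop :=
  ∃ p q r : Fin 2 → ℂ,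
    p 0 * q 1 - p 1 * q 0 ≠ 0 ∧ p 0 * r 1 - p 1 * r 0 ≠ 0 ∧ q 0 * r 1 - q 1 * r 0 ≠ 0 ∧
    ∀ X Y : ℂ,
      (c 4 : ℂ) * X ^ 4 + 4 * (c 3 : ℂ) * X ^ 3 * Y + 6 * (c 2 : ℂ) * X ^ 2 * Y ^ 2
          + 4 * (c 1 : ℂ) * X * Y ^ 3 + (c 0 : ℂ) * Y ^ 4 =
        (p 0 * X + p 1 * Y) ^ 2 * (q 0 * X + q 1 * Y) * (r 0 * X + r 1 * Y)

/-- The anti-self-dual Weyl curvature has Petrov type `II` at `x`.  The root type does not depend on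
the adapted frame. -/
def IsPetrovII (g : MetricField) (K : EndField) (x : R4) : Prop :=
  ∀ f : Fin 4 → R4, IsAdaptedAt g K x f → HasRootTypeII (psi g x f)

/-! ### The reduced bundle `F⁶ → M` and the forms on it -/

/-- The frames at `x` that make up the fibre of `F⁶`: adapted null frames with
`Ψ₀ = Ψ₁ = Ψ₃ = 0` and `Ψ₂ ≠ 0`. -/
def F6 (g : MetricField) (K : EndField) (x : R4) : Set (Fin 4 → R4) :=
  {f | IsAdaptedAt g K x f ∧ psi g x f 0 = 0 ∧ psi g x f 1 = 0 ∧ psi g x f 3 = 0 ∧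
    psi g x f 2 ≠ 0}

/-- `e` is a smooth local section of `F⁶` over `V`. -/
def IsF6Section (g : MetricField) (K : EndField) (V : Set R4) (e : FrameField) : Prop :=
  (∀ a, ContDiffOn ℝ ∞ (e a) V) ∧ ∀ x ∈ V, (fun a => e a x) ∈ F6 g K x

/-- The coframe dual to a null frame: `θ¹ = g(e₃, ·)`, `θ² = g(e₄, ·)`, `θ³ = g(e₁, ·)`,
`θ⁴ = g(e₂, ·)`. -/
def coframe (g : MetricField) (e : FrameField) (a : Fin 4) (x : R4) : R4 →L[ℝ] ℝ :=
  g x (e (dualIdx a) x)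

theorem coframe_dual {g : MetricField} {K : EndField} {e : FrameField} {x : R4}
    (h : IsAdaptedAt g K x (fun a => e a x)) (a b : Fin 4) :
    coframe g e a x (e b x) = if a = b then 1 else 0 := by
  have := h.1 (dualIdx a) b
  simp only [coframe, this]
  fin_cases a <;> fin_cases b <;> simp [eta, dualIdx]

/-- The Levi-Civita connection forms `Γ^a_b = θ^a(∇ e_b)` of the frame `e`. -/
def connForm (g : MetricField) (e : FrameField) (a b : Fin 4) (x : R4) : R4 →L[ℝ] ℝ :=
  (coframe g e a x).comp (fderiv ℝ (e b) x + (christoffel g x).flip (e b x))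

/-- The coefficients `(J₁, …, J₆)` (numbered from `0` here) of
`Γ²₁ = J₁ α² + J₂ ᾱ¹` and `Γ¹₂ = -J₃ α¹ + J₆ α² + J₅ ᾱ¹ + J₄ ᾱ²`. -/
def J (g : MetricField) (e : FrameField) (x : R4) : Fin 6 → ℝ :=
  ![connForm g e 1 0 x (e 1 x), connForm g e 1 0 x (e 2 x), -connForm g e 0 1 x (e 0 x),
    connForm g e 0 1 x (e 3 x), connForm g e 0 1 x (e 2 x), connForm g e 0 1 x (e 1 x)]

/-- The total space of the trivialised bundle: a point `(x, t)` with `x ∈ V`, `t₁ t₂ ≠ 0` stands for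
the coframe `(t₁ α¹, t₂ α², t₁⁻¹ ᾱ¹, t₂⁻¹ ᾱ²)` at `x`. -/
abbrev Tot : Type := R4 × (Fin 2 → ℝ)

/-- The part of `F⁶` over `V` in the trivialisation given by a section over `V`. -/
def totOver (V : Set R4) : Set Tot := {p | p.1 ∈ V ∧ p.2 0 ≠ 0 ∧ p.2 1 ≠ 0}

/-- The diagonal of `T = diag(A, (Aᵀ)⁻¹)`, `A = diag(t₁, t₂)`. -/
def torus (t : Fin 2 → ℝ) : Fin 4 → ℝ := ![t 0, t 1, (t 0)⁻¹, (t 1)⁻¹]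

/-- The lifted (tautological) coframe on `F⁶`. -/
def liftCoframe (g : MetricField) (e : FrameField) (a : Fin 4) (p : Tot) : Tot →L[ℝ] ℝ :=
  torus p.2 a • (coframe g e a p.1).comp (ContinuousLinearMap.fst ℝ R4 (Fin 2 → ℝ))

/-- The connection forms `Γ¹₁` and `Γ²₂` on `F⁶`, that is the diagonal entries of
`T Γ T⁻¹ - dT T⁻¹` with `T = diag(t₁, t₂)`. -/
def liftConn (g : MetricField) (e : FrameField) (i : Fin 2) (p : Tot) : Tot →L[ℝ] ℝ :=
  (connForm g e (Fin.castLE (by norm_num) i) (Fin.castLE (by norm_num) i) p.1).comp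
      (ContinuousLinearMap.fst ℝ R4 (Fin 2 → ℝ))
    - (p.2 i)⁻¹ • (ContinuousLinearMap.proj (R := ℝ) (φ := fun _ : Fin 2 => ℝ) i).comp
        (ContinuousLinearMap.snd ℝ R4 (Fin 2 → ℝ))

/-- The `so(2,2) = sl(2) ⊕ sl(2)`-valued Cartan connection `ℬ` on `F⁶`.  With
`s = √(3/2 |Ψ₂'|)`, the entries above the diagonal are `s α¹`, `s α²` and those below it
`sgn(Ψ₂') s ᾱ¹`, `sgn(Ψ₂') s ᾱ²`. -/
def connB (g : MetricField) (e : FrameField) (i j : Fin 4) (p : Tot) : Tot →L[ℝ] ℝ :=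
  let c : ℝ := psi2' g p.1 (fun a => e a p.1)
  let s : ℝ := Real.sqrt (3 / 2 * |c|)
  (!![(1 / 2 : ℝ) • liftConn g e 0 p, s • liftCoframe g e 0 p, 0, 0;
      (Real.sign c * s) • liftCoframe g e 2 p, -((1 / 2 : ℝ) • liftConn g e 0 p), 0, 0;
      0, 0, (1 / 2 : ℝ) • liftConn g e 1 p, s • liftCoframe g e 1 p;
      0, 0, (Real.sign c * s) • liftCoframe g e 3 p, -((1 / 2 : ℝ) • liftConn g e 1 p)] :
    Matrix (Fin 4) (Fin 4) (Tot →L[ℝ] ℝ)) i j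

/-! ### Exterior calculus and the Yang-Mills equations -/

/-- A covector as an alternating one-form. -/
def oneForm (β : Tot →L[ℝ] ℝ) : Tot [⋀^Fin 1]→L[ℝ] ℝ :=
  ContinuousAlternatingMap.ofSubsingleton ℝ Tot ℝ 0 β

/-- The wedge product `β ∧ w` of a one-form and an `n`-form,
`(β ∧ w)(v₀, …, vₙ) = ∑ᵢ (-1)ⁱ β(vᵢ) w(v₀, …, v̂ᵢ, …, vₙ)`. -/
def wedge {n : ℕ} (β : Tot →L[ℝ] ℝ) (w : Tot [⋀^Fin n]→L[ℝ] ℝ) : Tot [⋀^Fin (n + 1)]→L[ℝ] ℝ :=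
  ContinuousAlternatingMap.alternatizeUncurryFin (β.smulRight w)

theorem wedge_oneForm_apply (β γ : Tot →L[ℝ] ℝ) (u v : Tot) :
    wedge β (oneForm γ) ![u, v] = β u * γ v - β v * γ u := by
  simp [wedge, oneForm, ContinuousAlternatingMap.alternatizeUncurryFin_apply, Fin.sum_univ_two,
    Fin.removeNth, sub_eq_add_neg]

/-- The curvature `K_ℬ = dℬ + ℬ ∧ ℬ`, entry by entry. -/
def curvB (g : MetricField) (e : FrameField) (i j : Fin 4) (p : Tot) : Tot [⋀^Fin 2]→L[ℝ] ℝ :=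
  extDeriv (fun q => oneForm (connB g e i j q)) p
    + ∑ k, wedge (connB g e i k p) (oneForm (connB g e k j p))

/-- The vectors `(T_a⁻¹ e_a, 0)` at `(x, t)`, which project to the frame of `ℝ⁴` dual to the
coframe that `(x, t)` stands for. -/
def liftFrame (e : FrameField) (a : Fin 4) (p : Tot) : Tot :=
  ((torus p.2 a)⁻¹ • e a p.1, 0)

/-- The Hodge star of the metric `2θ¹θ³ + 2θ²θ⁴` with volume form `θ¹∧θ²∧θ³∧θ⁴`, applied to a
horizontal two-form on `F⁶`:
`*θ¹² = θ¹²`, `*θ³⁴ = θ³⁴`, `*θ¹³ = θ²⁴`, `*θ²⁴ = θ¹³`, `*θ¹⁴ = -θ¹⁴`, `*θ²³ = -θ²³`. -/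
def hodge (g : MetricField) (e : FrameField) (p : Tot) (w : Tot [⋀^Fin 2]→L[ℝ] ℝ) :
    Tot [⋀^Fin 2]→L[ℝ] ℝ :=
  let c : Fin 4 → Fin 4 → ℝ := fun a b => w ![liftFrame e a p, liftFrame e b p]
  let θθ : Fin 4 → Fin 4 → Tot [⋀^Fin 2]→L[ℝ] ℝ := fun a b =>
    wedge (liftCoframe g e a p) (oneForm (liftCoframe g e b p))
  c 0 1 • θθ 0 1 + c 2 3 • θθ 2 3 + c 0 2 • θθ 1 3 + c 1 3 • θθ 0 2
    - c 0 3 • θθ 0 3 - c 1 2 • θθ 1 2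

/-- The covariant derivative `D S = dS + ℬ ∧ S - S ∧ ℬ` of a matrix `S` of two-forms, entry by entry
(one-forms and two-forms commute under the wedge product). -/
def covD (g : MetricField) (e : FrameField) (S : Fin 4 → Fin 4 → Tot → Tot [⋀^Fin 2]→L[ℝ] ℝ)
    (i j : Fin 4) (p : Tot) : Tot [⋀^Fin 3]→L[ℝ] ℝ :=
  extDeriv (S i j) p
    + ∑ k, (wedge (connB g e i k p) (S k j p) - wedge (connB g e k j p) (S i k p))

/-- The Yang-Mills equations `D * K_ℬ = 0` on the part of `F⁶` over `V`, in the trivialisation given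
by the section `e`. -/
def YangMills (g : MetricField) (e : FrameField) (V : Set R4) : Prop :=
  ∀ p ∈ totOver V, ∀ i j : Fin 4,
    covD g e (fun k l q => hodge g e q (curvB g e k l q)) i j p = 0

/-- The conditions `Ψ₂ = Ψ₂'`, `J₁ = J₂ = J₃ = J₄ = 0` at `x`. -/
def YMConditions (g : MetricField) (e : FrameField) (x : R4) : Prop :=
  psi g x (fun a => e a x) 2 = psi2' g x (fun a => e a x) ∧
    J g e x 0 = 0 ∧ J g e x 1 = 0 ∧ J g e x 2 = 0 ∧ J g e x 3 = 0

/-! ### The explicit coframes, in coordinates `(x, y, a, b)` -/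

/-- The coframe `θ¹ = dx - (3/2) c (x² + x f₁(a) + f₂(b)) da`, `θ² = db`, `θ³ = da`,
`θ⁴ = dy - (3/2) c (y² + y f₃(b) + f₄(a)) db`. -/
def exCoframe (c : ℝ) (f₁ f₂ f₃ f₄ : ℝ → ℝ) (a : Fin 4) (z : R4) : R4 →L[ℝ] ℝ :=
  let dz : Fin 4 → R4 →L[ℝ] ℝ := fun i =>
    ContinuousLinearMap.proj (R := ℝ) (φ := fun _ : Fin 4 => ℝ) i
  (![dz 0 - (3 / 2 * c * (z 0 ^ 2 + z 0 * f₁ (z 2) + f₂ (z 3))) • dz 2,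
     dz 3,
     dz 2,
     dz 1 - (3 / 2 * c * (z 1 ^ 2 + z 1 * f₃ (z 3) + f₄ (z 2))) • dz 3] :
    Fin 4 → R4 →L[ℝ] ℝ) a

/-- The frame dual to `exCoframe`. -/
def exFrame (c : ℝ) (f₁ f₂ f₃ f₄ : ℝ → ℝ) : FrameField := fun a z =>
  (![![1, 0, 0, 0],
     ![0, 3 / 2 * c * (z 1 ^ 2 + z 1 * f₃ (z 3) + f₄ (z 2)), 0, 1],
     ![3 / 2 * c * (z 0 ^ 2 + z 0 * f₁ (z 2) + f₂ (z 3)), 0, 1, 0],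
     ![0, 1, 0, 0]] : Fin 4 → R4) a

theorem exCoframe_exFrame (c : ℝ) (f₁ f₂ f₃ f₄ : ℝ → ℝ) (a b : Fin 4) (z : R4) :
    exCoframe c f₁ f₂ f₃ f₄ a z (exFrame c f₁ f₂ f₃ f₄ b z) = if a = b then 1 else 0 := by
  fin_cases a <;> fin_cases b <;> simp [exCoframe, exFrame]

/-- The metric `2θ¹θ³ + 2θ²θ⁴ = θ¹⊗θ³ + θ³⊗θ¹ + θ²⊗θ⁴ + θ⁴⊗θ²`. -/
def exMetric (c : ℝ) (f₁ f₂ f₃ f₄ : ℝ → ℝ) : MetricField := fun z =>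
  ∑ a, (exCoframe c f₁ f₂ f₃ f₄ a z).smulRight (exCoframe c f₁ f₂ f₃ f₄ (dualIdx a) z)

/-- The paracomplex structure `θ¹⊗e₁ + θ²⊗e₂ - θ³⊗e₃ - θ⁴⊗e₄` to which the coframe is adapted. -/
def exPara (c : ℝ) (f₁ f₂ f₃ f₄ : ℝ → ℝ) : EndField := fun z =>
  ∑ a, paraSign a • (exCoframe c f₁ f₂ f₃ f₄ a z).smulRight (exFrame c f₁ f₂ f₃ f₄ a z)

/-- The domain of the coframe when `f₁, f₄` are defined on `A` and `f₂, f₃` on `B`. -/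
def exDomain (A B : Set ℝ) : Set R4 := {z | z 2 ∈ A ∧ z 3 ∈ B}

end PKE

end

noncomputable section

namespace PKE

/-! ### Levi-Civita calculus in a null frame -/

/-! Lean indices are shifted by one: `connForm g e 1 0` is Γ²₁, and `e 0` is e₁. Integrability of
both eigendistributions of K, together with dρ = 0, makes the two null planes parallel
(`IsPKE.isParallelFrame`). Hence Γ is block diagonal, with a 2×2 block and minus its transpose. The
Einstein condition and Ψ₀ = Ψ₁ = Ψ₃ = 0 then leave a curvature that depends only on Ψ₂', Ψ₂ and Ψ₄
(`curvature_reduced`). Two uses of d² = 0 follow. The trace of the block gives d(Γ¹₁ + Γ²₂) =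
-3Ψ₂'ρ, so Ψ₂' is locally constant and ℬ can be differentiated as if its scale were a number
(`fderiv_psi2'`, `connB_eventuallyEq`). The equation for dΓ²₁ gives Ψ₂Γ²₁(e₁) = Ψ₂Γ²₁(e₄) = 0, which
is the asserted shape of Γ²₁ (`connForm_one_zero_apply`).

Necessity: the scale s is such that the (1,1) and (3,3) entries of K_ℬ are opposite. In the sum of
these two entries of D*K_ℬ the exterior derivatives cancel, and an algebraic three-form is left
(`covD_trace`). Up to sign, its four components are (3/2)Ψ₂' times J₁, J₂, J₃, J₄. Once J₁ = J₂ = 0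
on V, Γ²₁ vanishes there, and its curvature equation reduces to (Ψ₂' - Ψ₂) θ²∧θ³ = 0.

Sufficiency: under the stated conditions every entry of K_ℬ is a multiple of θ²∧θ³ (`hodge_curvB`).
Such forms are anti-self-dual, so D*K_ℬ = -DK_ℬ, which vanishes by the Bianchi identity.

For the explicit coframes the connection forms are written down and recognised as Levi-Civita by
uniqueness (`connForm_unique`), and the curvature tensor is then read off (`ExData.g_riem_eq`). In
the given coframe the quartic is X²(Ψ₄X² + 6cY²), so the type is II exactly where Ψ₄ ≠ 0. Since Ψ₄
is affine in x with slope a nonzero multiple of f₄', a small shift of x reaches such points. -/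

/-- `e` is a smooth frame on the open set `V` in which the smooth metric `g` is `eta`. -/
structure IsNullFrame (g : MetricField) (e : FrameField) (V : Set R4) : Prop where
  isOpen : IsOpen V
  smooth_g : ContDiffOn ℝ ∞ g V
  symm : ∀ x ∈ V, ∀ u v : R4, g x u v = g x v u
  smooth_e : ∀ a, ContDiffOn ℝ ∞ (e a) V
  orth : ∀ x ∈ V, ∀ a b, g x (e a x) (e b x) = eta a b

@[simp] theorem dualIdx_dualIdx (a : Fin 4) : dualIdx (dualIdx a) = a := by
  fin_cases a <;> rfl

theorem eta_symm (a b : Fin 4) : eta a b = eta b a := by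
  fin_cases a <;> fin_cases b <;> simp [eta, dualIdx]

/-- A vector is determined by its components in a null frame. -/
theorem frame_decomp_at {G : R4 →L[ℝ] R4 →L[ℝ] ℝ} {f : Fin 4 → R4}
    (h : ∀ a b, G (f a) (f b) = eta a b) (u : R4) :
    u = ∑ a, G (f (dualIdx a)) u • f a := by
  let E : Matrix (Fin 4) (Fin 4) ℝ := Matrix.of fun i a => f a i
  let T : Matrix (Fin 4) (Fin 4) ℝ := Matrix.of fun a i => G (f (dualIdx a)) (Pi.single i 1)
  have hG : ∀ (a : Fin 4) (v : R4), G (f (dualIdx a)) v = ∑ i, T a i * v i := by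
    intro a v
    conv_lhs => rw [pi_eq_sum_univ' v]
    simp only [map_sum, map_smul, smul_eq_mul, T, Matrix.of_apply]
    refine Finset.sum_congr rfl fun i _ => ?_
    rw [mul_comm]
  have hTE : T * E = 1 := by
    ext a b
    rw [Matrix.mul_apply]
    have := hG a (f b)
    rw [h] at this
    simp only [E, Matrix.of_apply]
    rw [← this]
    fin_cases a <;> fin_cases b <;> simp [eta, dualIdx]
  -- For square matrices the left inverse given by orthogonality is also a right inverse, and E T =
  -- 1 is the expansion of u in the frame.
  have hET : E * T = 1 := mul_eq_one_comm.mp hTE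
  ext j
  simp only [Finset.sum_apply, Pi.smul_apply, smul_eq_mul, hG]
  have h1 : (E * T).mulVec u j = u j := by rw [hET, Matrix.one_mulVec]
  rw [← h1, ← Matrix.mulVec_mulVec]
  simp only [Matrix.mulVec, dotProduct, E, Matrix.of_apply]
  exact Finset.sum_congr rfl fun a _ => mul_comm _ _

namespace IsNullFrame

variable {g : MetricField} {e : FrameField} {V : Set R4}

theorem decomp (h : IsNullFrame g e V) {x : R4} (hx : x ∈ V) (u : R4) :
    u = ∑ a, coframe g e a x u • e a x :=
  frame_decomp_at (f := fun a => e a x) (h.orth x hx) u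

theorem coframe_apply (h : IsNullFrame g e V) {x : R4} (hx : x ∈ V) (a b : Fin 4) :
    coframe g e a x (e b x) = if a = b then 1 else 0 := by
  simp only [coframe, h.orth x hx]
  fin_cases a <;> fin_cases b <;> simp [eta, dualIdx]

/-- `christoffel` uses `ContinuousLinearMap.inverse`, whose value at a noninvertible map is zero.
The Koszul formula and smoothness therefore need invertibility at every point of V. -/
theorem isInvertible (h : IsNullFrame g e V) {x : R4} (hx : x ∈ V) : (g x).IsInvertible := by
  have inj : Function.Injective (g x) := by
    rw [injective_iff_map_eq_zero]
    intro u hu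
    rw [h.decomp hx u]
    refine Finset.sum_eq_zero fun a _ => ?_
    rw [coframe, h.symm x hx, hu]
    simp
  have hd : Module.finrank ℝ R4 = Module.finrank ℝ (R4 →L[ℝ] ℝ) := by
    rw [← LinearMap.toContinuousLinearMap.finrank_eq]
    simp
  refine ⟨(LinearEquiv.ofInjectiveOfFinrankEq (g x : R4 →ₗ[ℝ] (R4 →L[ℝ] ℝ)) inj
    hd).toContinuousLinearEquiv, ?_⟩
  ext; rfl

theorem g_christoffel (h : IsNullFrame g e V) {x : R4} (hx : x ∈ V) (u v w : R4) :
    g x (christoffel g x u v) w =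
      1 / 2 * (fderiv ℝ g x u v w + fderiv ℝ g x v u w - fderiv ℝ g x w u v) := by
  rw [← koszul_apply]
  obtain ⟨E, hE⟩ := h.isInvertible hx
  have : christoffel g x u v = (g x).inverse (koszul g x u v) := rfl
  rw [this, ← hE, ContinuousLinearMap.inverse_equiv]
  simp

theorem contDiffOn_christoffel (h : IsNullFrame g e V) : ContDiffOn ℝ ∞ (christoffel g) V := by
  have hD : ContDiffOn ℝ ∞ (fderiv ℝ g) V := h.smooth_g.fderiv_of_isOpen h.isOpen (by simp)
  have hI : ContDiffOn ℝ ∞ (fun x => (g x).inverse) V := by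
    intro x hx
    obtain ⟨E, hE⟩ := h.isInvertible hx
    have h1 : ContDiffAt ℝ ∞ ContinuousLinearMap.inverse (g x) := by
      rw [← hE]; exact contDiffAt_map_inverse E
    exact h1.comp_contDiffWithinAt x (h.smooth_g x hx)
  have hF : ContDiffOn ℝ ∞ (fun x => (fderiv ℝ g x).flip) V :=
    (ContinuousLinearMap.flipₗᵢ ℝ R4 R4 (R4 →L[ℝ] ℝ)).contDiff.comp_contDiffOn hD
  have hK : ContDiffOn ℝ ∞ (koszul g) V := by
    unfold koszul
    exact ((hD.add hF).sub (contDiffOn_const.clm_comp hF)).const_smul (1 / 2 : ℝ)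
  unfold christoffel
  exact (((ContinuousLinearMap.compL ℝ R4 (R4 →L[ℝ] ℝ) R4).contDiff.comp_contDiffOn hI).clm_comp hK)

theorem contDiffOn_coframe (h : IsNullFrame g e V) (a : Fin 4) :
    ContDiffOn ℝ ∞ (coframe g e a) V :=
  h.smooth_g.clm_apply (h.smooth_e _)

theorem contDiffOn_connForm (h : IsNullFrame g e V) (a b : Fin 4) :
    ContDiffOn ℝ ∞ (connForm g e a b) V := by
  have hD : ContDiffOn ℝ ∞ (fderiv ℝ (e b)) V :=
    (h.smooth_e b).fderiv_of_isOpen h.isOpen (by simp)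
  have hF : ContDiffOn ℝ ∞ (fun x => (christoffel g x).flip) V :=
    (ContinuousLinearMap.flipₗᵢ ℝ R4 R4 R4).contDiff.comp_contDiffOn h.contDiffOn_christoffel
  exact (h.contDiffOn_coframe a).clm_comp (hD.add (hF.clm_apply (h.smooth_e b)))

theorem differentiableAt (h : IsNullFrame g e V) {F : Type*} [NormedAddCommGroup F]
    [NormedSpace ℝ F] {φ : R4 → F} (hφ : ContDiffOn ℝ ∞ φ V) {x : R4} (hx : x ∈ V) :
    DifferentiableAt ℝ φ x :=
  (hφ.contDiffAt (h.isOpen.mem_nhds hx)).differentiableAt (by simp)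

theorem fderiv_g_symm (h : IsNullFrame g e V) {x : R4} (hx : x ∈ V) (u v w : R4) :
    fderiv ℝ g x u v w = fderiv ℝ g x u w v := by
  have hd := h.differentiableAt h.smooth_g hx
  have h1 : ∀ v w, HasFDerivAt (fun y => g y v w) ((fderiv ℝ g x).flip v |>.flip w) x := by
    intro v w
    have := (hd.hasFDerivAt.clm_apply (hasFDerivAt_const v x)).clm_apply (hasFDerivAt_const w x)
    refine this.congr_fderiv ?_
    ext z; simp
  have h2 : (fun y => g y v w) =ᶠ[nhds x] fun y => g y w v := by
    filter_upwards [h.isOpen.mem_nhds hx] with y hy using h.symm y hy v w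
  have h3 := h2.fderiv_eq (𝕜 := ℝ)
  rw [(h1 v w).fderiv, (h1 w v).fderiv] at h3
  simpa using congrArg (fun l => l u) h3

theorem g_ext (h : IsNullFrame g e V) {x : R4} (hx : x ∈ V) {u v : R4}
    (huv : ∀ w, g x u w = g x v w) : u = v := by
  rw [h.decomp hx u, h.decomp hx v]
  refine Finset.sum_congr rfl fun a _ => ?_
  rw [coframe, h.symm x hx _ u, h.symm x hx _ v, huv]

theorem christoffel_symm (h : IsNullFrame g e V) {x : R4} (hx : x ∈ V) (u v : R4) :
    christoffel g x u v = christoffel g x v u := by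
  apply h.g_ext hx
  intro w
  rw [h.g_christoffel hx, h.g_christoffel hx, h.fderiv_g_symm hx w u v]
  ring

/-- This is ∇g = 0 in coordinates. -/
theorem g_christoffel_add (h : IsNullFrame g e V) {x : R4} (hx : x ∈ V) (u v w : R4) :
    g x (christoffel g x u v) w + g x v (christoffel g x u w) = fderiv ℝ g x u v w := by
  rw [h.symm x hx v, h.g_christoffel hx, h.g_christoffel hx, h.fderiv_g_symm hx w u v,
    h.fderiv_g_symm hx u v w, h.fderiv_g_symm hx v u w]
  ring

/-- The frame expansion of ∇_u e_b = ∂_u e_b + Γ(u, e_b). It trades derivatives of the frame for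
connection forms. -/
theorem fderiv_frame (h : IsNullFrame g e V) {x : R4} (hx : x ∈ V) (b : Fin 4) (u : R4) :
    fderiv ℝ (e b) x u = ∑ c, connForm g e c b x u • e c x - christoffel g x u (e b x) := by
  rw [eq_sub_iff_add_eq, h.decomp hx (fderiv ℝ (e b) x u + christoffel g x u (e b x))]
  rfl

theorem connForm_dualIdx {x : R4} (a b : Fin 4) (u : R4) :
    connForm g e (dualIdx a) b x u =
      g x (e a x) (fderiv ℝ (e b) x u + christoffel g x u (e b x)) := by
  simp [connForm, coframe]

/-- Differentiate the constant g(e_a, e_b) and use ∇g = 0. -/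
theorem connForm_skew (h : IsNullFrame g e V) {x : R4} (hx : x ∈ V) (a b : Fin 4) (u : R4) :
    connForm g e (dualIdx a) b x u + connForm g e (dualIdx b) a x u = 0 := by
  have hg := (h.differentiableAt h.smooth_g hx).hasFDerivAt
  have he := fun a => (h.differentiableAt (h.smooth_e a) hx).hasFDerivAt
  have h1 := (hg.clm_apply (he a)).clm_apply (he b)
  have h2 : (fun y => g y (e a y) (e b y)) =ᶠ[nhds x] fun _ => eta a b := by
    filter_upwards [h.isOpen.mem_nhds hx] with y hy using h.orth y hy a b
  have h3 := h2.fderiv_eq (𝕜 := ℝ)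
  rw [h1.fderiv] at h3
  have h4 := congrArg (fun l => l u) h3
  simp at h4
  rw [connForm_dualIdx, connForm_dualIdx, map_add, map_add,
    h.symm x hx (e b x) (fderiv ℝ (e a) x u), h.symm x hx (e b x)]
  have := h.g_christoffel_add hx u (e a x) (e b x)
  linarith

/-- The first structure equation. -/
theorem fderiv_coframe (h : IsNullFrame g e V) {x : R4} (hx : x ∈ V) (a : Fin 4) (u v : R4) :
    fderiv ℝ (coframe g e a) x u v =
      coframe g e a x (christoffel g x u v) - ∑ b, connForm g e a b x u * coframe g e b x v := by
  -- Differentiating the constant θ^a(e_b) gives the value on each frame vector; the general v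
  -- follows by linearity.
  have hb : ∀ b, fderiv ℝ (coframe g e a) x u (e b x) =
      coframe g e a x (christoffel g x u (e b x)) - connForm g e a b x u := by
    intro b
    have h1 := (h.differentiableAt (h.contDiffOn_coframe a) hx).hasFDerivAt.clm_apply
      (h.differentiableAt (h.smooth_e b) hx).hasFDerivAt
    have h2 : (fun y => coframe g e a y (e b y)) =ᶠ[nhds x] fun _ => if a = b then 1 else 0 := by
      filter_upwards [h.isOpen.mem_nhds hx] with y hy using h.coframe_apply hy a b
    have h3 := h2.fderiv_eq (𝕜 := ℝ)
    rw [h1.fderiv] at h3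
    have h4 := congrArg (fun l => l u) h3
    simp at h4
    simp only [connForm, ContinuousLinearMap.comp_apply, add_apply, map_add,
      ContinuousLinearMap.flip_apply]
    linarith
  conv_lhs => rw [h.decomp hx v]
  rw [map_sum]
  simp only [map_smul, smul_eq_mul, hb, mul_sub, Finset.sum_sub_distrib]
  congr 1
  · conv_rhs => rw [h.decomp hx v]
    simp
  · exact Finset.sum_congr rfl fun b _ => mul_comm _ _

theorem torsion_free (h : IsNullFrame g e V) {x : R4} (hx : x ∈ V) (a : Fin 4) (u v : R4) :
    fderiv ℝ (coframe g e a) x u v - fderiv ℝ (coframe g e a) x v u =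
      -∑ b, (connForm g e a b x u * coframe g e b x v - connForm g e a b x v * coframe g e b x u) := by
  rw [h.fderiv_coframe hx, h.fderiv_coframe hx, h.christoffel_symm hx u v, Finset.sum_sub_distrib]
  ring

theorem hasFDerivAt_christoffel (h : IsNullFrame g e V) {x : R4} (hx : x ∈ V) (v w : R4) :
    HasFDerivAt (fun y => christoffel g y v w)
      (((fderiv ℝ (christoffel g) x).flip v).flip w) x := by
  have hd := (h.differentiableAt h.contDiffOn_christoffel hx).hasFDerivAt
  refine ((hd.clm_apply (hasFDerivAt_const v x)).clm_apply (hasFDerivAt_const w x)).congr_fderiv ?_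
  ext z; simp

theorem riem_eq (h : IsNullFrame g e V) {x : R4} (hx : x ∈ V) (u v w : R4) :
    riem g x u v w = fderiv ℝ (christoffel g) x u v w - fderiv ℝ (christoffel g) x v u w
      + christoffel g x u (christoffel g x v w) - christoffel g x v (christoffel g x u w) := by
  simp only [riem, (h.hasFDerivAt_christoffel hx _ _).fderiv, ContinuousLinearMap.flip_apply]

/-- The second structure equation. -/
theorem curvature (h : IsNullFrame g e V) {x : R4} (hx : x ∈ V) (a b : Fin 4) (u v : R4) :
    coframe g e a x (riem g x u v (e b x)) =
      fderiv ℝ (connForm g e a b) x u v - fderiv ℝ (connForm g e a b) x v u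
        + ∑ c, (connForm g e a c x u * connForm g e c b x v
          - connForm g e a c x v * connForm g e c b x u) := by
  have hsym := (((h.smooth_e b).contDiffAt (h.isOpen.mem_nhds hx)).isSymmSndFDerivAt
    (by simpa using WithTop.coe_le_coe.2 (le_top : (2 : ℕ∞) ≤ ⊤))).eq u v
  have hDD : ∀ v : R4, HasFDerivAt (fun y => fderiv ℝ (e b) y v)
      ((fderiv ℝ (fderiv ℝ (e b)) x).flip v) x := by
    intro v
    have hD : ContDiffOn ℝ ∞ (fderiv ℝ (e b)) V :=
      (h.smooth_e b).fderiv_of_isOpen h.isOpen (by simp)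
    refine ((h.differentiableAt hD hx).hasFDerivAt.clm_apply
      (hasFDerivAt_const v x)).congr_fderiv ?_
    ext z; simp
  have hE := fun c => (h.differentiableAt (h.smooth_e c) hx).hasFDerivAt
  -- Differentiating `fderiv_frame` once more expresses ∂_u∂_v e_b through Γ and the Christoffel
  -- map. Symmetry in u and v then equates the antisymmetrised Christoffel terms, which form the
  -- Riemann tensor, with dΓ + Γ∧Γ.
  have key : ∀ u v : R4, fderiv ℝ (fderiv ℝ (e b)) x u v =
      ∑ c, (fderiv ℝ (connForm g e c b) x u v • e c x
        + connForm g e c b x v • fderiv ℝ (e c) x u)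
      - (fderiv ℝ (christoffel g) x u v (e b x) + christoffel g x v (fderiv ℝ (e b) x u)) := by
    intro u v
    have h1 : HasFDerivAt (fun y => ∑ c, connForm g e c b y v • e c y
        - christoffel g y v (e b y)) _ x :=
      (HasFDerivAt.fun_sum (u := Finset.univ) fun c _ =>
        ((h.differentiableAt (h.contDiffOn_connForm c b) hx).hasFDerivAt.clm_apply
          (hasFDerivAt_const v x)).smul (hE c)).sub
      (((h.differentiableAt h.contDiffOn_christoffel hx).hasFDerivAt.clm_apply
        (hasFDerivAt_const v x)).clm_apply (hE b))
    have h2 : (fun y => fderiv ℝ (e b) y v) =ᶠ[nhds x] (fun y => ∑ c, connForm g e c b y v • e c y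
        - christoffel g y v (e b y)) := by
      filter_upwards [h.isOpen.mem_nhds hx] with y hy using h.fderiv_frame hy b v
    have h3 := h2.fderiv_eq (𝕜 := ℝ)
    rw [h1.fderiv, (hDD v).fderiv] at h3
    have h4 := congrArg (fun l => l u) h3
    simp only [ContinuousLinearMap.flip_apply] at h4
    rw [h4]
    simp [add_comm]
  rw [key u v, key v u] at hsym
  simp only [Finset.sum_add_distrib] at hsym
  have hs2 : ∀ u v : R4, ∑ c, connForm g e c b x v • fderiv ℝ (e c) x u
      = ∑ c, connForm g e c b x v • (∑ d, connForm g e d c x u • e d x)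
        - christoffel g x u (∑ c, connForm g e c b x v • e c x) := by
    intro u v
    simp only [h.fderiv_frame hx, smul_sub, Finset.sum_sub_distrib, map_sum, map_smul]
  have hfe : ∀ u, ∑ c, connForm g e c b x u • e c x =
      fderiv ℝ (e b) x u + christoffel g x u (e b x) := fun u => by
    rw [h.fderiv_frame hx]; abel
  rw [hs2 u v, hs2 v u, hfe, hfe, map_add, map_add] at hsym
  have hR : riem g x u v (e b x) =
      (∑ c, fderiv ℝ (connForm g e c b) x u v • e c x
        - ∑ c, fderiv ℝ (connForm g e c b) x v u • e c x)
      + (∑ c, connForm g e c b x v • (∑ d, connForm g e d c x u • e d x)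
        - ∑ c, connForm g e c b x u • (∑ d, connForm g e d c x v • e d x)) := by
    rw [h.riem_eq hx]
    rw [← sub_eq_zero] at hsym ⊢
    rw [← neg_eq_zero, ← hsym]
    abel
  rw [hR]
  simp only [map_add, map_sub, map_sum, map_smul, smul_eq_mul, h.coframe_apply hx, mul_ite,
    mul_one, mul_zero, Finset.sum_ite_eq, Finset.mem_univ, if_true, Finset.sum_sub_distrib]
  simp only [mul_comm]

end IsNullFrame

/-! ### Algebra of the curvature tensor -/

/-- The classical octahedron argument: the four cyclic identities, one for each index held first,
combine by means of the two skew symmetries. -/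
theorem pair_symm_of_skew_of_cyclic {ι : Type*} {R : ι → ι → ι → ι → ℝ}
    (h12 : ∀ a b c d, R a b c d = -R b a c d) (h34 : ∀ a b c d, R a b c d = -R a b d c)
    (hc : ∀ a b c d, R a b c d + R a c d b + R a d b c = 0) (a b c d : ι) :
    R a b c d = R c d a b := by
  linarith [hc a b c d, hc b c d a, hc c d a b, hc d a b c, h12 a b c d, h12 a b d c, h12 c d a b,
    h12 c d b a, h34 a b c d, h34 b a c d, h34 c d a b, h34 d c a b, h12 a c d b, h12 a d b c,
    h12 b c d a, h12 b d a c, h34 a c d b, h34 a d b c, h34 b c d a, h34 b d a c, h34 c a b d,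
    h34 d a b c, h34 d b c a, h34 c b d a, h12 c a b d, h12 d a b c, h12 b d c a, h12 a c b d,
    h34 d b a c]

namespace IsNullFrame

variable {g : MetricField} {e : FrameField} {V : Set R4}

theorem eventually {p : R4 → Prop} (h : IsNullFrame g e V) {x : R4} (hx : x ∈ V)
    (hp : ∀ y ∈ V, p y) : ∀ᶠ y in nhds x, p y :=
  Filter.mem_of_superset (h.isOpen.mem_nhds hx) hp

theorem riem_cyclic (h : IsNullFrame g e V) {x : R4} (hx : x ∈ V) (u v w : R4) :
    riem g x u v w + riem g x v w u + riem g x w u v = 0 := by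
  have hD : ∀ u v w : R4,
      fderiv ℝ (christoffel g) x u v w = fderiv ℝ (christoffel g) x u w v := by
    intro u v w
    have h2 : (fun y => christoffel g y v w) =ᶠ[nhds x] fun y => christoffel g y w v :=
      h.eventually hx fun y hy => h.christoffel_symm hy v w
    have h3 := h2.fderiv_eq (𝕜 := ℝ)
    rw [(h.hasFDerivAt_christoffel hx v w).fderiv, (h.hasFDerivAt_christoffel hx w v).fderiv] at h3
    simpa using congrArg (fun l => l u) h3
  rw [h.riem_eq hx, h.riem_eq hx, h.riem_eq hx, hD v w u, hD w u v, hD u w v,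
    h.christoffel_symm hx w u, h.christoffel_symm hx v w, h.christoffel_symm hx u v]
  abel

theorem riemComp_eq (h : IsNullFrame g e V) {x : R4} (hx : x ∈ V) (a b c d : Fin 4) :
    riemComp g x (fun a => e a x) a b c d =
      coframe g e (dualIdx a) x (riem g x (e c x) (e d x) (e b x)) := by
  simp only [riemComp, coframe, dualIdx_dualIdx]
  exact h.symm x hx _ _

theorem fderiv_connForm_skew (h : IsNullFrame g e V) {x : R4} (hx : x ∈ V) (a b : Fin 4)
    (u v : R4) : fderiv ℝ (connForm g e (dualIdx a) b) x u v
      + fderiv ℝ (connForm g e (dualIdx b) a) x u v = 0 := by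
  have h2 : connForm g e (dualIdx a) b =ᶠ[nhds x] fun y => -connForm g e (dualIdx b) a y :=
    h.eventually hx fun y hy => by
      ext u
      have := h.connForm_skew hy a b u
      simp only [neg_apply]
      linarith
  rw [h2.fderiv_eq (𝕜 := ℝ), fderiv_fun_neg]
  simp

/-- The curvature forms dΓ + Γ∧Γ inherit the skewness of Γ. -/
theorem riemComp_skew_left (h : IsNullFrame g e V) {x : R4} (hx : x ∈ V) (a b c d : Fin 4) :
    riemComp g x (fun a => e a x) a b c d = -riemComp g x (fun a => e a x) b a c d := by
  rw [h.riemComp_eq hx, h.riemComp_eq hx, h.curvature hx, h.curvature hx]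
  have s := h.connForm_skew hx
  have e1 : ∀ k u, connForm g e (dualIdx a) k x u = -connForm g e (dualIdx k) a x u :=
    fun k u => by linarith [s a k u]
  have e2 : ∀ k u, connForm g e (dualIdx b) k x u = -connForm g e (dualIdx k) b x u :=
    fun k u => by linarith [s b k u]
  have d1 := h.fderiv_connForm_skew hx a b (e c x) (e d x)
  have d2 := h.fderiv_connForm_skew hx a b (e d x) (e c x)
  simp only [Fin.sum_univ_four, e1 0, e1 1, e1 2, e1 3, e2 0, e2 1, e2 2, e2 3]
  simp only [dualIdx, Matrix.cons_val] at *
  linear_combination d1 - d2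

theorem _root_.PKE.riem_skew (u v w x : R4) : riem g x u v w = -riem g x v u w := by
  simp only [riem]
  abel

theorem _root_.PKE.riemComp_skew_right {x : R4} {f : Fin 4 → R4} (a b c d : Fin 4) :
    riemComp g x f a b c d = -riemComp g x f a b d c := by
  rw [riemComp, riem_skew]
  simp [riemComp]

theorem riemComp_cyclic (h : IsNullFrame g e V) {x : R4} (hx : x ∈ V) {f : Fin 4 → R4}
    (a b c d : Fin 4) :
    riemComp g x f a b c d + riemComp g x f a c d b + riemComp g x f a d b c = 0 := by
  have := h.riem_cyclic hx (f c) (f d) (f b)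
  simp only [riemComp]
  rw [← add_apply, ← add_apply, ← map_add, ← map_add, this]
  simp

theorem riemComp_pair_symm (h : IsNullFrame g e V) {x : R4} (hx : x ∈ V) (a b c d : Fin 4) :
    riemComp g x (fun a => e a x) a b c d = riemComp g x (fun a => e a x) c d a b :=
  pair_symm_of_skew_of_cyclic (h.riemComp_skew_left hx) riemComp_skew_right
    (h.riemComp_cyclic hx) a b c d

theorem coframe_riem (h : IsNullFrame g e V) {x : R4} (hx : x ∈ V) (a b : Fin 4) (u v : R4) :
    coframe g e a x (riem g x u v (e b x)) = ∑ c, ∑ d, coframe g e c x u * coframe g e d x v *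
      riemComp g x (fun a => e a x) (dualIdx a) b c d := by
  have key : riem g x u v (e b x) = ∑ c, ∑ d, (coframe g e c x u * coframe g e d x v) •
      riem g x (e c x) (e d x) (e b x) := by
    have hu : ∀ (v w : R4) , riem g x u v w = ∑ c, coframe g e c x u • riem g x (e c x) v w := by
      intro v w
      conv_lhs => rw [h.decomp hx u]
      simp only [h.riem_eq hx, map_sum, map_smul, sum_apply,
        smul_apply, Finset.sum_add_distrib, Finset.sum_sub_distrib, smul_sub, smul_add]
    have hv : ∀ (u w : R4) , riem g x u v w = ∑ d, coframe g e d x v • riem g x u (e d x) w := by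
      intro u w
      conv_lhs => rw [h.decomp hx v]
      simp only [h.riem_eq hx, map_sum, map_smul, sum_apply,
        smul_apply, Finset.sum_add_distrib, Finset.sum_sub_distrib, smul_sub, smul_add]
    rw [hu]
    refine Finset.sum_congr rfl fun c _ => ?_
    rw [hv, Finset.smul_sum]
    exact Finset.sum_congr rfl fun d _ => smul_smul _ _ _
  rw [key]
  simp only [map_sum, map_smul, smul_eq_mul, h.riemComp_eq hx, dualIdx_dualIdx]

/-- A trace does not depend on the basis: the sum over coordinate vectors in `ricci` equals the sum
over the null frame. -/
theorem ricciComp_eq (h : IsNullFrame g e V) {x : R4} (hx : x ∈ V) (a b : Fin 4) :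
    ricciComp g x (fun a => e a x) a b = ricci g x (e a x) (e b x) := by
  simp only [ricciComp, ricci, h.riemComp_eq hx, dualIdx_dualIdx]
  have hu : ∀ (u v w : R4) , riem g x u v w = ∑ c, coframe g e c x u • riem g x (e c x) v w := by
    intro u v w
    conv_lhs => rw [h.decomp hx u]
    simp only [h.riem_eq hx, map_sum, map_smul, sum_apply,
      smul_apply, Finset.sum_add_distrib, Finset.sum_sub_distrib, smul_sub, smul_add]
  have hθ : ∀ c (w : R4), coframe g e c x w = ∑ i, coframe g e c x (Pi.single i 1) * w i := by
    intro c w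
    conv_lhs => rw [pi_eq_sum_univ' w]
    simp [mul_comm]
  symm
  calc ∑ i, riem g x (Pi.single i 1) (e b x) (e a x) i
      = ∑ i, ∑ c, coframe g e c x (Pi.single i 1) * riem g x (e c x) (e b x) (e a x) i := by
        refine Finset.sum_congr rfl fun i _ => ?_
        rw [hu]; simp
    _ = _ := by
        rw [Finset.sum_comm]
        exact Finset.sum_congr rfl fun c _ => (hθ c _).symm

end IsNullFrame

/-- The derivative of the components of `f α ∧ β`. -/
theorem fderiv_smul_wedge {E : Type*} [NormedAddCommGroup E] [NormedSpace ℝ E]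
    {f : E → ℝ} {α β : E → E →L[ℝ] ℝ} {x : E}
    (hf : DifferentiableAt ℝ f x) (hα : DifferentiableAt ℝ α x) (hβ : DifferentiableAt ℝ β x)
    (v w : E) :
    HasFDerivAt (fun y => f y * (α y v * β y w - α y w * β y v))
      ((α x v * β x w - α x w * β x v) • fderiv ℝ f x + f x •
        (β x w • (fderiv ℝ α x).flip v + α x v • (fderiv ℝ β x).flip w
          - β x v • (fderiv ℝ α x).flip w - α x w • (fderiv ℝ β x).flip v)) x := by
  have a := fun v => hα.hasFDerivAt.clm_apply (hasFDerivAt_const v x)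
  have b := fun v => hβ.hasFDerivAt.clm_apply (hasFDerivAt_const v x)
  refine (hf.hasFDerivAt.mul (((a v).mul (b w)).sub ((a w).mul (b v)))).congr_fderiv ?_
  ext z
  simp
  ring

/-! ### Para-Kähler-Einstein frames -/

/-- A null frame whose two null planes `⟨e₁, e₂⟩`, `⟨e₃, e₄⟩` are parallel, for an Einstein
metric. -/
structure IsParallelFrame (g : MetricField) (e : FrameField) (V : Set R4) : Prop
    extends IsNullFrame g e V where
  conn_two_one : ∀ x ∈ V, connForm g e 2 1 x = 0
  conn_zero_three : ∀ x ∈ V, connForm g e 0 3 x = 0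
  einstein : IsEinstein g V

theorem IsPKE.isNullFrame {U V : Set R4} {g : MetricField} {K : EndField} {e : FrameField}
    (h : IsPKE g K U) (hV : IsOpen V) (hVU : V ⊆ U) (he : IsF6Section g K V e) :
    IsNullFrame g e V where
  isOpen := hV
  smooth_g := h.almost.smooth_g.mono hVU
  symm x hx := h.almost.symm x (hVU hx)
  smooth_e := he.1
  orth x hx := (he.2 x hx).1.1

/-- Compatibility gives s²g(u, v) = -g(u, v) with s² = 1, so the eigenspaces are null. -/
theorem IsAlmostParaHermitian.eq_zero_of_eigen {U : Set R4} {g : MetricField} {K : EndField}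
    (h : IsAlmostParaHermitian g K U) {x : R4} (hx : x ∈ U) {s : ℝ} (hs : s * s = 1) {u v : R4}
    (hu : K x u = s • u) (hv : K x v = s • v) : g x u v = 0 := by
  have := h.compatible x hx u v
  rw [hu, hv] at this
  simp only [map_smul, smul_apply, smul_eq_mul, ← mul_assoc, hs] at this
  linarith

/-- The bracket [e_a, e_b] = ∇_{e_a} e_b - ∇_{e_b} e_a stays in the eigenspace of e_c, which is
null, so it is orthogonal to e_c. -/
theorem IsNullFrame.conn_eq_of_eigenIntegrable {V U : Set R4} {g : MetricField} {K : EndField}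
    {e : FrameField} (h : IsNullFrame g e V) (hK : IsAlmostParaHermitian g K U) (hVU : V ⊆ U)
    {s : ℝ} (hs : s * s = 1) (hint : EigenIntegrable K s U) {a b c : Fin 4}
    (ha : ∀ x ∈ V, K x (e a x) = s • e a x) (hb : ∀ x ∈ V, K x (e b x) = s • e b x)
    (hc : ∀ x ∈ V, K x (e c x) = s • e c x) {x : R4} (hx : x ∈ V) :
    connForm g e (dualIdx c) b x (e a x) = connForm g e (dualIdx c) a x (e b x) := by
  have h1 := hint V (e a) (e b) h.isOpen hVU (h.smooth_e a) (h.smooth_e b) ha hb x hx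
  have h2 := hK.eq_zero_of_eigen (hVU hx) hs (hc x hx) h1
  rw [VectorField.lieBracket, h.fderiv_frame hx, h.fderiv_frame hx,
    h.christoffel_symm hx (e b x)] at h2
  have h3 : ∀ d, g x (e c x) (e d x) = if dualIdx c = d then 1 else 0 := fun d => by
    rw [h.orth x hx]; simp [eta, eq_comm]
  simp [map_sub, h3] at h2
  linarith

theorem IsNullFrame.fundamentalForm_apply {V : Set R4} {g : MetricField} {K : EndField}
    {e : FrameField} (h : IsNullFrame g e V)
    (hK : ∀ x ∈ V, ∀ a, K x (e a x) = paraSign a • e a x) {x : R4} (hx : x ∈ V) (v w : R4) :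
    g x (K x v) w =
      (coframe g e 0 x v * coframe g e 2 x w - coframe g e 0 x w * coframe g e 2 x v)
      + (coframe g e 1 x v * coframe g e 3 x w - coframe g e 1 x w * coframe g e 3 x v) := by
  have h1 : ∀ d, g x (e d x) w = coframe g e (dualIdx d) x w := fun d => by simp [coframe]
  conv_lhs => rw [h.decomp hx v]
  simp only [map_add, add_apply, map_smul, hK x hx, smul_apply, h1, Fin.sum_univ_four, dualIdx,
    paraSign, Matrix.cons_val, smul_eq_mul]
  ring

namespace IsNullFrame

variable {g : MetricField} {e : FrameField} {V : Set R4}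

/-- The so(2,2) relations. Up to sign the only off-block entries are Γ³₂ and Γ¹₄, so the vanishing
of these two is exactly what parallel null planes require. -/
theorem conn_skew (h : IsNullFrame g e V) {x : R4} (hx : x ∈ V) :
    connForm g e 2 0 x = 0 ∧ connForm g e 3 1 x = 0 ∧ connForm g e 0 2 x = 0 ∧
    connForm g e 1 3 x = 0 ∧ connForm g e 3 0 x = -connForm g e 2 1 x ∧
    connForm g e 1 2 x = -connForm g e 0 3 x ∧ connForm g e 2 2 x = -connForm g e 0 0 x ∧
    connForm g e 3 3 x = -connForm g e 1 1 x ∧ connForm g e 2 3 x = -connForm g e 1 0 x ∧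
    connForm g e 3 2 x = -connForm g e 0 1 x := by
  have s := fun a b u => h.connForm_skew hx a b u
  refine ⟨?_, ?_, ?_, ?_, ?_, ?_, ?_, ?_, ?_, ?_⟩ <;> ext u <;>
    simp only [neg_apply, zero_apply]
  · linarith [show connForm g e 2 0 x u + connForm g e 2 0 x u = 0 from s 0 0 u]
  · linarith [show connForm g e 3 1 x u + connForm g e 3 1 x u = 0 from s 1 1 u]
  · linarith [show connForm g e 0 2 x u + connForm g e 0 2 x u = 0 from s 2 2 u]
  · linarith [show connForm g e 1 3 x u + connForm g e 1 3 x u = 0 from s 3 3 u]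
  · linarith [show connForm g e 2 1 x u + connForm g e 3 0 x u = 0 from s 0 1 u]
  · linarith [show connForm g e 0 3 x u + connForm g e 1 2 x u = 0 from s 2 3 u]
  · linarith [show connForm g e 2 2 x u + connForm g e 0 0 x u = 0 from s 0 2 u]
  · linarith [show connForm g e 3 3 x u + connForm g e 1 1 x u = 0 from s 1 3 u]
  · linarith [show connForm g e 2 3 x u + connForm g e 1 0 x u = 0 from s 0 3 u]
  · linarith [show connForm g e 3 2 x u + connForm g e 0 1 x u = 0 from s 1 2 u]

theorem torsion_frame (h : IsNullFrame g e V) {x : R4} (hx : x ∈ V) (a i j : Fin 4) :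
    fderiv ℝ (coframe g e a) x (e i x) (e j x) - fderiv ℝ (coframe g e a) x (e j x) (e i x) =
      connForm g e a i x (e j x) - connForm g e a j x (e i x) := by
  rw [h.torsion_free hx]
  simp [h.coframe_apply hx, Finset.sum_sub_distrib]

theorem clm_ext (h : IsNullFrame g e V) {x : R4} (hx : x ∈ V) {β γ : R4 →L[ℝ] ℝ}
    (hb : ∀ a, β (e a x) = γ (e a x)) : β = γ := by
  ext u
  rw [h.decomp hx u]
  simp [hb]

/-- Since ∇ is torsion free, dρ on each of the four triples of distinct frame vectors is, up to
sign, twice one coefficient of Γ³₂ or Γ¹₄. These are the coefficients that integrability does not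
reach. -/
theorem conn_eq_zero_of_closed {K : EndField} {U : Set R4} (h : IsNullFrame g e V)
    (hVU : V ⊆ U) (hK : ∀ x ∈ V, ∀ a, K x (e a x) = paraSign a • e a x)
    (hc : FundamentalFormClosed g K U) {x : R4} (hx : x ∈ V) :
    connForm g e 2 1 x (e 2 x) = 0 ∧ connForm g e 2 1 x (e 3 x) = 0 ∧
      connForm g e 0 3 x (e 0 x) = 0 ∧ connForm g e 0 3 x (e 1 x) = 0 := by
  have hd := fun a => h.differentiableAt (h.contDiffOn_coframe a) hx
  have hρ : ∀ u v w : R4, fderiv ℝ (fun y => g y (K y v) w) x u =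
      (fderiv ℝ (coframe g e 0) x u v * coframe g e 2 x w
        + coframe g e 0 x v * fderiv ℝ (coframe g e 2) x u w
        - fderiv ℝ (coframe g e 0) x u w * coframe g e 2 x v
        - coframe g e 0 x w * fderiv ℝ (coframe g e 2) x u v)
      + (fderiv ℝ (coframe g e 1) x u v * coframe g e 3 x w
        + coframe g e 1 x v * fderiv ℝ (coframe g e 3) x u w
        - fderiv ℝ (coframe g e 1) x u w * coframe g e 3 x v
        - coframe g e 1 x w * fderiv ℝ (coframe g e 3) x u v) := fun u v w => by
    rw [Filter.EventuallyEq.fderiv_eq (𝕜 := ℝ) (h.eventually hx fun y hy =>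
      h.fundamentalForm_apply hK hy v w)]
    have H := (fderiv_smul_wedge (differentiableAt_const (1 : ℝ)) (hd 0) (hd 2) v w).add
      (fderiv_smul_wedge (differentiableAt_const (1 : ℝ)) (hd 1) (hd 3) v w)
    simp only [one_mul] at H
    have H2 := congrArg (fun l => l u) H.fderiv
    refine H2.trans ?_
    simp
    ring
  have hcl := hc x (hVU hx)
  simp only [hρ] at hcl
  obtain ⟨c20, c31, c02, c13, c30, c12, c22, c33, c23, c32⟩ := h.conn_skew hx
  have T : ∀ a i j, fderiv ℝ (coframe g e a) x (e i x) (e j x)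
      - fderiv ℝ (coframe g e a) x (e j x) (e i x) - connForm g e a i x (e j x)
        + connForm g e a j x (e i x) = 0 := fun a i j => by
    rw [h.torsion_frame hx]; ring
  have h012 := hcl (e 0 x) (e 1 x) (e 2 x)
  have h013 := hcl (e 0 x) (e 1 x) (e 3 x)
  have h023 := hcl (e 0 x) (e 2 x) (e 3 x)
  have h123 := hcl (e 1 x) (e 2 x) (e 3 x)
  simp [h.coframe_apply hx] at h012 h013 h023 h123
  refine ⟨?_, ?_, ?_, ?_⟩
  · have t1 := T 0 0 1
    have t2 := T 2 1 2
    have t3 := T 3 0 2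
    simp only [c30, c22, c32, neg_apply] at t1 t2 t3
    linarith
  · have t1 := T 2 1 3
    have t2 := T 1 0 1
    have t3 := T 3 0 3
    simp only [c30, c33, c23, neg_apply] at t1 t2 t3
    linarith
  · have t1 := T 0 0 3
    have t2 := T 2 2 3
    have t3 := T 1 0 2
    simp only [c12, c22, c23, neg_apply] at t1 t2 t3
    linarith
  · have t1 := T 0 1 3
    have t2 := T 1 1 2
    have t3 := T 3 2 3
    simp only [c12, c33, c32, neg_apply] at t1 t2 t3
    linarith

end IsNullFrame

/-- Integrability kills Γ³₂ on e₁, e₂ and Γ¹₄ on e₃, e₄; closedness of ρ kills the complementary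
coefficients. -/
theorem IsPKE.isParallelFrame {U V : Set R4} {g : MetricField} {K : EndField} {e : FrameField}
    (h : IsPKE g K U) (hV : IsOpen V) (hVU : V ⊆ U) (he : IsF6Section g K V e) :
    IsParallelFrame g e V := by
  have hf := h.isNullFrame hV hVU he
  have hK : ∀ x ∈ V, ∀ a, K x (e a x) = paraSign a • e a x := fun x hx => (he.2 x hx).1.2
  have kp : ∀ a, paraSign a = 1 → ∀ x ∈ V, K x (e a x) = (1 : ℝ) • e a x :=
    fun a ha x hx => by rw [hK x hx, ha]
  have kn : ∀ a, paraSign a = -1 → ∀ x ∈ V, K x (e a x) = (-1 : ℝ) • e a x :=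
    fun a ha x hx => by rw [hK x hx, ha]
  have p0 := kp 0 rfl
  have p1 := kp 1 rfl
  have n2 := kn 2 rfl
  have n3 := kn 3 rfl
  refine ⟨hf, fun x hx => hf.clm_ext hx fun a => ?_, fun x hx => hf.clm_ext hx fun a => ?_,
    fun x hx => h.einstein x (hVU hx)⟩
  all_goals
    obtain ⟨c20, c31, c02, c13, c30, c12, -⟩ := hf.conn_skew hx
    obtain ⟨d1, d2, d3, d4⟩ := hf.conn_eq_zero_of_closed hVU hK h.closed hx
  · have q1 := hf.conn_eq_of_eigenIntegrable h.almost hVU (by norm_num) h.integrable_pos p0 p1 p0 hx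
    have q2 := hf.conn_eq_of_eigenIntegrable h.almost hVU (by norm_num) h.integrable_pos p0 p1 p1 hx
    simp [dualIdx, c20, c31, c30] at q1 q2
    fin_cases a <;> simp_all
  · have q1 := hf.conn_eq_of_eigenIntegrable h.almost hVU (by norm_num) h.integrable_neg n2 n3 n2 hx
    have q2 := hf.conn_eq_of_eigenIntegrable h.almost hVU (by norm_num) h.integrable_neg n2 n3 n3 hx
    simp [dualIdx, c02, c13, c12] at q1 q2
    fin_cases a <;> simp_all

namespace IsParallelFrame

variable {g : MetricField} {e : FrameField} {V : Set R4}

theorem conn (h : IsParallelFrame g e V) {x : R4} (hx : x ∈ V) :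
    connForm g e 2 0 x = 0 ∧ connForm g e 3 1 x = 0 ∧ connForm g e 0 2 x = 0 ∧
    connForm g e 1 3 x = 0 ∧ connForm g e 3 0 x = 0 ∧ connForm g e 1 2 x = 0 ∧
    connForm g e 2 1 x = 0 ∧ connForm g e 0 3 x = 0 ∧
    connForm g e 2 2 x = -connForm g e 0 0 x ∧ connForm g e 3 3 x = -connForm g e 1 1 x ∧
    connForm g e 2 3 x = -connForm g e 1 0 x ∧ connForm g e 3 2 x = -connForm g e 0 1 x := by
  have h1 := h.conn_two_one x hx
  have h2 := h.conn_zero_three x hx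
  simpa [h1, h2] using h.conn_skew hx

/-- Block diagonal connection forms have block diagonal curvature. -/
theorem riemComp_zero_one (h : IsParallelFrame g e V) {x : R4} (hx : x ∈ V) (c d : Fin 4) :
    riemComp g x (fun a => e a x) 0 1 c d = 0 ∧ riemComp g x (fun a => e a x) 2 3 c d = 0 := by
  have h0 : ∀ a b, (∀ y ∈ V, connForm g e a b y = 0) → fderiv ℝ (connForm g e a b) x = 0 :=
    fun a b hab => by
      rw [Filter.EventuallyEq.fderiv_eq (𝕜 := ℝ) (h.eventually hx hab)]
      exact fderiv_const_apply 0
  have d1 := h0 2 1 h.conn_two_one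
  have d2 := h0 0 3 h.conn_zero_three
  obtain ⟨c20, c31, c02, c13, c30, c12, c21, c03, -⟩ := h.conn hx
  rw [h.riemComp_eq hx, h.riemComp_eq hx, h.curvature hx, h.curvature hx]
  simp [dualIdx, Fin.sum_univ_four, d1, d2, c20, c31, c02, c13, c21, c03]

/-- The Ricci tensor of an Einstein metric in the frame. -/
theorem exists_ricciComp (h : IsParallelFrame g e V) {x : R4} (hx : x ∈ V) :
    ∃ r : ℝ, ∀ a b, ricciComp g x (fun a => e a x) a b = r * eta a b := by
  obtain ⟨r, hr⟩ := h.einstein x hx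
  exact ⟨r, fun a b => by rw [h.ricciComp_eq hx, hr, h.orth x hx]⟩

/-- The Weyl tensor of an Einstein metric. -/
theorem _root_.PKE.weylComp_of_ricciComp {x : R4} {f : Fin 4 → R4} {r : ℝ}
    (hr : ∀ a b, ricciComp g x f a b = r * eta a b) (a b c d : Fin 4) :
    weylComp g x f a b c d = riemComp g x f a b c d
      + r / 3 * (eta a d * eta b c - eta a c * eta b d) := by
  have hs : scalComp g x f = 4 * r := by
    simp only [scalComp, hr, Fin.sum_univ_four, eta, dualIdx]
    simp
    ring
  simp only [weylComp, schoutenComp, hr, hs, eta_symm c, eta_symm d]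
  ring

/-- Because R₁₂₃₄ = 0, the component C₁₂₃₄ consists of its trace part alone, which is -r/3 when Ric
= r g. -/
theorem ricciComp_eq_psi2' (h : IsParallelFrame g e V) {x : R4} (hx : x ∈ V) (a b : Fin 4) :
    ricciComp g x (fun a => e a x) a b = -3 * psi2' g x (fun a => e a x) * eta a b := by
  obtain ⟨r, hr⟩ := h.exists_ricciComp hx
  rw [hr, psi2', weylComp_of_ricciComp hr, (h.riemComp_zero_one hx 2 3).1]
  simp only [eta, dualIdx, Fin.isValue, Matrix.cons_val]
  simp
  left
  ring

theorem weylComp_eq (h : IsParallelFrame g e V) {x : R4} (hx : x ∈ V) (a b c d : Fin 4) :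
    weylComp g x (fun a => e a x) a b c d = riemComp g x (fun a => e a x) a b c d
      - psi2' g x (fun a => e a x) * (eta a d * eta b c - eta a c * eta b d) := by
  rw [weylComp_of_ricciComp (h.ricciComp_eq_psi2' hx)]
  ring

end IsParallelFrame

/-! ### Curvature forms of a reduced frame -/

/-- The value of `α ∧ β` on two vectors. -/
def wedge2 {E : Type*} [NormedAddCommGroup E] [NormedSpace ℝ E] (α β : E →L[ℝ] ℝ) (u v : E) : ℝ :=
  α u * β v - α v * β u

/-- The value of `dα` on two vectors. -/
def dOne {E : Type*} [NormedAddCommGroup E] [NormedSpace ℝ E] (α : E → E →L[ℝ] ℝ) (x u v : E) : ℝ :=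
  fderiv ℝ α x u v - fderiv ℝ α x v u

/-- The second exterior derivative of a one-form vanishes. -/
theorem cyclic_fderiv_dOne {E : Type*} [NormedAddCommGroup E] [NormedSpace ℝ E]
    {α : E → E →L[ℝ] ℝ} {x : E} (hα : ContDiffAt ℝ ∞ α x) (u v w : E) :
    fderiv ℝ (fun y => dOne α y v w) x u + fderiv ℝ (fun y => dOne α y w u) x v
      + fderiv ℝ (fun y => dOne α y u v) x w = 0 := by
  have hs := hα.isSymmSndFDerivAt (by simpa using WithTop.coe_le_coe.2 (le_top : (2 : ℕ∞) ≤ ⊤))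
  have hd : DifferentiableAt ℝ (fderiv ℝ α) x :=
    (hα.fderiv_right (m := 1) (by exact WithTop.coe_le_coe.2 le_top)).differentiableAt (by simp)
  have h1 : ∀ v w : E, HasFDerivAt (fun y => fderiv ℝ α y v w)
      (((fderiv ℝ (fderiv ℝ α) x).flip v).flip w) x := by
    intro v w
    refine ((hd.hasFDerivAt.clm_apply (hasFDerivAt_const v x)).clm_apply
      (hasFDerivAt_const w x)).congr_fderiv ?_
    ext z; simp
  have h2 : ∀ u v w : E, fderiv ℝ (fun y => dOne α y v w) x u =
      fderiv ℝ (fderiv ℝ α) x u v w - fderiv ℝ (fderiv ℝ α) x u w v := by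
    intro u v w
    simp only [dOne]
    rw [((h1 v w).fun_sub (h1 w v)).fderiv]
    simp
  rw [h2, h2, h2, hs.eq u v, hs.eq u w, hs.eq v w]
  ring

/-- `d(f α ∧ β) = df ∧ α ∧ β + f dα ∧ β - f α ∧ dβ`. -/
theorem cyclic_fderiv_smul_wedge {E : Type*} [NormedAddCommGroup E] [NormedSpace ℝ E]
    {f : E → ℝ} {α β : E → E →L[ℝ] ℝ} {x : E}
    (hf : DifferentiableAt ℝ f x) (hα : DifferentiableAt ℝ α x) (hβ : DifferentiableAt ℝ β x)
    (u v w : E) :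
    fderiv ℝ (fun y => f y * wedge2 (α y) (β y) v w) x u
      + fderiv ℝ (fun y => f y * wedge2 (α y) (β y) w u) x v
      + fderiv ℝ (fun y => f y * wedge2 (α y) (β y) u v) x w =
    fderiv ℝ f x u * wedge2 (α x) (β x) v w + fderiv ℝ f x v * wedge2 (α x) (β x) w u
      + fderiv ℝ f x w * wedge2 (α x) (β x) u v
      + f x * (dOne α x u v * β x w + dOne α x v w * β x u + dOne α x w u * β x v
        - (α x u * dOne β x v w + α x v * dOne β x w u + α x w * dOne β x u v)) := by
  simp only [wedge2]
  rw [(fderiv_smul_wedge hf hα hβ v w).fderiv, (fderiv_smul_wedge hf hα hβ w u).fderiv,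
    (fderiv_smul_wedge hf hα hβ u v).fderiv]
  simp [dOne]
  ring

theorem differentiableAt_smul_wedge2 {E : Type*} [NormedAddCommGroup E] [NormedSpace ℝ E]
    {f : E → ℝ} {α β : E → E →L[ℝ] ℝ} {x : E}
    (hf : DifferentiableAt ℝ f x) (hα : DifferentiableAt ℝ α x) (hβ : DifferentiableAt ℝ β x)
    (v w : E) : DifferentiableAt ℝ (fun y => f y * wedge2 (α y) (β y) v w) x :=
  (fderiv_smul_wedge hf hα hβ v w).differentiableAt

namespace IsNullFrame

variable {g : MetricField} {e : FrameField} {V : Set R4}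

theorem dOne_coframe (h : IsNullFrame g e V) {x : R4} (hx : x ∈ V) (a : Fin 4) (u v : R4) :
    dOne (coframe g e a) x u v = -∑ b, wedge2 (connForm g e a b x) (coframe g e b x) u v :=
  h.torsion_free hx a u v

theorem contDiffOn_riemComp (h : IsNullFrame g e V) (a b c d : Fin 4) :
    ContDiffOn ℝ ∞ (fun x => riemComp g x (fun a => e a x) a b c d) V := by
  have hC := h.contDiffOn_christoffel
  have hD : ContDiffOn ℝ ∞ (fderiv ℝ (christoffel g)) V :=
    hC.fderiv_of_isOpen h.isOpen (by simp)
  have he := h.smooth_e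
  refine ContDiffOn.congr (f := fun x => g x (fderiv ℝ (christoffel g) x (e c x) (e d x) (e b x)
    - fderiv ℝ (christoffel g) x (e d x) (e c x) (e b x)
      + christoffel g x (e c x) (christoffel g x (e d x) (e b x))
      - christoffel g x (e d x) (christoffel g x (e c x) (e b x))) (e a x)) ?_ ?_
  · refine (h.smooth_g.clm_apply ?_).clm_apply (he a)
    refine ContDiffOn.sub (ContDiffOn.add (ContDiffOn.sub ?_ ?_) ?_) ?_
    · exact ((hD.clm_apply (he c)).clm_apply (he d)).clm_apply (he b)
    · exact ((hD.clm_apply (he d)).clm_apply (he c)).clm_apply (he b)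
    · exact (hC.clm_apply (he c)).clm_apply ((hC.clm_apply (he d)).clm_apply (he b))
    · exact (hC.clm_apply (he d)).clm_apply ((hC.clm_apply (he c)).clm_apply (he b))
  · intro x hx
    simp only [riemComp, h.riem_eq hx]

theorem contDiffOn_ricciComp (h : IsNullFrame g e V) (a b : Fin 4) :
    ContDiffOn ℝ ∞ (fun x => ricciComp g x (fun a => e a x) a b) V :=
  ContDiffOn.sum fun _ _ => h.contDiffOn_riemComp _ _ _ _

theorem contDiffOn_weylComp (h : IsNullFrame g e V) (a b c d : Fin 4) :
    ContDiffOn ℝ ∞ (fun x => weylComp g x (fun a => e a x) a b c d) V := by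
  have hS : ∀ a b, ContDiffOn ℝ ∞ (fun x => schoutenComp g x (fun a => e a x) a b) V := by
    intro a b
    have hs : ContDiffOn ℝ ∞ (fun x => scalComp g x (fun a => e a x)) V :=
      ContDiffOn.sum fun c _ => h.contDiffOn_ricciComp _ _
    exact (contDiffOn_const.mul (h.contDiffOn_ricciComp a b)).sub
      ((contDiffOn_const.mul hs).mul contDiffOn_const)
  exact ((((h.contDiffOn_riemComp a b c d).add (contDiffOn_const.mul (hS c b))).sub
    (contDiffOn_const.mul (hS d b))).add (contDiffOn_const.mul (hS d a))).sub
    (contDiffOn_const.mul (hS c a))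

/-- The curvature form `R^a_b` in the basis `θ^c ∧ θ^d`, `c < d`. -/
theorem curvature_form (h : IsNullFrame g e V) {x : R4} (hx : x ∈ V) (a b : Fin 4) (u v : R4) :
    dOne (connForm g e (dualIdx a) b) x u v
        + ∑ c, wedge2 (connForm g e (dualIdx a) c x) (connForm g e c b x) u v =
      riemComp g x (fun a => e a x) a b 0 1 * wedge2 (coframe g e 0 x) (coframe g e 1 x) u v
      + riemComp g x (fun a => e a x) a b 0 2 * wedge2 (coframe g e 0 x) (coframe g e 2 x) u v
      + riemComp g x (fun a => e a x) a b 0 3 * wedge2 (coframe g e 0 x) (coframe g e 3 x) u v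
      + riemComp g x (fun a => e a x) a b 1 2 * wedge2 (coframe g e 1 x) (coframe g e 2 x) u v
      + riemComp g x (fun a => e a x) a b 1 3 * wedge2 (coframe g e 1 x) (coframe g e 3 x) u v
      + riemComp g x (fun a => e a x) a b 2 3 * wedge2 (coframe g e 2 x) (coframe g e 3 x) u v := by
  have h1 := h.curvature hx (dualIdx a) b u v
  rw [h.coframe_riem hx, dualIdx_dualIdx] at h1
  simp only [dOne, wedge2]
  rw [← h1]
  have s := fun c d => riemComp_skew_right (g := g) (x := x) (f := fun a => e a x) a b c d
  have s0 : ∀ c, riemComp g x (fun a => e a x) a b c c = 0 := fun c => by linarith [s c c]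
  simp only [Fin.sum_univ_four, s 1 0, s 2 0, s 3 0, s 2 1, s 3 1, s 3 2, s0]
  ring

end IsNullFrame

namespace IsParallelFrame

variable {g : MetricField} {e : FrameField} {V : Set R4}

/-- The first five come from the definition of the Weyl components. The others follow from the Ricci
components R₁₄ = R₂₃ = 0 and R₁₃ = R₂₄ = -3Ψ₂', together with one cyclic identity for R₁₃₂₄. -/
theorem riemComp_values (h : IsParallelFrame g e V) {x : R4} (hx : x ∈ V) {f : Fin 4 → R4}
    (hf : f = fun a => e a x) :
    riemComp g x f 0 3 0 3 = psi g x f 0 ∧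
    riemComp g x f 1 3 0 3 = psi g x f 1 ∧
    riemComp g x f 0 3 1 2 = psi2' g x f - psi g x f 2 ∧
    riemComp g x f 0 2 1 2 = psi g x f 3 ∧
    riemComp g x f 1 2 1 2 = psi g x f 4 ∧
    riemComp g x f 0 2 0 3 = -psi g x f 1 ∧
    riemComp g x f 1 3 1 2 = -psi g x f 3 ∧
    riemComp g x f 0 2 1 3 = psi2' g x f - psi g x f 2 ∧
    riemComp g x f 0 2 0 2 = 2 * psi2' g x f + psi g x f 2 ∧
    riemComp g x f 1 3 1 3 = 2 * psi2' g x f + psi g x f 2 := by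
  subst hf
  have w := h.weylComp_eq hx
  have r := h.ricciComp_eq_psi2' hx
  have z0 := fun c d => (h.riemComp_zero_one hx c d).1
  have z2 := fun c d => (h.riemComp_zero_one hx c d).2
  have sl := h.riemComp_skew_left hx
  have sr := fun a b c d => riemComp_skew_right (g := g) (x := x) (f := fun a => e a x) a b c d
  have ps := h.riemComp_pair_symm hx
  have cy := fun a b c d => h.riemComp_cyclic hx (f := fun a => e a x) a b c d
  have w0 := w 0 3 0 3
  have w1 := w 1 3 0 3
  have w2 := w 0 3 1 2
  have w3 := w 0 2 1 2
  have w4 := w 1 2 1 2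
  have r02 := r 0 2
  have r13 := r 1 3
  have r03 := r 0 3
  have r12 := r 1 2
  simp [eta, dualIdx] at w0 w1 w2 w3 w4
  simp [ricciComp, eta, dualIdx, Fin.sum_univ_four] at r02 r13 r03 r12
  simp only [psi, Matrix.cons_val]
  have a1 := cy 0 2 1 3
  have d : ∀ a c d, riemComp g x (fun a => e a x) a a c d = 0 := fun a c d => by
    linarith [sl a a c d]
  have d' : ∀ a c d, riemComp g x (fun a => e a x) c d a a = 0 := fun a c d => by
    linarith [sr c d a a]
  refine ⟨?_, ?_, ?_, ?_, ?_, ?_, ?_, ?_, ?_, ?_⟩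
  · linarith
  · linarith
  · linarith
  · linarith
  · linarith
  · linarith [sl 2 0 0 3, sl 3 0 1 3, d 0 2 3, sl 1 0 3 3, d' 3 1 0, ps 1 3 0 3]
  · linarith [sl 2 1 0 2, sl 3 1 1 2, d 1 3 2, sl 0 1 2 2, d' 2 0 1, ps 0 2 1 2, sr 2 1 0 2]
  · linarith [sr 0 3 2 1, z0 3 2, sr 0 1 3 2]
  · linarith [sl 2 0 0 2, sl 3 0 1 2, d 0 2 2, z0 2 2, sl 1 0 3 2, z0 3 2]
  · linarith [sl 2 1 0 3, sl 3 1 1 3, d 1 3 3, z0 2 3, ps 1 2 0 3, d' 3 1 2]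

/-- `Ψ₀ = Ψ₁ = Ψ₃ = 0` on `V`. -/
def IsReduced (g : MetricField) (e : FrameField) (V : Set R4) : Prop :=
  ∀ x ∈ V, psi g x (fun a => e a x) 0 = 0 ∧ psi g x (fun a => e a x) 1 = 0 ∧
    psi g x (fun a => e a x) 3 = 0

/-- Pair symmetry with `riemComp_zero_one` removes the θ¹∧θ² and θ³∧θ⁴ components, and Ψ₀ = Ψ₁ = Ψ₃
= 0 removes all others except those shown. The equivalence with Yang-Mills uses the curvature only
through these four equations. -/
theorem curvature_reduced (h : IsParallelFrame g e V) (h0 : IsReduced g e V) {x : R4} (hx : x ∈ V)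
    {p q r : ℝ} (hp : p = psi2' g x (fun a => e a x)) (hq : q = psi g x (fun a => e a x) 2)
    (hr : r = psi g x (fun a => e a x) 4) (u v : R4) :
    dOne (connForm g e 0 0) x u v + wedge2 (connForm g e 0 1 x) (connForm g e 1 0 x) u v =
      -(2 * p + q) * wedge2 (coframe g e 0 x) (coframe g e 2 x) u v
        - (p - q) * wedge2 (coframe g e 1 x) (coframe g e 3 x) u v ∧
    dOne (connForm g e 1 1) x u v + wedge2 (connForm g e 1 0 x) (connForm g e 0 1 x) u v =
      -(p - q) * wedge2 (coframe g e 0 x) (coframe g e 2 x) u v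
        - (2 * p + q) * wedge2 (coframe g e 1 x) (coframe g e 3 x) u v ∧
    dOne (connForm g e 0 1) x u v + wedge2 (connForm g e 0 0 x) (connForm g e 0 1 x) u v
        + wedge2 (connForm g e 0 1 x) (connForm g e 1 1 x) u v =
      -(p - q) * wedge2 (coframe g e 0 x) (coframe g e 3 x) u v
        - r * wedge2 (coframe g e 1 x) (coframe g e 2 x) u v ∧
    dOne (connForm g e 1 0) x u v + wedge2 (connForm g e 1 0 x) (connForm g e 0 0 x) u v
        + wedge2 (connForm g e 1 1 x) (connForm g e 1 0 x) u v =
      -(p - q) * wedge2 (coframe g e 1 x) (coframe g e 2 x) u v := by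
  obtain ⟨v1, v2, v3, v4, v5, v6, v7, v8, v9, v10⟩ := h.riemComp_values hx rfl
  obtain ⟨y0, y1, y3⟩ := h0 x hx
  obtain ⟨c20, c31, c02, c13, c30, c12, c21, c03, -⟩ := h.conn hx
  have z0 := fun c d => (h.riemComp_zero_one hx c d).1
  have z2 := fun c d => (h.riemComp_zero_one hx c d).2
  have zp0 := fun a b => (h.riemComp_pair_symm hx a b 0 1).trans (z0 a b)
  have zp2 := fun a b => (h.riemComp_pair_symm hx a b 2 3).trans (z2 a b)
  have sl := h.riemComp_skew_left hx
  have ps := h.riemComp_pair_symm hx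
  have f1 := h.curvature_form hx 2 0 u v
  have f2 := h.curvature_form hx 3 1 u v
  have f3 := h.curvature_form hx 2 1 u v
  have f4 := h.curvature_form hx 3 0 u v
  rw [y0] at v1
  rw [y1] at v2 v6
  rw [y3] at v4 v7
  rw [← hp, ← hq] at v3 v8 v9 v10
  rw [← hr] at v5
  have wz : ∀ (α : R4 →L[ℝ] ℝ) (u v : R4), wedge2 α α u v = 0 := fun α u v => by
    simp [wedge2]; ring
  simp only [dualIdx, Matrix.cons_val, Fin.sum_univ_four, zp0, zp2, sl 2 0, sl 3 1, sl 2 1,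
    sl 3 0, v9, v6, v4, v8, v10, v2, v7, v1, v3, v5, ps 1 3 0 2, ps 1 2 0 2, ps 1 2 0 3, ps 1 2 1 3,
    ps 0 3 0 2, ps 0 3 1 3, c20, c31, c02, c13, c30, c12, c21, c03, wz] at f1 f2 f3 f4
  exact ⟨by linarith, by linarith, by linarith, by linarith⟩

end IsParallelFrame

/-! ### Consequences of d² = 0 for the curvature equations -/

/-- The identity `d² = 0` for a one-form whose exterior derivative is given. -/
theorem cyclic_eq_zero_of_dOne_eq {E ι : Type*} [NormedAddCommGroup E] [NormedSpace ℝ E]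
    [Fintype ι] {γ : E → E →L[ℝ] ℝ} {x : E} (hγ : ContDiffAt ℝ ∞ γ x) {f : ι → E → ℝ}
    {α β : ι → E → E →L[ℝ] ℝ} (hf : ∀ i, DifferentiableAt ℝ (f i) x)
    (hα : ∀ i, DifferentiableAt ℝ (α i) x) (hβ : ∀ i, DifferentiableAt ℝ (β i) x)
    (heq : ∀ᶠ y in nhds x, ∀ v w, dOne γ y v w = ∑ i, f i y * wedge2 (α i y) (β i y) v w)
    (u v w : E) :
    ∑ i, (fderiv ℝ (f i) x u * wedge2 (α i x) (β i x) v w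
        + fderiv ℝ (f i) x v * wedge2 (α i x) (β i x) w u
        + fderiv ℝ (f i) x w * wedge2 (α i x) (β i x) u v
      + f i x * (dOne (α i) x u v * β i x w + dOne (α i) x v w * β i x u
          + dOne (α i) x w u * β i x v
        - (α i x u * dOne (β i) x v w + α i x v * dOne (β i) x w u
          + α i x w * dOne (β i) x u v))) = 0 := by
  have h1 : ∀ u v w, fderiv ℝ (fun y => dOne γ y v w) x u =
      ∑ i, fderiv ℝ (fun y => f i y * wedge2 (α i y) (β i y) v w) x u := by
    intro u v w
    rw [Filter.EventuallyEq.fderiv_eq (𝕜 := ℝ) (heq.mono fun y hy => hy v w), fderiv_fun_sum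
      fun i _ => differentiableAt_smul_wedge2 (hf i) (hα i) (hβ i) v w]
    simp
  have h2 := cyclic_fderiv_dOne hγ u v w
  rw [h1, h1, h1, ← Finset.sum_add_distrib, ← Finset.sum_add_distrib] at h2
  rw [← h2]
  exact Finset.sum_congr rfl fun i _ => (cyclic_fderiv_smul_wedge (hf i) (hα i) (hβ i) u v w).symm

namespace IsParallelFrame

variable {g : MetricField} {e : FrameField} {V : Set R4}

/-- `Ψ₂'` is locally constant. -/
theorem fderiv_psi2' (h : IsParallelFrame g e V) (h0 : IsReduced g e V) {x : R4} (hx : x ∈ V) :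
    fderiv ℝ (fun y => psi2' g y (fun a => e a y)) x = 0 := by
  have hG := fun a b => h.contDiffOn_connForm a b
  have hθ := fun a => h.differentiableAt (h.contDiffOn_coframe a) hx
  have hp : DifferentiableAt ℝ (fun y => psi2' g y (fun a => e a y)) x :=
    h.differentiableAt (h.contDiffOn_weylComp 0 1 2 3) hx
  -- In the sum of the first two curvature equations the products of Γ¹₂ and Γ²₁ cancel, so d(Γ¹₁ +
  -- Γ²₂) = -3Ψ₂'ρ. As ρ is closed, d² = 0 leaves dΨ₂'∧ρ = 0.
  have H := cyclic_eq_zero_of_dOne_eq (ι := Fin 2)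
    (γ := fun y => connForm g e 0 0 y + connForm g e 1 1 y)
    (f := fun _ y => psi2' g y (fun a => e a y))
    (α := ![fun y => (-3 : ℝ) • coframe g e 0 y, fun y => (-3 : ℝ) • coframe g e 1 y])
    (β := ![coframe g e 2, coframe g e 3])
    (((hG 0 0).add (hG 1 1)).contDiffAt (h.isOpen.mem_nhds hx)) (fun _ => hp)
    (fun i => by
      fin_cases i
      · exact (hθ 0).const_smul (-3 : ℝ)
      · exact (hθ 1).const_smul (-3 : ℝ))
    (fun i => by fin_cases i <;> exact hθ _)
    (h.eventually hx fun y hy v w => by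
      obtain ⟨k1, k2, -⟩ := h.curvature_reduced h0 hy rfl rfl rfl v w
      have hd : dOne (fun y => connForm g e 0 0 y + connForm g e 1 1 y) y v w =
          dOne (connForm g e 0 0) y v w + dOne (connForm g e 1 1) y v w := by
        simp only [dOne]
        rw [fderiv_fun_add (h.differentiableAt (hG 0 0) hy) (h.differentiableAt (hG 1 1) hy)]
        simp only [add_apply]
        ring
      rw [hd]
      simp [Fin.sum_univ_two, wedge2] at k1 k2 ⊢
      linarith)
  have hd : ∀ a u v, dOne (fun y => (-3 : ℝ) • coframe g e a y) x u v
      = -3 * dOne (coframe g e a) x u v := fun a u v => by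
    simp only [dOne]
    rw [fderiv_fun_const_smul (hθ a)]
    simp
    ring
  obtain ⟨c20, c31, c02, c13, c30, c12, c21, c03, c22, c33, c23, c32⟩ := h.conn hx
  refine h.clm_ext hx fun a => ?_
  -- Wedging with ρ is injective on one-forms: for each e_a, one of the pairs (e₁, e₃), (e₂, e₄)
  -- does not contain e_a, and ρ is 1 on it.
  have Ha := H (e 0 x) (e 2 x) (e a x)
  have Hb := H (e 1 x) (e 3 x) (e a x)
  simp only [Fin.sum_univ_two, Matrix.cons_val_zero, Matrix.cons_val_one, hd,
    h.dOne_coframe hx] at Ha Hb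
  fin_cases a <;>
  · simp [wedge2, h.coframe_apply hx, c20, c31, c02, c13, c30, c12, c21, c03,
      c22, c33, c23, c32] at Ha Hb ⊢
    linarith

/-- These are Bianchi identities, obtained by applying d to the equation for dΓ²₁. They confine Γ²₁
to the span of θ² and θ³. -/
theorem connForm_one_zero_apply (h : IsParallelFrame g e V) (h0 : IsReduced g e V) {x : R4}
    (hx : x ∈ V) (hq : psi g x (fun a => e a x) 2 ≠ 0) :
    connForm g e 1 0 x (e 0 x) = 0 ∧ connForm g e 1 0 x (e 3 x) = 0 := by
  have hG := fun a b => h.contDiffOn_connForm a b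
  have hG' := fun a b => h.differentiableAt (h.contDiffOn_connForm a b) hx
  have hθ := fun a => h.differentiableAt (h.contDiffOn_coframe a) hx
  have hp : DifferentiableAt ℝ (fun y => psi2' g y (fun a => e a y)) x :=
    h.differentiableAt (h.contDiffOn_weylComp 0 1 2 3) hx
  have hq' : DifferentiableAt ℝ (fun y => psi g y (fun a => e a y) 2) x :=
    (h.differentiableAt (h.contDiffOn_weylComp 0 3 1 2) hx).neg
  have H := cyclic_eq_zero_of_dOne_eq (ι := Fin 3) (γ := connForm g e 1 0)
    (f := ![fun y => psi g y (fun a => e a y) 2 - psi2' g y (fun a => e a y), fun _ => -1,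
      fun _ => -1])
    (α := ![coframe g e 1, connForm g e 1 0, connForm g e 1 1])
    (β := ![coframe g e 2, connForm g e 0 0, connForm g e 1 0])
    ((hG 1 0).contDiffAt (h.isOpen.mem_nhds hx))
    (fun i => by
      fin_cases i
      · exact hq'.sub hp
      all_goals exact differentiableAt_const _)
    (fun i => by fin_cases i <;> first | exact hθ _ | exact hG' _ _)
    (fun i => by fin_cases i <;> first | exact hθ _ | exact hG' _ _)
    (h.eventually hx fun y hy v w => by
      obtain ⟨-, -, -, k⟩ := h.curvature_reduced h0 hy rfl rfl rfl v w
      simp only [Fin.sum_univ_three, Matrix.cons_val]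
      linarith)
  obtain ⟨c20, c31, c02, c13, c30, c12, c21, c03, c22, c33, c23, c32⟩ := h.conn hx
  have k := h.curvature_reduced h0 hx rfl rfl rfl
  have k1 := fun u v => eq_sub_of_add_eq (k u v).1
  have k2 := fun u v => eq_sub_of_add_eq (k u v).2.1
  have k4 := fun u v => eq_sub_of_add_eq (eq_sub_of_add_eq (k u v).2.2.2)
  -- The form θ²∧θ³ vanishes on all pairs from (e₁, e₂, e₄) and from (e₁, e₃, e₄), so the
  -- derivatives of Ψ₂ and Ψ₂' drop out. Up to sign, what remains is 3Ψ₂ times a single coefficient.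
  have H1 := H (e 0 x) (e 1 x) (e 3 x)
  have H2 := H (e 0 x) (e 2 x) (e 3 x)
  simp only [Fin.sum_univ_three, Matrix.cons_val, h.dOne_coframe hx, k1, k2, k4,
    Fin.sum_univ_four, wedge2, h.coframe_apply hx, c20, c13, c12, c21, c22, c23] at H1 H2
  simp at H1 H2
  constructor
  · refine (mul_eq_zero.mp (?_ : psi g x (fun a => e a x) 2 * _ = 0)).resolve_left hq
    linear_combination (1 / 3) * H1
  · refine (mul_eq_zero.mp (?_ : psi g x (fun a => e a x) 2 * _ = 0)).resolve_left hq
    linear_combination (-1 / 3) * H2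

end IsParallelFrame

/-! ### Differential forms on the bundle -/

theorem ext_two {w w' : Tot [⋀^Fin 2]→L[ℝ] ℝ} (h : ∀ u v, w ![u, v] = w' ![u, v]) : w = w' := by
  ext m
  have : m = ![m 0, m 1] := by ext i <;> fin_cases i <;> rfl
  rw [this, h]

theorem ext_three {w w' : Tot [⋀^Fin 3]→L[ℝ] ℝ} (h : ∀ u v z, w ![u, v, z] = w' ![u, v, z]) :
    w = w' := by
  ext m
  have : m = ![m 0, m 1, m 2] := by ext i <;> fin_cases i <;> rfl
  rw [this, h]

theorem two_swap (w : Tot [⋀^Fin 2]→L[ℝ] ℝ) (u v : Tot) : w ![u, v] = -w ![v, u] := by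
  have h := w.map_swap ![v, u] (i := 0) (j := 1) (by decide)
  refine Eq.trans ?_ h
  change w _ = w _
  congr 1
  ext i <;> fin_cases i <;> rfl

theorem wedge_oneForm_eq (β γ : Tot →L[ℝ] ℝ) (u v : Tot) :
    wedge β (oneForm γ) ![u, v] = wedge2 β γ u v :=
  wedge_oneForm_apply β γ u v

theorem removeNth_three {E : Type*} (u v z : E) :
    (Fin.removeNth 0 ![u, v, z] : Fin 2 → E) = ![v, z] ∧
    (Fin.removeNth 1 ![u, v, z] : Fin 2 → E) = ![u, z] ∧
    (Fin.removeNth 2 ![u, v, z] : Fin 2 → E) = ![u, v] := by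
  refine ⟨?_, ?_, ?_⟩ <;> ext i <;> fin_cases i <;> rfl

theorem wedge_two_apply (β : Tot →L[ℝ] ℝ) (w : Tot [⋀^Fin 2]→L[ℝ] ℝ) (u v z : Tot) :
    wedge β w ![u, v, z] = β u * w ![v, z] + β v * w ![z, u] + β z * w ![u, v] := by
  obtain ⟨h0, h1, h2⟩ := removeNth_three u v z
  rw [wedge, ContinuousAlternatingMap.alternatizeUncurryFin_apply, Fin.sum_univ_three, h0, h1, h2,
    two_swap w z u]
  simp

/-- A bridge from `extDeriv` to `dOne`; with it the form computations become polynomial identities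
in the values of one-forms. -/
theorem extDeriv_oneForm_apply {β : Tot → Tot →L[ℝ] ℝ} {p : Tot} (hβ : DifferentiableAt ℝ β p)
    (u v : Tot) : extDeriv (fun q => oneForm (β q)) p ![u, v] = dOne β p u v := by
  have h1 : DifferentiableAt ℝ (fun q => oneForm (β q)) p :=
    ((ContinuousAlternatingMap.ofSubsingletonLIE (𝕜 := ℝ) (E := Tot) (F := ℝ)
      (0 : Fin 1)).toContinuousLinearEquiv.differentiableAt).comp p hβ
  have h2 : ∀ v, HasFDerivAt (fun q => β q v) ((fderiv ℝ β p).flip v) p := fun v => by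
    refine (hβ.hasFDerivAt.clm_apply (hasFDerivAt_const v p)).congr_fderiv ?_
    ext z <;> simp
  have e : ∀ (q : Tot) (m : Fin 1 → Tot), oneForm (β q) m = β q (m 0) := fun q m => by
    simp [oneForm]
  rw [extDeriv_apply h1, Fin.sum_univ_two]
  simp only [e, Fin.removeNth, Fin.succAbove]
  simp [(h2 _).fderiv, dOne, sub_eq_add_neg]

theorem extDeriv_two_apply {w : Tot → Tot [⋀^Fin 2]→L[ℝ] ℝ} {p : Tot}
    (hw : DifferentiableAt ℝ w p) (u v z : Tot) :
    extDeriv w p ![u, v, z] = fderiv ℝ (fun q => w q ![v, z]) p u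
      + fderiv ℝ (fun q => w q ![z, u]) p v + fderiv ℝ (fun q => w q ![u, v]) p z := by
  obtain ⟨h0, h1, h2⟩ := removeNth_three u v z
  have hs : (fun q => w q ![z, u]) = fun q => -w q ![u, z] := funext fun q => two_swap _ _ _
  rw [extDeriv_apply hw, Fin.sum_univ_three, h0, h1, h2, hs, fderiv_fun_neg]
  simp

theorem contDiffAt_oneForm {β : Tot → Tot →L[ℝ] ℝ} {p : Tot} (hβ : ContDiffAt ℝ ∞ β p) :
    ContDiffAt ℝ ∞ (fun q => oneForm (β q)) p :=
  (ContinuousAlternatingMap.ofSubsingletonLIE (𝕜 := ℝ) (E := Tot) (F := ℝ)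
      (0 : Fin 1)).toContinuousLinearEquiv.contDiff.contDiffAt.comp p hβ

theorem contDiffAt_wedge {n : ℕ} {β : Tot → Tot →L[ℝ] ℝ} {w : Tot → Tot [⋀^Fin n]→L[ℝ] ℝ} {p : Tot}
    (hβ : ContDiffAt ℝ ∞ β p) (hw : ContDiffAt ℝ ∞ w p) :
    ContDiffAt ℝ ∞ (fun q => wedge (β q) (w q)) p :=
  (ContinuousAlternatingMap.alternatizeUncurryFinCLM ℝ Tot ℝ).contDiff.contDiffAt.comp p
    (hβ.smulRight hw)

theorem extDeriv_wedge_apply {β γ : Tot → Tot →L[ℝ] ℝ} {p : Tot}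
    (hβ : ContDiffAt ℝ ∞ β p) (hγ : ContDiffAt ℝ ∞ γ p) (u v z : Tot) :
    extDeriv (fun q => wedge (β q) (oneForm (γ q))) p ![u, v, z] =
      dOne β p u v * γ p z + dOne β p v z * γ p u + dOne β p z u * γ p v
        - (β p u * dOne γ p v z + β p v * dOne γ p z u + β p z * dOne γ p u v) := by
  rw [extDeriv_two_apply ((contDiffAt_wedge hβ (contDiffAt_oneForm hγ)).differentiableAt (by simp))]
  simp only [wedge_oneForm_eq]
  have h := cyclic_fderiv_smul_wedge (differentiableAt_const (1 : ℝ))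
    (hβ.differentiableAt (by simp)) (hγ.differentiableAt (by simp)) u v z
  simp only [one_mul] at h
  rw [h]
  simp

/-- The Bianchi identity `D(dB + B ∧ B) = 0`. -/
theorem bianchi {B : Fin 4 → Fin 4 → Tot → Tot →L[ℝ] ℝ} {p : Tot}
    (hB : ∀ i j, ContDiffAt ℝ ∞ (B i j) p) {S : Fin 4 → Fin 4 → Tot → Tot [⋀^Fin 2]→L[ℝ] ℝ}
    (hS : ∀ i j, S i j = fun q => extDeriv (fun q => oneForm (B i j q)) q
      + ∑ k, wedge (B i k q) (oneForm (B k j q))) (i j : Fin 4) :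
    extDeriv (S i j) p + ∑ k, (wedge (B i k p) (S k j p) - wedge (B k j p) (S i k p)) = 0 := by
  have hd := fun i j => (hB i j).differentiableAt (by simp : (∞ : WithTop ℕ∞) ≠ 0)
  have hw : ∀ i j k, ContDiffAt ℝ ∞ (fun q => wedge (B i k q) (oneForm (B k j q))) p :=
    fun i j k => contDiffAt_wedge (hB i k) (contDiffAt_oneForm (hB k j))
  have he : ContDiffAt ℝ ∞ (extDeriv (fun q => oneForm (B i j q))) p :=
    (ContinuousAlternatingMap.alternatizeUncurryFinCLM ℝ Tot ℝ).contDiff.contDiffAt.comp p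
      ((contDiffAt_oneForm (hB i j)).fderiv_right (by simp))
  have hSv : ∀ i j u v, S i j p ![u, v] = dOne (B i j) p u v
      + ∑ k, wedge2 (B i k p) (B k j p) u v := fun i j u v => by
    rw [hS]
    simp [extDeriv_oneForm_apply (hd i j), wedge_oneForm_eq]
  -- Since d² = 0, only d(B∧B) survives.
  have hdS : extDeriv (S i j) p =
      ∑ k, extDeriv (fun q => wedge (B i k q) (oneForm (B k j q))) p := by
    rw [hS, extDeriv_fun_add (he.differentiableAt (by simp))
      (DifferentiableAt.fun_sum fun k _ => (hw i j k).differentiableAt (by simp)),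
      extDeriv_extDeriv_apply (contDiffAt_oneForm (hB i j))
        (by simpa using WithTop.coe_le_coe.2 (le_top : (2 : ℕ∞) ≤ ⊤)), zero_add]
    simp only [Fin.sum_univ_four]
    have d := fun k => (hw i j k).differentiableAt (by simp : (∞ : WithTop ℕ∞) ≠ 0)
    rw [extDeriv_fun_add (((d 0).fun_add (d 1)).fun_add (d 2)) (d 3),
      extDeriv_fun_add ((d 0).fun_add (d 1)) (d 2), extDeriv_fun_add (d 0) (d 1)]
  refine ext_three fun u v z => ?_
  rw [hdS]
  have hsum : ∀ f : Fin 4 → Tot [⋀^Fin 3]→L[ℝ] ℝ, (∑ k, f k) ![u, v, z] = ∑ k, f k ![u, v, z] :=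
    fun f => by simp
  rw [ContinuousAlternatingMap.add_apply, hsum, hsum]
  simp only [ContinuousAlternatingMap.sub_apply, extDeriv_wedge_apply (hB _ _) (hB _ _),
    wedge_two_apply, hSv, ContinuousAlternatingMap.coe_zero, Pi.zero_apply]
  -- The terms with dB cancel in pairs, and the cubic terms cancel by associativity of the matrix
  -- wedge product.
  simp only [Fin.sum_univ_four, wedge2]
  ring

/-! ### The lifted forms and the curvature of `ℬ` -/

theorem dOne_fun_smul {E : Type*} [NormedAddCommGroup E] [NormedSpace ℝ E] {f : E → ℝ}
    {α : E → E →L[ℝ] ℝ} {p : E} (hf : DifferentiableAt ℝ f p) (hα : DifferentiableAt ℝ α p)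
    (u v : E) :
    dOne (fun q => f q • α q) p u v = f p * dOne α p u v + wedge2 (fderiv ℝ f p) (α p) u v := by
  simp only [dOne, wedge2, fderiv_fun_smul hf hα]
  simp
  ring

theorem dOne_fun_sub {E : Type*} [NormedAddCommGroup E] [NormedSpace ℝ E]
    {α β : E → E →L[ℝ] ℝ} {p : E} (hα : DifferentiableAt ℝ α p) (hβ : DifferentiableAt ℝ β p)
    (u v : E) : dOne (fun q => α q - β q) p u v = dOne α p u v - dOne β p u v := by
  simp only [dOne, fderiv_fun_sub hα hβ]
  simp
  ring

theorem dOne_fun_neg {E : Type*} [NormedAddCommGroup E] [NormedSpace ℝ E]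
    {α : E → E →L[ℝ] ℝ} {p : E} (u v : E) : dOne (fun q => -α q) p u v = -dOne α p u v := by
  simp only [dOne, fderiv_fun_neg]
  simp
  ring

theorem dOne_const {E : Type*} [NormedAddCommGroup E] [NormedSpace ℝ E] (γ : E →L[ℝ] ℝ) (p u v : E) :
    dOne (fun _ => γ) p u v = 0 := by
  simp [dOne]

theorem _root_.Filter.EventuallyEq.dOne_eq {E : Type*} [NormedAddCommGroup E] [NormedSpace ℝ E]
    {α β : E → E →L[ℝ] ℝ} {p : E} (h : α =ᶠ[nhds p] β) (u v : E) :
    dOne α p u v = dOne β p u v := by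
  simp only [dOne, h.fderiv_eq (𝕜 := ℝ)]

theorem dOne_pullback_fst {β : R4 → R4 →L[ℝ] ℝ} {p : Tot} (hβ : DifferentiableAt ℝ β p.1)
    (u v : Tot) :
    dOne (fun q : Tot => (β q.1).comp (ContinuousLinearMap.fst ℝ R4 (Fin 2 → ℝ))) p u v =
      dOne β p.1 u.1 v.1 := by
  have h1 : HasFDerivAt (fun q : Tot => β q.1) _ p := hβ.hasFDerivAt.comp p hasFDerivAt_fst
  have h2 := h1.clm_comp (hasFDerivAt_const (ContinuousLinearMap.fst ℝ R4 (Fin 2 → ℝ)) p)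
  simp only [dOne]
  rw [h2.fderiv]
  simp

theorem isOpen_totOver {V : Set R4} (hV : IsOpen V) : IsOpen (totOver V) := by
  refine (hV.preimage continuous_fst).inter (IsOpen.inter ?_ ?_)
  · exact isOpen_ne.preimage ((continuous_apply 0).comp continuous_snd)
  · exact isOpen_ne.preimage ((continuous_apply 1).comp continuous_snd)

/-- The logarithmic derivative of `torus`. -/
def dlogTorus (p : Tot) (a : Fin 4) : Tot →L[ℝ] ℝ :=
  let l : Fin 2 → Tot →L[ℝ] ℝ := fun i => (p.2 i)⁻¹ •
    (ContinuousLinearMap.proj (R := ℝ) (φ := fun _ : Fin 2 => ℝ) i).comp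
        (ContinuousLinearMap.snd ℝ R4 (Fin 2 → ℝ))
  (![l 0, l 1, -l 0, -l 1] : Fin 4 → Tot →L[ℝ] ℝ) a

theorem torus_ne_zero {V : Set R4} {p : Tot} (hp : p ∈ totOver V) (a : Fin 4) :
    torus p.2 a ≠ 0 := by
  obtain ⟨-, h0, h1⟩ := hp
  fin_cases a <;> simp [torus, h0, h1]

theorem hasFDerivAt_coord (i : Fin 2) (p : Tot) : HasFDerivAt (fun q : Tot => q.2 i)
    ((ContinuousLinearMap.proj (R := ℝ) (φ := fun _ : Fin 2 => ℝ) i).comp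
        (ContinuousLinearMap.snd ℝ R4 (Fin 2 → ℝ))) p :=
  ContinuousLinearMap.hasFDerivAt
    ((ContinuousLinearMap.proj (R := ℝ) (φ := fun _ : Fin 2 => ℝ) i).comp
        (ContinuousLinearMap.snd ℝ R4 (Fin 2 → ℝ)))

theorem hasFDerivAt_torus {V : Set R4} {p : Tot} (hp : p ∈ totOver V) (a : Fin 4) :
    HasFDerivAt (fun q : Tot => torus q.2 a) (torus p.2 a • dlogTorus p a) p := by
  obtain ⟨-, h0, h1⟩ := hp
  fin_cases a
  · refine (hasFDerivAt_coord 0 p).congr_fderiv ?_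
    simp [torus, dlogTorus, smul_smul, h0]
  · refine (hasFDerivAt_coord 1 p).congr_fderiv ?_
    simp [torus, dlogTorus, smul_smul, h1]
  · refine ((hasDerivAt_inv h0).comp_hasFDerivAt p (hasFDerivAt_coord 0 p)).congr_fderiv ?_
    simp [torus, dlogTorus, smul_smul, pow_two]
  · refine ((hasDerivAt_inv h1).comp_hasFDerivAt p (hasFDerivAt_coord 1 p)).congr_fderiv ?_
    simp [torus, dlogTorus, smul_smul, pow_two]

theorem contDiffAt_coord (i : Fin 2) (p : Tot) : ContDiffAt ℝ ∞ (fun q : Tot => q.2 i) p :=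
  (ContinuousLinearMap.contDiff
    ((ContinuousLinearMap.proj (R := ℝ) (φ := fun _ : Fin 2 => ℝ) i).comp
        (ContinuousLinearMap.snd ℝ R4 (Fin 2 → ℝ)))).contDiffAt

theorem contDiffAt_torus {V : Set R4} {p : Tot} (hp : p ∈ totOver V) (a : Fin 4) :
    ContDiffAt ℝ ∞ (fun q : Tot => torus q.2 a) p := by
  obtain ⟨-, h0, h1⟩ := hp
  fin_cases a
  · exact contDiffAt_coord 0 p
  · exact contDiffAt_coord 1 p
  · exact (contDiffAt_coord 0 p).inv h0
  · exact (contDiffAt_coord 1 p).inv h1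

/-- `ℬ` with constants `s`, `σ` in place of `√(3/2 |Ψ₂'|)` and `sgn(Ψ₂') √(3/2 |Ψ₂'|)`. -/
def connConst (s σ : ℝ) (g : MetricField) (e : FrameField) (i j : Fin 4) (p : Tot) :
    Tot →L[ℝ] ℝ :=
  (!![(1 / 2 : ℝ) • liftConn g e 0 p, s • liftCoframe g e 0 p, 0, 0;
      σ • liftCoframe g e 2 p, -((1 / 2 : ℝ) • liftConn g e 0 p), 0, 0;
      0, 0, (1 / 2 : ℝ) • liftConn g e 1 p, s • liftCoframe g e 1 p;
      0, 0, σ • liftCoframe g e 3 p, -((1 / 2 : ℝ) • liftConn g e 1 p)] :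
    Matrix (Fin 4) (Fin 4) (Tot →L[ℝ] ℝ)) i j

/-- `√(3/2 |c|)`. -/
def scaleUp (c : ℝ) : ℝ := Real.sqrt (3 / 2 * |c|)

/-- `sgn(c) √(3/2 |c|)`. -/
def scaleDown (c : ℝ) : ℝ := Real.sign c * Real.sqrt (3 / 2 * |c|)

/-- The diagonal of the curvature contains s and σ only through their product, so no root or sign
remains there. -/
theorem scaleUp_mul_scaleDown (c : ℝ) : scaleUp c * scaleDown c = 3 / 2 * c := by
  have h : Real.sqrt (3 / 2 * |c|) * Real.sqrt (3 / 2 * |c|) = 3 / 2 * |c| :=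
    Real.mul_self_sqrt (by positivity)
  have h2 : Real.sign c * |c| = c := by
    rcases lt_trichotomy c 0 with hc | hc | hc
    · rw [Real.sign_of_neg hc, abs_of_neg hc]; ring
    · simp [hc]
    · rw [Real.sign_of_pos hc, abs_of_pos hc]; ring
  simp only [scaleUp, scaleDown]
  linear_combination Real.sign c * h + 3 / 2 * h2

namespace IsNullFrame

variable {g : MetricField} {e : FrameField} {V : Set R4}

theorem contDiffAt_liftCoframe (h : IsNullFrame g e V) {p : Tot} (hp : p ∈ totOver V)
    (a : Fin 4) : ContDiffAt ℝ ∞ (liftCoframe g e a) p := by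
  have h1 : ContDiffAt ℝ ∞ (fun q : Tot => coframe g e a q.1) p :=
    ((h.contDiffOn_coframe a).contDiffAt (h.isOpen.mem_nhds hp.1)).comp p contDiffAt_fst
  exact (contDiffAt_torus hp a).smul (h1.clm_comp contDiffAt_const)

theorem contDiffAt_liftConn (h : IsNullFrame g e V) {p : Tot} (hp : p ∈ totOver V)
    (i : Fin 2) : ContDiffAt ℝ ∞ (liftConn g e i) p := by
  have h1 : ∀ a b, ContDiffAt ℝ ∞ (fun q : Tot => connForm g e a b q.1) p := fun a b =>
    ((h.contDiffOn_connForm a b).contDiffAt (h.isOpen.mem_nhds hp.1)).comp p contDiffAt_fst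
  have h2 : p.2 i ≠ 0 := by fin_cases i; exacts [hp.2.1, hp.2.2]
  exact ((h1 _ _).clm_comp contDiffAt_const).sub
    (((contDiffAt_coord i p).inv h2).smul contDiffAt_const)

theorem contDiffAt_connConst (h : IsNullFrame g e V) {p : Tot} (hp : p ∈ totOver V) (s σ : ℝ)
    (i j : Fin 4) : ContDiffAt ℝ ∞ (connConst s σ g e i j) p := by
  have h1 := h.contDiffAt_liftCoframe hp
  have h2 := h.contDiffAt_liftConn hp
  fin_cases i <;> fin_cases j <;>
    first
    | exact contDiffAt_const (c := (0 : Tot →L[ℝ] ℝ))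
    | exact contDiffAt_const.smul (h1 _)
    | exact contDiffAt_const.smul (h2 _)
    | exact ((h2 0).const_smul (1 / 2 : ℝ)).neg
    | exact ((h2 1).const_smul (1 / 2 : ℝ)).neg

/-- The product rule on the bundle. The term dlog t ∧ θ is the one that the fibre part of `liftConn`
later cancels. -/
theorem dOne_liftCoframe (h : IsNullFrame g e V) {p : Tot} (hp : p ∈ totOver V) (a : Fin 4)
    (u v : Tot) : dOne (liftCoframe g e a) p u v =
      torus p.2 a * dOne (coframe g e a) p.1 u.1 v.1
        + wedge2 (dlogTorus p a) (liftCoframe g e a p) u v := by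
  have h1 : ContDiffAt ℝ ∞ (fun q : Tot => coframe g e a q.1) p :=
    ((h.contDiffOn_coframe a).contDiffAt (h.isOpen.mem_nhds hp.1)).comp p contDiffAt_fst
  have h2 := (h1.clm_comp (contDiffAt_const (c := ContinuousLinearMap.fst ℝ R4 (Fin 2 → ℝ)))).differentiableAt
    (by simp)
  have h3 := dOne_fun_smul (hasFDerivAt_torus hp a).differentiableAt h2 u v
  rw [dOne_pullback_fst (h.differentiableAt (h.contDiffOn_coframe a) hp.1),
    (hasFDerivAt_torus hp a).fderiv] at h3
  refine h3.trans ?_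
  simp [wedge2, liftCoframe]
  ring

/-- The fibre term dtᵢ/tᵢ is closed, so only the pull-back contributes. -/
theorem dOne_liftConn (h : IsNullFrame g e V) {p : Tot} (hp : p ∈ totOver V) (i : Fin 2)
    (u v : Tot) : dOne (liftConn g e i) p u v =
      dOne (connForm g e (Fin.castLE (by norm_num) i) (Fin.castLE (by norm_num) i)) p.1 u.1 v.1 := by
  have h1 : ∀ a b, ContDiffAt ℝ ∞ (fun q : Tot => connForm g e a b q.1) p := fun a b =>
    ((h.contDiffOn_connForm a b).contDiffAt (h.isOpen.mem_nhds hp.1)).comp p contDiffAt_fst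
  have hi : p.2 i ≠ 0 := by fin_cases i; exacts [hp.2.1, hp.2.2]
  have h2 := fun a b => ((h1 a b).clm_comp
    (contDiffAt_const (c := ContinuousLinearMap.fst ℝ R4 (Fin 2 → ℝ)))).differentiableAt
      (by simp : (∞ : WithTop ℕ∞) ≠ 0)
  have h3 : HasFDerivAt (fun q : Tot => (q.2 i)⁻¹) _ p :=
    (hasDerivAt_inv hi).comp_hasFDerivAt p (hasFDerivAt_coord i p)
  have h4 := dOne_fun_smul h3.differentiableAt (differentiableAt_const
    ((ContinuousLinearMap.proj (R := ℝ) (φ := fun _ : Fin 2 => ℝ) i).comp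
        (ContinuousLinearMap.snd ℝ R4 (Fin 2 → ℝ)))) u v
  rw [h3.fderiv, dOne_const] at h4
  refine (dOne_fun_sub (h2 _ _) (h3.differentiableAt.fun_smul (differentiableAt_const _)) u v).trans ?_
  rw [h4, dOne_pullback_fst (h.differentiableAt (h.contDiffOn_connForm _ _) hp.1)]
  simp [wedge2]
  ring

end IsNullFrame

/-- The curvature of `connConst`, evaluated on two vectors. -/
def curvConst (s σ : ℝ) (g : MetricField) (e : FrameField) (i j : Fin 4) (p u v : Tot) : ℝ :=
  dOne (connConst s σ g e i j) p u v
    + ∑ k, wedge2 (connConst s σ g e i k p) (connConst s σ g e k j p) u v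

namespace IsParallelFrame

variable {g : MetricField} {e : FrameField} {V : Set R4}

theorem dOne_coframe_eq (h : IsParallelFrame g e V) {x : R4} (hx : x ∈ V) (u v : R4) :
    dOne (coframe g e 0) x u v = -wedge2 (connForm g e 0 0 x) (coframe g e 0 x) u v
      - wedge2 (connForm g e 0 1 x) (coframe g e 1 x) u v ∧
    dOne (coframe g e 1) x u v = -wedge2 (connForm g e 1 0 x) (coframe g e 0 x) u v
      - wedge2 (connForm g e 1 1 x) (coframe g e 1 x) u v ∧
    dOne (coframe g e 2) x u v = wedge2 (connForm g e 0 0 x) (coframe g e 2 x) u v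
      + wedge2 (connForm g e 1 0 x) (coframe g e 3 x) u v ∧
    dOne (coframe g e 3) x u v = wedge2 (connForm g e 0 1 x) (coframe g e 2 x) u v
      + wedge2 (connForm g e 1 1 x) (coframe g e 3 x) u v := by
  obtain ⟨c20, c31, c02, c13, c30, c12, c21, c03, c22, c33, c23, c32⟩ := h.conn hx
  simp only [h.dOne_coframe hx, Fin.sum_univ_four, wedge2, c20, c31, c02, c13, c30, c12, c21, c03,
    c22, c33, c23, c32, neg_apply, zero_apply]
  refine ⟨?_, ?_, ?_, ?_⟩ <;> ring

/-- ℬ carries only the diagonal forms Γ¹₁ and Γ²₂, so the first structure equation cancels them and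
the off-diagonal curvature is the torsion-like remainder with Γ¹₂ or Γ²₁. The dlog t terms cancel
too: every value depends on u and v only through their projections to the base. -/
theorem curvConst_values (h : IsParallelFrame g e V) {p : Tot} (hp : p ∈ totOver V) (s σ : ℝ)
    (u v : Tot) :
    curvConst s σ g e 0 0 p u v = 1 / 2 * dOne (connForm g e 0 0) p.1 u.1 v.1
      + s * σ * wedge2 (coframe g e 0 p.1) (coframe g e 2 p.1) u.1 v.1 ∧
    curvConst s σ g e 1 1 p u v = -(1 / 2 * dOne (connForm g e 0 0) p.1 u.1 v.1
      + s * σ * wedge2 (coframe g e 0 p.1) (coframe g e 2 p.1) u.1 v.1) ∧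
    curvConst s σ g e 2 2 p u v = 1 / 2 * dOne (connForm g e 1 1) p.1 u.1 v.1
      + s * σ * wedge2 (coframe g e 1 p.1) (coframe g e 3 p.1) u.1 v.1 ∧
    curvConst s σ g e 3 3 p u v = -(1 / 2 * dOne (connForm g e 1 1) p.1 u.1 v.1
      + s * σ * wedge2 (coframe g e 1 p.1) (coframe g e 3 p.1) u.1 v.1) ∧
    curvConst s σ g e 0 1 p u v = -(s * torus p.2 0
      * wedge2 (connForm g e 0 1 p.1) (coframe g e 1 p.1) u.1 v.1) ∧
    curvConst s σ g e 1 0 p u v = σ * torus p.2 2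
      * wedge2 (connForm g e 1 0 p.1) (coframe g e 3 p.1) u.1 v.1 ∧
    curvConst s σ g e 2 3 p u v = -(s * torus p.2 1
      * wedge2 (connForm g e 1 0 p.1) (coframe g e 0 p.1) u.1 v.1) ∧
    curvConst s σ g e 3 2 p u v = σ * torus p.2 3
      * wedge2 (connForm g e 0 1 p.1) (coframe g e 2 p.1) u.1 v.1 := by
  obtain ⟨d0, d1, d2, d3⟩ := h.dOne_coframe_eq hp.1 u.1 v.1
  have hθ := fun a => (h.contDiffAt_liftCoframe hp a).differentiableAt (by simp)
  have hω := fun i => (h.contDiffAt_liftConn hp i).differentiableAt (by simp)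
  have lθ := h.dOne_liftCoframe hp (u := u) (v := v)
  have lω := h.dOne_liftConn hp (u := u) (v := v)
  have smul : ∀ (c : ℝ) {α : Tot → Tot →L[ℝ] ℝ}, DifferentiableAt ℝ α p →
      dOne (fun q => c • α q) p u v = c * dOne α p u v := fun c α hα => by
    rw [dOne_fun_smul (differentiableAt_const c) hα]
    simp [wedge2]
  have k00 : dOne (connConst s σ g e 0 0) p u v = 1 / 2 * dOne (liftConn g e 0) p u v :=
    smul _ (hω 0)
  have k22 : dOne (connConst s σ g e 2 2) p u v = 1 / 2 * dOne (liftConn g e 1) p u v :=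
    smul _ (hω 1)
  have k11 : dOne (connConst s σ g e 1 1) p u v = -(1 / 2 * dOne (liftConn g e 0) p u v) :=
    (dOne_fun_neg (α := fun q => (1 / 2 : ℝ) • liftConn g e 0 q) u v).trans
      (congrArg _ (smul _ (hω 0)))
  have k33 : dOne (connConst s σ g e 3 3) p u v = -(1 / 2 * dOne (liftConn g e 1) p u v) :=
    (dOne_fun_neg (α := fun q => (1 / 2 : ℝ) • liftConn g e 1 q) u v).trans
      (congrArg _ (smul _ (hω 1)))
  have k01 : dOne (connConst s σ g e 0 1) p u v = s * dOne (liftCoframe g e 0) p u v :=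
    smul _ (hθ 0)
  have k10 : dOne (connConst s σ g e 1 0) p u v = σ * dOne (liftCoframe g e 2) p u v :=
    smul _ (hθ 2)
  have k23 : dOne (connConst s σ g e 2 3) p u v = s * dOne (liftCoframe g e 1) p u v :=
    smul _ (hθ 1)
  have k32 : dOne (connConst s σ g e 3 2) p u v = σ * dOne (liftCoframe g e 3) p u v :=
    smul _ (hθ 3)
  have t0 : torus p.2 0 * torus p.2 2 = 1 := mul_inv_cancel₀ hp.2.1
  have t1 : torus p.2 1 * torus p.2 3 = 1 := mul_inv_cancel₀ hp.2.2
  simp only [curvConst, Fin.sum_univ_four, k00, k11, k22, k33, k01, k10, k23, k32, lθ, lω, d0, d1,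
    d2, d3]
  simp [connConst, wedge2, liftCoframe, liftConn, dlogTorus]
  refine ⟨?_, ?_, ?_, ?_, ?_, ?_, ?_, ?_⟩
  · linear_combination (s * σ * (coframe g e 0 p.1 u.1 * coframe g e 2 p.1 v.1
      - coframe g e 0 p.1 v.1 * coframe g e 2 p.1 u.1)) * t0
  · linear_combination -(s * σ * (coframe g e 0 p.1 u.1 * coframe g e 2 p.1 v.1
      - coframe g e 0 p.1 v.1 * coframe g e 2 p.1 u.1)) * t0
  · linear_combination (s * σ * (coframe g e 1 p.1 u.1 * coframe g e 3 p.1 v.1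
      - coframe g e 1 p.1 v.1 * coframe g e 3 p.1 u.1)) * t1
  · linear_combination -(s * σ * (coframe g e 1 p.1 u.1 * coframe g e 3 p.1 v.1
      - coframe g e 1 p.1 v.1 * coframe g e 3 p.1 u.1)) * t1
  all_goals ring

end IsParallelFrame

/-! ### The Yang-Mills equations -/

namespace IsNullFrame

variable {g : MetricField} {e : FrameField} {V : Set R4}

theorem liftCoframe_liftFrame (h : IsNullFrame g e V) {p : Tot} (hp : p ∈ totOver V)
    (a b : Fin 4) : liftCoframe g e a p (liftFrame e b p) = if a = b then 1 else 0 := by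
  have := torus_ne_zero hp b
  simp only [liftCoframe, liftFrame, smul_apply, ContinuousLinearMap.comp_apply,
    ContinuousLinearMap.coe_fst', map_smul, h.coframe_apply hp.1, smul_eq_mul]
  split_ifs with hab
  · subst hab; field_simp
  · simp

theorem hodge_liftFrame (h : IsNullFrame g e V) {p : Tot} (hp : p ∈ totOver V)
    (w : Tot [⋀^Fin 2]→L[ℝ] ℝ) (a b : Fin 4) :
    hodge g e p w ![liftFrame e a p, liftFrame e b p] =
      w ![liftFrame e 0 p, liftFrame e 1 p] *
        ((if 0 = a then 1 else 0) * (if 1 = b then 1 else 0)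
          - (if 0 = b then 1 else 0) * (if 1 = a then 1 else 0))
      + w ![liftFrame e 2 p, liftFrame e 3 p] *
        ((if 2 = a then 1 else 0) * (if 3 = b then 1 else 0)
          - (if 2 = b then 1 else 0) * (if 3 = a then 1 else 0))
      + w ![liftFrame e 0 p, liftFrame e 2 p] *
        ((if 1 = a then 1 else 0) * (if 3 = b then 1 else 0)
          - (if 1 = b then 1 else 0) * (if 3 = a then 1 else 0))
      + w ![liftFrame e 1 p, liftFrame e 3 p] *
        ((if 0 = a then 1 else 0) * (if 2 = b then 1 else 0)
          - (if 0 = b then 1 else 0) * (if 2 = a then 1 else 0))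
      - w ![liftFrame e 0 p, liftFrame e 3 p] *
        ((if 0 = a then 1 else 0) * (if 3 = b then 1 else 0)
          - (if 0 = b then 1 else 0) * (if 3 = a then 1 else 0))
      - w ![liftFrame e 1 p, liftFrame e 2 p] *
        ((if 1 = a then 1 else 0) * (if 2 = b then 1 else 0)
          - (if 1 = b then 1 else 0) * (if 2 = a then 1 else 0)) := by
  simp only [hodge, ContinuousAlternatingMap.add_apply, ContinuousAlternatingMap.sub_apply,
    ContinuousAlternatingMap.smul_apply, wedge_oneForm_eq, wedge2, h.liftCoframe_liftFrame hp,
    smul_eq_mul]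

/-- Multiples of `θ² ∧ θ³` are anti-self-dual. -/
theorem hodge_of_wedge (h : IsNullFrame g e V) {p : Tot} (hp : p ∈ totOver V)
    {w : Tot [⋀^Fin 2]→L[ℝ] ℝ} {k : ℝ}
    (hw : ∀ u v, w ![u, v] = k * wedge2 (coframe g e 1 p.1) (coframe g e 2 p.1) u.1 v.1) :
    hodge g e p w = -w := by
  have t1 := torus_ne_zero hp 1
  have t2 := torus_ne_zero hp 2
  refine ext_two fun u v => ?_
  simp only [hodge, ContinuousAlternatingMap.add_apply, ContinuousAlternatingMap.sub_apply,
    ContinuousAlternatingMap.smul_apply, ContinuousAlternatingMap.neg_apply, wedge_oneForm_eq, hw,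
    smul_eq_mul]
  simp only [liftFrame, wedge2, map_smul, h.coframe_apply hp.1, liftCoframe, smul_apply,
    ContinuousLinearMap.comp_apply, ContinuousLinearMap.coe_fst', smul_eq_mul]
  simp
  field_simp

end IsNullFrame

theorem hodge_neg (g : MetricField) (e : FrameField) (p : Tot) (w : Tot [⋀^Fin 2]→L[ℝ] ℝ) :
    hodge g e p (-w) = -hodge g e p w := by
  simp only [hodge, ContinuousAlternatingMap.neg_apply, neg_smul]
  abel

namespace IsParallelFrame

variable {g : MetricField} {e : FrameField} {V : Set R4}

theorem eventually_psi2'_eq (h : IsParallelFrame g e V) (h0 : IsReduced g e V) {x : R4}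
    (hx : x ∈ V) : ∀ᶠ y in nhds x, psi2' g y (fun a => e a y) = psi2' g x (fun a => e a x) := by
  obtain ⟨r, hr, hball⟩ := Metric.isOpen_iff.mp h.isOpen x hx
  have hd : DifferentiableOn ℝ (fun y => psi2' g y (fun a => e a y)) (Metric.ball x r) :=
    fun y hy => (h.differentiableAt (h.contDiffOn_weylComp 0 1 2 3)
      (hball hy)).differentiableWithinAt
  filter_upwards [Metric.ball_mem_nhds x hr] with y hy
  exact Metric.isOpen_ball.is_const_of_fderiv_eq_zero (convex_ball x r).isPreconnected hd
    (fun z hz => h.fderiv_psi2' h0 (hball hz)) hy (Metric.mem_ball_self hr)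

/-- Local constancy of Ψ₂' allows the scale to be frozen at its value at p, so the exterior
derivatives of ℬ involve no derivative of √|Ψ₂'|. -/
theorem connB_eventuallyEq (h : IsParallelFrame g e V) (h0 : IsReduced g e V) {p : Tot}
    (hp : p ∈ totOver V) {c : ℝ} (hc : c = psi2' g p.1 (fun a => e a p.1)) (i j : Fin 4) :
    connB g e i j =ᶠ[nhds p] connConst (scaleUp c) (scaleDown c) g e i j := by
  have h1 : ∀ᶠ q : Tot in nhds p, psi2' g q.1 (fun a => e a q.1) = c := by
    rw [hc]
    exact continuous_fst.continuousAt.eventually (h.eventually_psi2'_eq h0 hp.1)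
  filter_upwards [h1] with q hq
  simp only [connB, connConst, hq, scaleUp, scaleDown]

theorem connB_eq (h : IsParallelFrame g e V) (h0 : IsReduced g e V) {p : Tot}
    (hp : p ∈ totOver V) {c : ℝ} (hc : c = psi2' g p.1 (fun a => e a p.1)) (i j : Fin 4) :
    connB g e i j p = connConst (scaleUp c) (scaleDown c) g e i j p :=
  (h.connB_eventuallyEq h0 hp hc i j).eq_of_nhds

theorem contDiffAt_connB (h : IsParallelFrame g e V) (h0 : IsReduced g e V) {p : Tot}
    (hp : p ∈ totOver V) (i j : Fin 4) : ContDiffAt ℝ ∞ (connB g e i j) p :=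
  (h.contDiffAt_connConst hp _ _ i j).congr_of_eventuallyEq (h.connB_eventuallyEq h0 hp rfl i j)

theorem curvB_apply (h : IsParallelFrame g e V) (h0 : IsReduced g e V) {p : Tot}
    (hp : p ∈ totOver V) {c : ℝ} (hc : c = psi2' g p.1 (fun a => e a p.1)) (i j : Fin 4)
    (u v : Tot) :
    curvB g e i j p ![u, v] = curvConst (scaleUp c) (scaleDown c) g e i j p u v := by
  have hd := (h.contDiffAt_connB h0 hp i j).differentiableAt (by simp)
  simp only [curvB, ContinuousAlternatingMap.add_apply, extDeriv_oneForm_apply hd, curvConst,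
    (h.connB_eventuallyEq h0 hp hc i j).dOne_eq, ← h.connB_eq h0 hp hc]
  simp [wedge_oneForm_eq]

/-- This is what the scale is chosen for: sσ = (3/2)Ψ₂' makes the contribution of ℬ∧ℬ cancel half of
d(Γ¹₁ + Γ²₂) = -3Ψ₂'ρ. -/
theorem curvB_two_two (h : IsParallelFrame g e V) (h0 : IsReduced g e V) {p : Tot}
    (hp : p ∈ totOver V) : curvB g e 2 2 p = -curvB g e 0 0 p := by
  refine ext_two fun u v => ?_
  obtain ⟨k0, -, k2, -⟩ := h.curvConst_values hp
    (scaleUp (psi2' g p.1 (fun a => e a p.1))) (scaleDown (psi2' g p.1 (fun a => e a p.1))) u v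
  rw [ContinuousAlternatingMap.neg_apply, h.curvB_apply h0 hp rfl, h.curvB_apply h0 hp rfl, k0, k2,
    scaleUp_mul_scaleDown]
  obtain ⟨r0, r1, -⟩ := h.curvature_reduced h0 hp.1 rfl rfl rfl u.1 v.1
  simp only [wedge2] at *
  linarith

/-- Add the (1,1) and (3,3) entries of the equations. By `curvB_two_two` the two exterior
derivatives are opposite, and what is left contains no derivative of the curvature. -/
theorem covD_trace (h : IsParallelFrame g e V) (h0 : IsReduced g e V) {p : Tot}
    (hp : p ∈ totOver V) (hYM : YangMills g e V) {S : Fin 4 → Fin 4 → Tot [⋀^Fin 2]→L[ℝ] ℝ}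
    (hS : ∀ i j, S i j = hodge g e p (curvB g e i j p)) {s σ : ℝ}
    (hs : s = scaleUp (psi2' g p.1 (fun a => e a p.1)))
    (hσ : σ = scaleDown (psi2' g p.1 (fun a => e a p.1))) :
    wedge (s • liftCoframe g e 0 p) (S 1 0) - wedge (σ • liftCoframe g e 2 p) (S 0 1)
      + (wedge (s • liftCoframe g e 1 p) (S 3 2) - wedge (σ • liftCoframe g e 3 p) (S 2 3)) = 0 := by
  have a0 := hYM p hp 0 0
  have a2 := hYM p hp 2 2
  have hneg : (fun q => hodge g e q (curvB g e 2 2 q)) =ᶠ[nhds p]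
      fun q => -hodge g e q (curvB g e 0 0 q) := by
    filter_upwards [(isOpen_totOver h.isOpen).mem_nhds hp] with q hq
    rw [h.curvB_two_two h0 hq, hodge_neg]
  have hd : extDeriv (fun q => hodge g e q (curvB g e 2 2 q)) p =
      -extDeriv (fun q => hodge g e q (curvB g e 0 0 q)) p := by
    rw [hneg.extDeriv_eq]
    have := extDeriv_fun_smul (x := p) (-1 : ℝ) (fun q => hodge g e q (curvB g e 0 0 q))
    simp only [neg_one_smul] at this
    exact this
  have z : ∀ w : Tot [⋀^Fin 2]→L[ℝ] ℝ, wedge 0 w = 0 := fun w =>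
    ext_three fun u v z => by simp [wedge_two_apply]
  simp only [covD, Fin.sum_univ_four, ← hS] at a0 a2
  rw [hd] at a2
  have b := h.connB_eq h0 hp rfl
  have b02 : connB g e 0 2 p = 0 := rfl
  have b03 : connB g e 0 3 p = 0 := rfl
  have b20 : connB g e 2 0 p = 0 := rfl
  have b21 : connB g e 2 1 p = 0 := rfl
  have b12 : connB g e 1 2 p = 0 := rfl
  have b30 : connB g e 3 0 p = 0 := rfl
  have b01 : connB g e 0 1 p = s • liftCoframe g e 0 p := by rw [b, hs]; rfl
  have b10 : connB g e 1 0 p = σ • liftCoframe g e 2 p := by rw [b, hσ]; rfl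
  have b23 : connB g e 2 3 p = s • liftCoframe g e 1 p := by rw [b, hs]; rfl
  have b32 : connB g e 3 2 p = σ • liftCoframe g e 3 p := by rw [b, hσ]; rfl
  simp only [b01, b02, b03, b20, b21, b12, b30, b10, b23, b32, z, sub_self, add_zero, zero_add]
    at a0 a2
  -- The right side 0 is written as 0 + 0, and each summand is replaced by one of the two vanishing
  -- entries.
  rw [← add_zero (0 : Tot [⋀^Fin 3]→L[ℝ] ℝ)]
  nth_rw 1 [← a0]
  rw [← a2]
  simp only [hS]
  abel

/-- Each of the four triples of frame vectors isolates, in the three-form of `covD_trace`, one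
coefficient of Γ²₁ or Γ¹₂ multiplied by ±sσ. -/
theorem conn_eq_zero_of_yangMills (h : IsParallelFrame g e V) (h0 : IsReduced g e V)
    (hYM : YangMills g e V) {x : R4} (hx : x ∈ V) (hp' : psi2' g x (fun a => e a x) ≠ 0) :
    connForm g e 1 0 x (e 1 x) = 0 ∧ connForm g e 1 0 x (e 2 x) = 0 ∧
      connForm g e 0 1 x (e 0 x) = 0 ∧ connForm g e 0 1 x (e 3 x) = 0 := by
  -- The equations are needed at a single point of the fibre; at t = (1, 1) the lifted frame is e
  -- itself.
  let p : Tot := (x, 1)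
  have hp : p ∈ totOver V := ⟨hx, one_ne_zero, one_ne_zero⟩
  obtain ⟨s, hs⟩ : ∃ s, s = scaleUp (psi2' g p.1 (fun a => e a p.1)) := ⟨_, rfl⟩
  obtain ⟨σ, hσ⟩ : ∃ σ, σ = scaleDown (psi2' g p.1 (fun a => e a p.1)) := ⟨_, rfl⟩
  have hsσ : s * σ ≠ 0 := by
    rw [hs, hσ, scaleUp_mul_scaleDown]
    exact mul_ne_zero (by norm_num) hp'
  have H := h.covD_trace h0 hp hYM (fun i j => rfl) hs hσ
  have L := fun a b => h.liftCoframe_liftFrame hp a b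
  have F : ∀ a, (liftFrame e a p).1 = e a x := fun a => by
    fin_cases a <;> simp [liftFrame, torus, p]
  have C := fun i j u v => h.curvB_apply h0 hp rfl i j u v
  rw [← hs, ← hσ] at C
  have K := h.curvConst_values hp s σ
  have T : ∀ a, torus p.2 a = 1 := fun a => by fin_cases a <;> simp [torus, p]
  have k01 := fun u v => (K u v).2.2.2.2.1
  have k10 := fun u v => (K u v).2.2.2.2.2.1
  have k23 := fun u v => (K u v).2.2.2.2.2.2.1
  have k32 := fun u v => (K u v).2.2.2.2.2.2.2
  have E : ∀ a b c : Fin 4, _ := fun a b c => congrArg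
    (fun w : Tot [⋀^Fin 3]→L[ℝ] ℝ => w ![liftFrame e a p, liftFrame e b p, liftFrame e c p]) H
  have px : p.1 = x := rfl
  simp only [ContinuousAlternatingMap.add_apply, ContinuousAlternatingMap.sub_apply,
    wedge_two_apply, smul_apply, L, h.hodge_liftFrame hp, C, k01, k10, k23, k32, F, T, wedge2,
    px, h.coframe_apply hx] at E
  have E1 := E 0 1 3
  have E2 := E 0 2 3
  have E3 := E 0 1 2
  have E4 := E 1 2 3
  simp at E1 E2 E3 E4
  obtain ⟨hs0, hσ0⟩ := mul_ne_zero_iff.mp hsσ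
  simp only [hs0, hσ0, false_or] at E1 E2 E3 E4
  exact ⟨E1, E2, E3, E4⟩

/-- With Γ²₁ = 0 on all of V, its curvature equation reads (Ψ₂' - Ψ₂) θ²∧θ³ = 0. -/
theorem psi_two_eq_of_conn_eq_zero (h : IsParallelFrame g e V) (h0 : IsReduced g e V)
    (hc : ∀ x ∈ V, connForm g e 1 0 x = 0) {x : R4} (hx : x ∈ V) :
    psi g x (fun a => e a x) 2 = psi2' g x (fun a => e a x) := by
  obtain ⟨-, -, -, k⟩ := h.curvature_reduced h0 hx rfl rfl rfl (e 1 x) (e 2 x)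
  have hd : fderiv ℝ (connForm g e 1 0) x = 0 := by
    rw [Filter.EventuallyEq.fderiv_eq (𝕜 := ℝ) (h.eventually hx hc)]
    exact fderiv_const_apply 0
  simp [dOne, hd, hc x hx, wedge2, h.coframe_apply hx] at k
  linarith

/-- The shape of the connection form `Γ²₁`. -/
theorem connForm_one_zero_eq (h : IsParallelFrame g e V) (h0 : IsReduced g e V) {x : R4}
    (hx : x ∈ V) (hq : psi g x (fun a => e a x) 2 ≠ 0) :
    connForm g e 1 0 x = J g e x 0 • coframe g e 1 x + J g e x 1 • coframe g e 2 x := by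
  obtain ⟨q0, q3⟩ := h.connForm_one_zero_apply h0 hx hq
  refine h.clm_ext hx fun a => ?_
  fin_cases a <;> simp [J, h.coframe_apply hx, q0, q3]

theorem connForm_zero_one_eq (h : IsNullFrame g e V) {x : R4} (hx : x ∈ V) :
    connForm g e 0 1 x = -(J g e x 2 • coframe g e 0 x) + J g e x 5 • coframe g e 1 x
      + J g e x 4 • coframe g e 2 x + J g e x 3 • coframe g e 3 x := by
  refine h.clm_ext hx fun a => ?_
  fin_cases a <;> simp [J, h.coframe_apply hx]

/-- Γ²₁ = 0 kills the entries built from it, and Ψ₂ = Ψ₂' makes dΓ¹₁ and dΓ²₂ cancel the diagonal.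
The two entries with Γ¹₂ remain. -/
theorem hodge_curvB (h : IsParallelFrame g e V) (h0 : IsReduced g e V)
    (hY : ∀ x ∈ V, YMConditions g e x) (hc : ∀ x ∈ V, connForm g e 1 0 x = 0) {p : Tot}
    (hp : p ∈ totOver V) (i j : Fin 4) :
    hodge g e p (curvB g e i j p) = -curvB g e i j p := by
  obtain ⟨hpq, j0, j1, j2, j3⟩ := hY p.1 hp.1
  obtain ⟨s, hs⟩ : ∃ s, s = scaleUp (psi2' g p.1 (fun a => e a p.1)) := ⟨_, rfl⟩
  obtain ⟨σ, hσ⟩ : ∃ σ, σ = scaleDown (psi2' g p.1 (fun a => e a p.1)) := ⟨_, rfl⟩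
  have hsσ : s * σ = 3 / 2 * psi2' g p.1 (fun a => e a p.1) := by
    rw [hs, hσ, scaleUp_mul_scaleDown]
  have C := fun i j u v => h.curvB_apply h0 hp rfl i j u v
  rw [← hs, ← hσ] at C
  have r := h.curvature_reduced h0 hp.1 rfl rfl rfl
  rw [hpq] at r
  have hd := fun u v => h.curvConst_values hp s σ u v
  have c01 := connForm_zero_one_eq h.toIsNullFrame hp.1
  rw [j2, j3] at c01
  have key : ∃ k : ℝ, ∀ u v, curvB g e i j p ![u, v] =
      k * wedge2 (coframe g e 1 p.1) (coframe g e 2 p.1) u.1 v.1 := by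
    simp only [C]
    have z : ∀ (α : Tot →L[ℝ] ℝ) u v, wedge2 0 α u v = 0 ∧ wedge2 α 0 u v = 0 := fun α u v => by
      simp [wedge2]
    have d0 : ∀ u v : Tot, dOne (fun _ : Tot => (0 : Tot →L[ℝ] ℝ)) p u v = 0 := fun u v =>
      dOne_const 0 p u v
    -- Entries between the two sl(2) blocks: the connection entry is zero and every product has a
    -- zero factor.
    have off : ∀ i j, connConst s σ g e i j = (fun _ => 0) →
        (∀ k, connConst s σ g e i k = (fun _ => 0) ∨ connConst s σ g e k j = (fun _ => 0)) →
        ∃ k : ℝ, ∀ u v, curvConst s σ g e i j p u v =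
          k * wedge2 (coframe g e 1 p.1) (coframe g e 2 p.1) u.1 v.1 := by
      intro i j hij hk
      refine ⟨0, fun u v => ?_⟩
      rw [curvConst, hij, d0, zero_mul, zero_add]
      refine Finset.sum_eq_zero fun k _ => ?_
      rcases hk k with hk | hk <;> rw [hk]
      exacts [(z _ u v).1, (z _ u v).2]
    have z' : ∀ (α : R4 →L[ℝ] ℝ) u v, wedge2 0 α u v = 0 ∧ wedge2 α 0 u v = 0 := fun α u v => by
      simp [wedge2]
    fin_cases i <;> fin_cases j
    · refine ⟨0, fun u v => (hd u v).1.trans ?_⟩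
      obtain ⟨r0, r1, -⟩ := r u.1 v.1
      simp only [hsσ, hc _ hp.1, (z' _ _ _).1, (z' _ _ _).2] at r0 r1 ⊢
      linarith
    -- Now Γ¹₂ = J₆θ² + J₅θ³, so wedging with θ² leaves only J₅, and wedging with θ³ in the (4,3)
    -- entry leaves only J₆.
    · refine ⟨s * torus p.2 0 * J g e p.1 4, fun u v => (hd u v).2.2.2.2.1.trans ?_⟩
      rw [c01]
      simp [wedge2]
      ring
    · exact off 0 2 rfl fun k => by fin_cases k <;> first | exact Or.inl rfl | exact Or.inr rfl
    · exact off 0 3 rfl fun k => by fin_cases k <;> first | exact Or.inl rfl | exact Or.inr rfl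
    · refine ⟨0, fun u v => (hd u v).2.2.2.2.2.1.trans ?_⟩
      simp only [hc _ hp.1, (z' _ _ _).1, mul_zero, zero_mul]
    · refine ⟨0, fun u v => (hd u v).2.1.trans ?_⟩
      obtain ⟨r0, r1, -⟩ := r u.1 v.1
      simp only [hsσ, hc _ hp.1, (z' _ _ _).1, (z' _ _ _).2] at r0 r1 ⊢
      linarith
    · exact off 1 2 rfl fun k => by fin_cases k <;> first | exact Or.inl rfl | exact Or.inr rfl
    · exact off 1 3 rfl fun k => by fin_cases k <;> first | exact Or.inl rfl | exact Or.inr rfl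
    · exact off 2 0 rfl fun k => by fin_cases k <;> first | exact Or.inl rfl | exact Or.inr rfl
    · exact off 2 1 rfl fun k => by fin_cases k <;> first | exact Or.inl rfl | exact Or.inr rfl
    · refine ⟨0, fun u v => (hd u v).2.2.1.trans ?_⟩
      obtain ⟨r0, r1, -⟩ := r u.1 v.1
      simp only [hsσ, hc _ hp.1, (z' _ _ _).1, (z' _ _ _).2] at r0 r1 ⊢
      linarith
    · refine ⟨0, fun u v => (hd u v).2.2.2.2.2.2.1.trans ?_⟩
      simp only [hc _ hp.1, (z' _ _ _).1, mul_zero, zero_mul, neg_zero]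
    · exact off 3 0 rfl fun k => by fin_cases k <;> first | exact Or.inl rfl | exact Or.inr rfl
    · exact off 3 1 rfl fun k => by fin_cases k <;> first | exact Or.inl rfl | exact Or.inr rfl
    · refine ⟨σ * torus p.2 3 * J g e p.1 5, fun u v => (hd u v).2.2.2.2.2.2.2.trans ?_⟩
      rw [c01]
      simp [wedge2]
      ring
    · refine ⟨0, fun u v => (hd u v).2.2.2.1.trans ?_⟩
      obtain ⟨r0, r1, -⟩ := r u.1 v.1
      simp only [hsσ, hc _ hp.1, (z' _ _ _).1, (z' _ _ _).2] at r0 r1 ⊢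
      linarith
  obtain ⟨k, hk⟩ := key
  exact h.hodge_of_wedge hp hk

theorem yangMills_iff (h : IsParallelFrame g e V) (h0 : IsReduced g e V)
    (hq : ∀ x ∈ V, psi g x (fun a => e a x) 2 ≠ 0)
    (hp : ∀ x ∈ V, psi2' g x (fun a => e a x) ≠ 0) :
    YangMills g e V ↔ ∀ x ∈ V, YMConditions g e x := by
  constructor
  · intro hYM
    have hz := fun x hx => h.conn_eq_zero_of_yangMills h0 hYM (x := x) hx (hp x hx)
    have hc : ∀ x ∈ V, connForm g e 1 0 x = 0 := fun x hx => by
      obtain ⟨z1, z2, -⟩ := hz x hx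
      obtain ⟨z0, z3⟩ := h.connForm_one_zero_apply h0 hx (hq x hx)
      exact h.clm_ext hx fun a => by fin_cases a <;> simp [z0, z1, z2, z3]
    intro x hx
    obtain ⟨z1, z2, z0, z3⟩ := hz x hx
    exact ⟨h.psi_two_eq_of_conn_eq_zero h0 hc hx, by simp [J, z1], by simp [J, z2],
      by simp [J, z0], by simp [J, z3]⟩
  · intro hY p hp' i j
    have hc : ∀ x ∈ V, connForm g e 1 0 x = 0 := fun x hx => by
      obtain ⟨-, j0, j1, -⟩ := hY x hx
      rw [h.connForm_one_zero_eq h0 hx (hq x hx), j0, j1]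
      simp
    have hB := bianchi (B := connB g e) (S := curvB g e) (h.contDiffAt_connB h0 hp')
      (fun i j => rfl) i j
    -- Anti-self-duality holds near p, so it may be differentiated; D*K = -DK then vanishes by the
    -- Bianchi identity.
    have hS : (fun q => hodge g e q (curvB g e i j q)) =ᶠ[nhds p] fun q => -curvB g e i j q := by
      filter_upwards [(isOpen_totOver h.isOpen).mem_nhds hp'] with q hq'
      exact h.hodge_curvB h0 hY hc hq' i j
    have hd := extDeriv_fun_smul (x := p) (-1 : ℝ) (curvB g e i j)
    simp only [neg_one_smul] at hd
    have wn : ∀ (β : Tot →L[ℝ] ℝ) (w : Tot [⋀^Fin 2]→L[ℝ] ℝ), wedge β (-w) = -wedge β w :=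
      fun β w => ext_three fun u v z => by
        simp only [wedge_two_apply, ContinuousAlternatingMap.neg_apply]
        ring
    simp only [covD]
    rw [hS.extDeriv_eq]
    simp only [h.hodge_curvB h0 hY hc hp', wn]
    refine (congrArg (· + _) hd).trans ?_
    rw [← neg_eq_zero, ← hB, neg_add, neg_neg, ← Finset.sum_neg_distrib]
    congr 1
    exact Finset.sum_congr rfl fun k _ => by abel

end IsParallelFrame

/-! ### Constructing para-Kähler-Einstein structures from frames -/

/-- The braid argument behind uniqueness of the Levi-Civita connection: alternate the two symmetries
until the sign of the original term is reversed. -/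
theorem add_skew_eq_zero {ι : Type*} {D : ι → ι → ι → ℝ} (h1 : ∀ a b c, D a b c = -D b a c)
    (h2 : ∀ a b c, D a b c = D a c b) (a b c : ι) : D a b c = 0 := by
  linarith [h1 a b c, h2 b a c, h1 b c a, h2 c b a, h1 c a b, h2 a c b]

namespace IsNullFrame

variable {g : MetricField} {e : FrameField} {V : Set R4}

/-- A skew connection without torsion is the Levi-Civita connection. -/
theorem connForm_unique (h : IsNullFrame g e V) {x : R4} (hx : x ∈ V)
    {β : Fin 4 → Fin 4 → R4 →L[ℝ] ℝ}
    (hs : ∀ a b, β (dualIdx a) b + β (dualIdx b) a = 0)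
    (ht : ∀ a u v, dOne (coframe g e a) x u v = -∑ b, wedge2 (β a b) (coframe g e b x) u v)
    (a b : Fin 4) : connForm g e a b x = β a b := by
  have key := add_skew_eq_zero
    (D := fun a b c => connForm g e (dualIdx a) b x (e c x) - β (dualIdx a) b (e c x))
    (fun a b c => by
      have h1 := h.connForm_skew hx a b (e c x)
      have h2 := congrArg (fun l => l (e c x)) (hs a b)
      simp only [add_apply, zero_apply] at h2
      linarith)
    (fun a b c => by
      have h1 := h.torsion_frame hx (dualIdx a) b c
      have h2 := ht (dualIdx a) (e b x) (e c x)
      simp [wedge2, h.coframe_apply hx, Finset.sum_sub_distrib] at h2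
      rw [dOne, h1] at h2
      linarith)
  refine h.clm_ext hx fun c => ?_
  have := key (dualIdx a) b c
  simp only [dualIdx_dualIdx] at this
  linarith

/-- Every null frame at a point extends to a null frame field. -/
theorem exists_extension (h : IsNullFrame g e V) {x : R4} (hx : x ∈ V) {f : Fin 4 → R4}
    (hf : ∀ a b, g x (f a) (f b) = eta a b) :
    ∃ e' : FrameField, IsNullFrame g e' V ∧ (fun a => e' a x) = f := by
  -- The change of frame at x is used with constant coefficients. The Gram matrix of the new frame
  -- is then the same at every point, so it can be computed at x.
  let M : Fin 4 → Fin 4 → ℝ := fun a b => coframe g e b x (f a)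
  have hM : ∀ a, f a = ∑ b, M a b • e b x := fun a => h.decomp hx (f a)
  refine ⟨fun a y => ∑ b, M a b • e b y, ⟨h.isOpen, h.smooth_g, h.symm, fun a => ?_, ?_⟩,
    funext fun a => (hM a).symm⟩
  · exact ContDiffOn.sum fun b _ => (h.smooth_e b).const_smul (M a b)
  · have hg : ∀ y ∈ V, ∀ a b, g y (∑ c, M a c • e c y) (∑ d, M b d • e d y) =
        ∑ c, ∑ d, M a c * M b d * eta c d := by
      intro y hy a b
      simp only [map_sum, map_smul, sum_apply, smul_apply, h.orth y hy, smul_eq_mul]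
      rw [Finset.sum_comm]
      refine Finset.sum_congr rfl fun c _ => ?_
      simp only [Finset.mul_sum]
      exact Finset.sum_congr rfl fun d _ => by ring
    intro y hy a b
    rw [hg y hy, ← hg x hx, ← hM, ← hM, hf]

/-- One r serves every null frame at x. This is needed because Ψ₂' ≠ 0 and the Petrov type are
tested on all adapted frames. -/
theorem exists_ricciComp_of_einstein (h : IsNullFrame g e V) (hE : IsEinstein g V) {x : R4}
    (hx : x ∈ V) : ∃ r : ℝ, ∀ f : Fin 4 → R4, (∀ a b, g x (f a) (f b) = eta a b) →
      ∀ a b, ricciComp g x f a b = r * eta a b := by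
  obtain ⟨r, hr⟩ := hE x hx
  refine ⟨r, fun f hf a b => ?_⟩
  obtain ⟨e', h', he'⟩ := h.exists_extension hx hf
  have := h'.ricciComp_eq hx a b
  rw [he'] at this
  rw [this, hr, h'.orth x hx]

theorem isEinstein_of_ricciComp (h : IsNullFrame g e V) {r : ℝ}
    (hr : ∀ x ∈ V, ∀ a b, ricciComp g x (fun a => e a x) a b = r * eta a b) : IsEinstein g V := by
  intro x hx
  refine ⟨r, fun v w => ?_⟩
  have hw : ∀ v w, ricci g x v w = ∑ b, coframe g e b x w * ricci g x v (e b x) := by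
    intro v w
    simp only [ricci, Finset.mul_sum]
    rw [Finset.sum_comm]
    refine Finset.sum_congr rfl fun i _ => ?_
    conv_lhs => rw [h.decomp hx w]
    simp only [h.riem_eq hx, map_sum, map_smul, sum_apply, smul_apply, Pi.add_apply, Pi.sub_apply,
      Finset.sum_apply, Pi.smul_apply, smul_eq_mul, ← Finset.sum_add_distrib,
      ← Finset.sum_sub_distrib]
    exact Finset.sum_congr rfl fun _ _ => by ring
  have hv : ∀ v w, ricci g x v w = ∑ a, coframe g e a x v * ricci g x (e a x) w := by
    intro v w
    simp only [ricci, Finset.mul_sum]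
    rw [Finset.sum_comm]
    refine Finset.sum_congr rfl fun i _ => ?_
    conv_lhs => rw [h.decomp hx v]
    simp only [h.riem_eq hx, map_sum, map_smul, Pi.add_apply, Pi.sub_apply,
      Finset.sum_apply, Pi.smul_apply, smul_eq_mul, ← Finset.sum_add_distrib,
      ← Finset.sum_sub_distrib]
    exact Finset.sum_congr rfl fun _ _ => by ring
  rw [hv]
  conv_rhs => rw [h.decomp hx v]
  simp only [map_sum, map_smul, sum_apply, smul_apply, smul_eq_mul, Finset.mul_sum]
  refine Finset.sum_congr rfl fun a _ => ?_
  rw [hw]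
  conv_rhs => rw [h.decomp hx w]
  simp only [map_sum, map_smul, smul_eq_mul, Finset.mul_sum, ← h.ricciComp_eq hx, hr x hx,
    h.orth x hx]
  exact Finset.sum_congr rfl fun _ _ => by ring

/-- The curvature tensor from the curvature forms. -/
theorem g_riem (h : IsNullFrame g e V) {x : R4} (hx : x ∈ V) (u v w z : R4) :
    g x (riem g x u v w) z = ∑ b, ∑ a, coframe g e b x w * coframe g e (dualIdx a) x z *
      (dOne (connForm g e a b) x u v
        + ∑ c, wedge2 (connForm g e a c x) (connForm g e c b x) u v) := by
  have h1 : riem g x u v w = ∑ b, coframe g e b x w • riem g x u v (e b x) := by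
    conv_lhs => rw [h.decomp hx w]
    simp only [h.riem_eq hx, map_sum, map_smul, smul_add, smul_sub, Finset.sum_add_distrib,
      Finset.sum_sub_distrib]
  have h2 : ∀ b, g x (riem g x u v (e b x)) z = ∑ a, coframe g e (dualIdx a) x z *
      coframe g e a x (riem g x u v (e b x)) := by
    intro b
    conv_lhs => rw [h.decomp hx (riem g x u v (e b x))]
    simp only [map_sum, map_smul, sum_apply, smul_apply, smul_eq_mul]
    exact Finset.sum_congr rfl fun a _ => by simp [coframe, mul_comm]
  rw [h1]
  simp only [map_sum, map_smul, sum_apply, smul_apply, smul_eq_mul, h2, Finset.mul_sum]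
  refine Finset.sum_congr rfl fun b _ => Finset.sum_congr rfl fun a _ => ?_
  rw [h.curvature hx, mul_assoc]
  rfl

theorem para_apply (h : IsNullFrame g e V)
    {K : EndField} (hK : ∀ x ∈ V, ∀ a, K x (e a x) = paraSign a • e a x) {x : R4} (hx : x ∈ V) (u : R4) (b : Fin 4) :
    coframe g e b x (K x u) = paraSign b * coframe g e b x u := by
  conv_lhs => rw [h.decomp hx u]
  simp [hK x hx, h.coframe_apply hx, mul_comm]

theorem coframe_ext (h : IsNullFrame g e V) {x : R4} (hx : x ∈ V) {u v : R4}
    (huv : ∀ a, coframe g e a x u = coframe g e a x v) : u = v := by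
  rw [h.decomp hx u, h.decomp hx v]
  simp only [huv]

theorem isAlmostParaHermitian {K : EndField} (h : IsNullFrame g e V) (hKs : ContDiffOn ℝ ∞ K V)
    (hK : ∀ x ∈ V, ∀ a, K x (e a x) = paraSign a • e a x) : IsAlmostParaHermitian g K V where
  smooth_g := h.smooth_g
  smooth_K := hKs
  symm := h.symm
  nondegenerate x hx u hu := h.g_ext hx fun w => by simp [hu]
  involutive x hx u := h.coframe_ext hx fun a => by
    rw [h.para_apply hK hx, h.para_apply hK hx]
    fin_cases a <;> simp [paraSign]
  compatible x hx u v := by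
    -- Writing u = K(Ku) turns both sides into values of ρ.
    have hv : g x u v = g x (K x (K x u)) v := by
      congr 2
      exact h.coframe_ext hx fun a => by
        rw [h.para_apply hK hx, h.para_apply hK hx]
        fin_cases a <;> simp [paraSign]
    rw [hv, h.fundamentalForm_apply hK hx, h.fundamentalForm_apply hK hx]
    simp only [h.para_apply hK hx, paraSign, Matrix.cons_val]
    ring

end IsNullFrame

/-- A one-form that vanishes on `X`, `Y` vanishes on `[X, Y]` if its exterior derivative does so on
`X`, `Y`. -/
theorem apply_lieBracket_eq_zero {α : R4 → R4 →L[ℝ] ℝ} {X Y : R4 → R4} {x : R4}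
    (hα : DifferentiableAt ℝ α x) (hX : DifferentiableAt ℝ X x) (hY : DifferentiableAt ℝ Y x)
    (h0X : ∀ᶠ y in nhds x, α y (X y) = 0) (h0Y : ∀ᶠ y in nhds x, α y (Y y) = 0)
    (hd : dOne α x (X x) (Y x) = 0) : α x (VectorField.lieBracket ℝ X Y x) = 0 := by
  have key : ∀ Z : R4 → R4, DifferentiableAt ℝ Z x → (∀ᶠ y in nhds x, α y (Z y) = 0) → ∀ u,
      α x (fderiv ℝ Z x u) = -fderiv ℝ α x u (Z x) := by
    intro Z hZ h0 u
    have h1 := hα.hasFDerivAt.clm_apply hZ.hasFDerivAt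
    have h2 : (fun y => α y (Z y)) =ᶠ[nhds x] fun _ => 0 := h0
    have h3 := h2.fderiv_eq (𝕜 := ℝ)
    rw [h1.fderiv] at h3
    have h4 := congrArg (fun l => l u) h3
    simp at h4
    linarith
  rw [VectorField.lieBracket, map_sub, key X hX h0X, key Y hY h0Y]
  simp only [dOne] at hd
  linarith

namespace IsParallelFrame

variable {g : MetricField} {e : FrameField} {V : Set R4} {K : EndField}

/-- For a block diagonal Γ the four structure equations cancel in d(θ¹∧θ³ + θ²∧θ⁴). -/
theorem fundamentalFormClosed (h : IsParallelFrame g e V)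
    (hK : ∀ x ∈ V, ∀ a, K x (e a x) = paraSign a • e a x) : FundamentalFormClosed g K V := by
  intro x hx u v w
  have hd := fun a => h.differentiableAt (h.contDiffOn_coframe a) hx
  have h1 := differentiableAt_const (x := x) (𝕜 := ℝ) (1 : ℝ)
  have hρ : ∀ u v w : R4, fderiv ℝ (fun y => g y (K y v) w) x u =
      fderiv ℝ (fun y => 1 * wedge2 (coframe g e 0 y) (coframe g e 2 y) v w) x u
      + fderiv ℝ (fun y => 1 * wedge2 (coframe g e 1 y) (coframe g e 3 y) v w) x u := by
    intro u v w
    rw [Filter.EventuallyEq.fderiv_eq (𝕜 := ℝ) (h.eventually hx fun y hy =>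
      h.fundamentalForm_apply hK hy v w), ← add_apply,
      ← fderiv_fun_add (differentiableAt_smul_wedge2 h1 (hd 0) (hd 2) v w)
        (differentiableAt_smul_wedge2 h1 (hd 1) (hd 3) v w)]
    simp only [wedge2, one_mul]
  have hsw : fderiv ℝ (fun y => g y (K y u) w) x v = -fderiv ℝ (fun y => g y (K y w) u) x v := by
    rw [← neg_apply, ← fderiv_fun_neg]
    congr 1
    exact Filter.EventuallyEq.fderiv_eq (h.eventually hx fun y hy => by
      simp only [h.fundamentalForm_apply hK hy]; ring)
  rw [hsw, hρ, hρ, hρ]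
  have c0 := cyclic_fderiv_smul_wedge h1 (hd 0) (hd 2) u v w
  have c1 := cyclic_fderiv_smul_wedge h1 (hd 1) (hd 3) u v w
  have D := h.dOne_coframe_eq hx
  have D0 := fun u v => (D u v).1
  have D1 := fun u v => (D u v).2.1
  have D2 := fun u v => (D u v).2.2.1
  have D3 := fun u v => (D u v).2.2.2
  rw [fderiv_const_apply, D0, D0, D0, D2, D2, D2] at c0
  rw [fderiv_const_apply, D1, D1, D1, D3, D3, D3] at c1
  have e0 : ∀ u : R4, (0 : R4 →L[ℝ] ℝ) u = 0 := fun _ => rfl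
  simp only [e0] at c0 c1
  simp only [wedge2] at c0 c1 ⊢
  linear_combination c0 + c1

/-- The Frobenius criterion: θ³, θ⁴ annihilate the +1 eigenspace and θ¹, θ² the other, and each pair
generates a differential ideal because Γ is block diagonal. -/
theorem eigenIntegrable (h : IsParallelFrame g e V)
    (hK : ∀ x ∈ V, ∀ a, K x (e a x) = paraSign a • e a x) :
    EigenIntegrable K 1 V ∧ EigenIntegrable K (-1) V := by
  have hd := fun a x hx => h.differentiableAt (x := x) (h.contDiffOn_coframe a) hx
  constructor <;> intro W X Y hW hWV hX hY hKX hKY x hx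
  · have z : ∀ Z : R4 → R4, (∀ x ∈ W, K x (Z x) = (1 : ℝ) • Z x) → ∀ x ∈ W,
        coframe g e 2 x (Z x) = 0 ∧ coframe g e 3 x (Z x) = 0 := by
      intro Z hZ x hx
      have h2 := h.para_apply hK (hWV hx) (Z x) 2
      have h3 := h.para_apply hK (hWV hx) (Z x) 3
      rw [hZ x hx] at h2 h3
      simp [paraSign] at h2 h3
      constructor <;> linarith
    have n := hW.mem_nhds hx
    have hX' := (hX.contDiffAt n).differentiableAt (by simp)
    have hY' := (hY.contDiffAt n).differentiableAt (by simp)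
    obtain ⟨-, -, d2, d3⟩ := h.dOne_coframe_eq (hWV hx) (X x) (Y x)
    have l2 := apply_lieBracket_eq_zero (hd 2 x (hWV hx)) hX' hY'
      (Filter.mem_of_superset n fun y hy => (z X hKX y hy).1)
      (Filter.mem_of_superset n fun y hy => (z Y hKY y hy).1)
      (by simp [d2, wedge2, z X hKX x hx, z Y hKY x hx])
    have l3 := apply_lieBracket_eq_zero (hd 3 x (hWV hx)) hX' hY'
      (Filter.mem_of_superset n fun y hy => (z X hKX y hy).2)
      (Filter.mem_of_superset n fun y hy => (z Y hKY y hy).2)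
      (by simp [d3, wedge2, z X hKX x hx, z Y hKY x hx])
    refine h.coframe_ext (hWV hx) fun a => ?_
    rw [h.para_apply hK (hWV hx)]
    fin_cases a <;> simp [paraSign, l2, l3]
  · have z : ∀ Z : R4 → R4, (∀ x ∈ W, K x (Z x) = (-1 : ℝ) • Z x) → ∀ x ∈ W,
        coframe g e 0 x (Z x) = 0 ∧ coframe g e 1 x (Z x) = 0 := by
      intro Z hZ x hx
      have h2 := h.para_apply hK (hWV hx) (Z x) 0
      have h3 := h.para_apply hK (hWV hx) (Z x) 1
      rw [hZ x hx] at h2 h3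
      simp [paraSign] at h2 h3
      constructor <;> linarith
    have n := hW.mem_nhds hx
    have hX' := (hX.contDiffAt n).differentiableAt (by simp)
    have hY' := (hY.contDiffAt n).differentiableAt (by simp)
    obtain ⟨d0, d1, -⟩ := h.dOne_coframe_eq (hWV hx) (X x) (Y x)
    have l0 := apply_lieBracket_eq_zero (hd 0 x (hWV hx)) hX' hY'
      (Filter.mem_of_superset n fun y hy => (z X hKX y hy).1)
      (Filter.mem_of_superset n fun y hy => (z Y hKY y hy).1)
      (by simp [d0, wedge2, z X hKX x hx, z Y hKY x hx])
    have l1 := apply_lieBracket_eq_zero (hd 1 x (hWV hx)) hX' hY'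
      (Filter.mem_of_superset n fun y hy => (z X hKX y hy).2)
      (Filter.mem_of_superset n fun y hy => (z Y hKY y hy).2)
      (by simp [d1, wedge2, z X hKX x hx, z Y hKY x hx])
    refine h.coframe_ext (hWV hx) fun a => ?_
    rw [h.para_apply hK (hWV hx)]
    fin_cases a <;> simp [paraSign, l0, l1]

end IsParallelFrame

/-! ### The explicit structures -/

theorem isOpen_exDomain {A B : Set ℝ} (hA : IsOpen A) (hB : IsOpen B) : IsOpen (exDomain A B) :=
  (hA.preimage (continuous_apply 2)).inter (hB.preimage (continuous_apply 3))

/-- The data of the explicit structures. -/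
structure ExData (A B : Set ℝ) (c : ℝ) (f₁ f₂ f₃ f₄ : ℝ → ℝ) : Prop where
  isOpen_A : IsOpen A
  isOpen_B : IsOpen B
  smooth₁ : ContDiffOn ℝ ∞ f₁ A
  smooth₂ : ContDiffOn ℝ ∞ f₂ B
  smooth₃ : ContDiffOn ℝ ∞ f₃ B
  smooth₄ : ContDiffOn ℝ ∞ f₄ A

/-- The coordinate one-forms. -/
def dco (i : Fin 4) : R4 →L[ℝ] ℝ := ContinuousLinearMap.proj (R := ℝ) (φ := fun _ : Fin 4 => ℝ) i

/-- The function `(3/2) c (x² + x f₁(a) + f₂(b))`. -/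
def exP (c : ℝ) (f₁ f₂ : ℝ → ℝ) (z : R4) : ℝ := 3 / 2 * c * (z 0 ^ 2 + z 0 * f₁ (z 2) + f₂ (z 3))

/-- The function `(3/2) c (y² + y f₃(b) + f₄(a))`. -/
def exQ (c : ℝ) (f₃ f₄ : ℝ → ℝ) (z : R4) : ℝ := 3 / 2 * c * (z 1 ^ 2 + z 1 * f₃ (z 3) + f₄ (z 2))

/-- The connection forms of the explicit structures. -/
def exConn (c : ℝ) (f₁ f₂ f₃ f₄ : ℝ → ℝ) (a b : Fin 4) (z : R4) : R4 →L[ℝ] ℝ :=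
  let Γ₁₁ : R4 →L[ℝ] ℝ := -((3 / 2 * c * (2 * z 0 + f₁ (z 2))) • dco 2)
  let Γ₂₂ : R4 →L[ℝ] ℝ := (3 / 2 * c * (2 * z 1 + f₃ (z 3))) • dco 3
  let Γ₁₂ : R4 →L[ℝ] ℝ := (3 / 2 * c * deriv f₄ (z 2)) • dco 3 - (3 / 2 * c * deriv f₂ (z 3)) • dco 2
  (!![Γ₁₁, Γ₁₂, 0, 0; 0, Γ₂₂, 0, 0; 0, 0, -Γ₁₁, 0; 0, 0, -Γ₁₂, -Γ₂₂] :
    Matrix (Fin 4) (Fin 4) (R4 →L[ℝ] ℝ)) a b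

/-- The function `Ψ₄` of the explicit structures. -/
def exPsi4 (c : ℝ) (f₁ f₂ f₃ f₄ : ℝ → ℝ) (z : R4) : ℝ :=
  3 / 2 * c * (deriv (deriv f₂) (z 3) + deriv (deriv f₄) (z 2))
    - 3 / 2 * c * (2 * z 0 + f₁ (z 2)) * (3 / 2 * c * deriv f₄ (z 2))
    - 3 / 2 * c * (2 * z 1 + f₃ (z 3)) * (3 / 2 * c * deriv f₂ (z 3))

theorem hasFDerivAt_coord4 (i : Fin 4) (z : R4) : HasFDerivAt (fun y : R4 => y i) (dco i) z :=
  (dco i).hasFDerivAt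

theorem contDiff_coord4 (i : Fin 4) : ContDiff ℝ ∞ (fun y : R4 => y i) := (dco i).contDiff

theorem exMetric_apply (c : ℝ) (f₁ f₂ f₃ f₄ : ℝ → ℝ) (z u v : R4) :
    exMetric c f₁ f₂ f₃ f₄ z u v = ∑ a, exCoframe c f₁ f₂ f₃ f₄ a z u *
      exCoframe c f₁ f₂ f₃ f₄ (dualIdx a) z v := by
  simp [exMetric]

theorem exMetric_exFrame (c : ℝ) (f₁ f₂ f₃ f₄ : ℝ → ℝ) (z : R4) (a : Fin 4) :
    exMetric c f₁ f₂ f₃ f₄ z (exFrame c f₁ f₂ f₃ f₄ a z) =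
      exCoframe c f₁ f₂ f₃ f₄ (dualIdx a) z := by
  ext v
  simp [exMetric_apply, exCoframe_exFrame]

theorem exPara_exFrame (c : ℝ) (f₁ f₂ f₃ f₄ : ℝ → ℝ) (z : R4) (a : Fin 4) :
    exPara c f₁ f₂ f₃ f₄ z (exFrame c f₁ f₂ f₃ f₄ a z) =
      paraSign a • exFrame c f₁ f₂ f₃ f₄ a z := by
  simp [exPara, exCoframe_exFrame]

theorem coframe_exFrame (c : ℝ) (f₁ f₂ f₃ f₄ : ℝ → ℝ) (a : Fin 4) :
    coframe (exMetric c f₁ f₂ f₃ f₄) (exFrame c f₁ f₂ f₃ f₄) a = exCoframe c f₁ f₂ f₃ f₄ a := by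
  funext z
  rw [coframe, exMetric_exFrame, dualIdx_dualIdx]

namespace ExData

variable {A B : Set ℝ} {c : ℝ} {f₁ f₂ f₃ f₄ : ℝ → ℝ}

theorem comp_fst {f : ℝ → ℝ} (hf : ContDiffOn ℝ ∞ f A) :
    ContDiffOn ℝ ∞ (fun z : R4 => f (z 2)) (exDomain A B) :=
  hf.comp (contDiff_coord4 2).contDiffOn fun _ hz => hz.1

theorem comp_snd {f : ℝ → ℝ} (hf : ContDiffOn ℝ ∞ f B) :
    ContDiffOn ℝ ∞ (fun z : R4 => f (z 3)) (exDomain A B) :=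
  hf.comp (contDiff_coord4 3).contDiffOn fun _ hz => hz.2

theorem contDiffOn_exP (h : ExData A B c f₁ f₂ f₃ f₄) :
    ContDiffOn ℝ ∞ (exP c f₁ f₂) (exDomain A B) := by
  have x := (contDiff_coord4 0).contDiffOn (s := exDomain A B)
  exact contDiffOn_const.mul (((x.pow 2).add (x.mul (comp_fst h.smooth₁))).add (comp_snd h.smooth₂))

theorem contDiffOn_exQ (h : ExData A B c f₁ f₂ f₃ f₄) :
    ContDiffOn ℝ ∞ (exQ c f₃ f₄) (exDomain A B) := by
  have x := (contDiff_coord4 1).contDiffOn (s := exDomain A B)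
  exact contDiffOn_const.mul (((x.pow 2).add (x.mul (comp_snd h.smooth₃))).add (comp_fst h.smooth₄))

theorem contDiffOn_exCoframe (h : ExData A B c f₁ f₂ f₃ f₄) (a : Fin 4) :
    ContDiffOn ℝ ∞ (exCoframe c f₁ f₂ f₃ f₄ a) (exDomain A B) := by
  fin_cases a
  · exact contDiffOn_const.sub (h.contDiffOn_exP.smul contDiffOn_const)
  · exact contDiffOn_const
  · exact contDiffOn_const
  · exact contDiffOn_const.sub (h.contDiffOn_exQ.smul contDiffOn_const)

theorem contDiffOn_exFrame (h : ExData A B c f₁ f₂ f₃ f₄) (a : Fin 4) :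
    ContDiffOn ℝ ∞ (exFrame c f₁ f₂ f₃ f₄ a) (exDomain A B) := by
  rw [contDiffOn_pi]
  intro i
  fin_cases a <;> fin_cases i <;>
    first
    | exact contDiffOn_const (c := (0 : ℝ))
    | exact contDiffOn_const (c := (1 : ℝ))
    | exact h.contDiffOn_exP
    | exact h.contDiffOn_exQ

theorem isNullFrame (h : ExData A B c f₁ f₂ f₃ f₄) :
    IsNullFrame (exMetric c f₁ f₂ f₃ f₄) (exFrame c f₁ f₂ f₃ f₄) (exDomain A B) where
  isOpen := isOpen_exDomain h.isOpen_A h.isOpen_B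
  smooth_g := ContDiffOn.sum fun a _ =>
    (h.contDiffOn_exCoframe a).smulRight (h.contDiffOn_exCoframe (dualIdx a))
  symm z _ u v := by
    rw [exMetric_apply, exMetric_apply]
    simp only [Fin.sum_univ_four, dualIdx, Matrix.cons_val]
    ring
  smooth_e := h.contDiffOn_exFrame
  orth z _ a b := by
    rw [exMetric_exFrame, exCoframe_exFrame]
    simp [eta, eq_comm]

theorem contDiffOn_exPara (h : ExData A B c f₁ f₂ f₃ f₄) :
    ContDiffOn ℝ ∞ (exPara c f₁ f₂ f₃ f₄) (exDomain A B) :=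
  ContDiffOn.sum fun a _ =>
    ((h.contDiffOn_exCoframe a).smulRight (h.contDiffOn_exFrame a)).const_smul (paraSign a)

theorem hasFDerivAt_comp_fst {f : ℝ → ℝ} {z : R4} (hA : IsOpen A) (hf : ContDiffOn ℝ ∞ f A)
    (hz : z ∈ exDomain A B) : HasFDerivAt (fun y : R4 => f (y 2)) (deriv f (z 2) • dco 2) z :=
  ((hf.contDiffAt (hA.mem_nhds hz.1)).differentiableAt (by simp)).hasDerivAt.comp_hasFDerivAt z
    (hasFDerivAt_coord4 2 z)

theorem hasFDerivAt_comp_snd {f : ℝ → ℝ} {z : R4} (hB : IsOpen B) (hf : ContDiffOn ℝ ∞ f B)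
    (hz : z ∈ exDomain A B) : HasFDerivAt (fun y : R4 => f (y 3)) (deriv f (z 3) • dco 3) z :=
  ((hf.contDiffAt (hB.mem_nhds hz.2)).differentiableAt (by simp)).hasDerivAt.comp_hasFDerivAt z
    (hasFDerivAt_coord4 3 z)

theorem hasFDerivAt_exP (h : ExData A B c f₁ f₂ f₃ f₄) {z : R4} (hz : z ∈ exDomain A B) :
    HasFDerivAt (exP c f₁ f₂) ((3 / 2 * c * (2 * z 0 + f₁ (z 2))) • dco 0
      + (3 / 2 * c * z 0 * deriv f₁ (z 2)) • dco 2 + (3 / 2 * c * deriv f₂ (z 3)) • dco 3) z := by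
  have x := hasFDerivAt_coord4 0 z
  refine (((x.pow 2).add (x.mul (hasFDerivAt_comp_fst h.isOpen_A h.smooth₁ hz))).add
    (hasFDerivAt_comp_snd h.isOpen_B h.smooth₂ hz)).const_mul (3 / 2 * c) |>.congr_fderiv ?_
  ext u
  simp
  ring

theorem hasFDerivAt_exQ (h : ExData A B c f₁ f₂ f₃ f₄) {z : R4} (hz : z ∈ exDomain A B) :
    HasFDerivAt (exQ c f₃ f₄) ((3 / 2 * c * (2 * z 1 + f₃ (z 3))) • dco 1
      + (3 / 2 * c * z 1 * deriv f₃ (z 3)) • dco 3 + (3 / 2 * c * deriv f₄ (z 2)) • dco 2) z := by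
  have x := hasFDerivAt_coord4 1 z
  refine (((x.pow 2).add (x.mul (hasFDerivAt_comp_snd h.isOpen_B h.smooth₃ hz))).add
    (hasFDerivAt_comp_fst h.isOpen_A h.smooth₄ hz)).const_mul (3 / 2 * c) |>.congr_fderiv ?_
  ext u
  simp
  ring

theorem exCoframe_zero : exCoframe c f₁ f₂ f₃ f₄ 0 = fun z => dco 0 - exP c f₁ f₂ z • dco 2 := rfl
theorem exCoframe_one : exCoframe c f₁ f₂ f₃ f₄ 1 = fun _ => dco 3 := rfl
theorem exCoframe_two : exCoframe c f₁ f₂ f₃ f₄ 2 = fun _ => dco 2 := rfl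
theorem exCoframe_three : exCoframe c f₁ f₂ f₃ f₄ 3 = fun z => dco 1 - exQ c f₃ f₄ z • dco 3 := rfl

/-- With P = `exP` and Q = `exQ`, the derivatives P_x and Q_y produce Γ¹₁ and Γ²₂, while P_b and Q_a
produce Γ¹₂. No Γ²₁ is needed. -/
theorem dOne_exCoframe (h : ExData A B c f₁ f₂ f₃ f₄) {z : R4} (hz : z ∈ exDomain A B) (a : Fin 4)
    (u v : R4) : dOne (exCoframe c f₁ f₂ f₃ f₄ a) z u v =
      -∑ b, wedge2 (exConn c f₁ f₂ f₃ f₄ a b z) (exCoframe c f₁ f₂ f₃ f₄ b z) u v := by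
  have hP := h.hasFDerivAt_exP hz
  have hQ := h.hasFDerivAt_exQ hz
  have hd : ∀ (i j : Fin 4) {f : R4 → ℝ} {f' : R4 →L[ℝ] ℝ}, HasFDerivAt f f' z →
      dOne (fun y => dco i - f y • dco j) z u v = -wedge2 f' (dco j) u v := by
    intro i j f f' hf
    rw [dOne_fun_sub (differentiableAt_const _) (hf.differentiableAt.smul_const _), dOne_const,
      dOne_fun_smul hf.differentiableAt (differentiableAt_const _), dOne_const, hf.fderiv]
    ring
  have e0 : dOne (exCoframe c f₁ f₂ f₃ f₄ 0) z u v = _ := hd 0 2 hP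
  have e3 : dOne (exCoframe c f₁ f₂ f₃ f₄ 3) z u v = _ := hd 1 3 hQ
  have e1 : dOne (exCoframe c f₁ f₂ f₃ f₄ 1) z u v = 0 := dOne_const _ _ _ _
  have e2 : dOne (exCoframe c f₁ f₂ f₃ f₄ 2) z u v = 0 := dOne_const _ _ _ _
  fin_cases a
  · refine e0.trans ?_
    simp [Fin.sum_univ_four, exConn, exCoframe_zero, exCoframe_one, exCoframe_two, exCoframe_three,
      wedge2]
    ring
  · refine e1.trans ?_
    simp [Fin.sum_univ_four, exConn, exCoframe_zero, exCoframe_one, exCoframe_two, exCoframe_three,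
      wedge2]
    ring
  · refine e2.trans ?_
    simp [Fin.sum_univ_four, exConn, exCoframe_zero, exCoframe_one, exCoframe_two, exCoframe_three,
      wedge2]
    ring
  · refine e3.trans ?_
    simp [Fin.sum_univ_four, exConn, exCoframe_zero, exCoframe_one, exCoframe_two, exCoframe_three,
      wedge2]
    ring

theorem connForm_eq (h : ExData A B c f₁ f₂ f₃ f₄) {z : R4} (hz : z ∈ exDomain A B) (a b : Fin 4) :
    connForm (exMetric c f₁ f₂ f₃ f₄) (exFrame c f₁ f₂ f₃ f₄) a b z
      = exConn c f₁ f₂ f₃ f₄ a b z := by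
  refine h.isNullFrame.connForm_unique hz (β := fun a b => exConn c f₁ f₂ f₃ f₄ a b z)
    (fun a b => ?_) (fun a u v => ?_) a b
  · fin_cases a <;> fin_cases b <;> simp [dualIdx, exConn]
  · simp only [coframe_exFrame]
    exact h.dOne_exCoframe hz a u v

/-- The squares x², y² with factor (3/2)c have second derivative 3c, so dΓ¹₁ = -3c θ¹∧θ³ and dΓ²₂ =
-3c θ²∧θ⁴. This is `curvature_reduced` with Γ²₁ = 0 and Ψ₂ = Ψ₂' = c. -/
theorem dOne_connForm (h : ExData A B c f₁ f₂ f₃ f₄) {z : R4} (hz : z ∈ exDomain A B) (u v : R4) :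
    let Γ := connForm (exMetric c f₁ f₂ f₃ f₄) (exFrame c f₁ f₂ f₃ f₄)
    let W := wedge2 (dco 2) (dco 3) u v
    dOne (Γ 0 0) z u v = -(3 * c) * wedge2 (dco 0) (dco 2) u v ∧
    dOne (Γ 1 1) z u v = 3 * c * wedge2 (dco 1) (dco 3) u v ∧
    dOne (Γ 0 1) z u v = 3 / 2 * c * (deriv (deriv f₂) (z 3) + deriv (deriv f₄) (z 2)) * W := by
  intro Γ W
  have hev : ∀ a b, Γ a b =ᶠ[nhds z] exConn c f₁ f₂ f₃ f₄ a b := fun a b =>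
    h.isNullFrame.eventually hz fun y hy => h.connForm_eq hy a b
  simp only [(hev _ _).dOne_eq]
  have hD2 : ContDiffOn ℝ ∞ (deriv f₂) B := h.smooth₂.deriv_of_isOpen h.isOpen_B (by simp)
  have hD4 : ContDiffOn ℝ ∞ (deriv f₄) A := h.smooth₄.deriv_of_isOpen h.isOpen_A (by simp)
  have s := fun (j : Fin 4) {f : R4 → ℝ} {f' : R4 →L[ℝ] ℝ} (hf : HasFDerivAt f f' z) =>
    (dOne_fun_smul hf.differentiableAt (differentiableAt_const (dco j)) u v).trans
      (by rw [dOne_const, hf.fderiv, mul_zero, zero_add] : _ = wedge2 f' (dco j) u v)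
  have g0 : HasFDerivAt (fun y : R4 => 3 / 2 * c * (2 * y 0 + f₁ (y 2))) _ z :=
    (((hasFDerivAt_coord4 0 z).const_mul 2).add
      (hasFDerivAt_comp_fst h.isOpen_A h.smooth₁ hz)).const_mul (3 / 2 * c)
  have g1 : HasFDerivAt (fun y : R4 => 3 / 2 * c * (2 * y 1 + f₃ (y 3))) _ z :=
    (((hasFDerivAt_coord4 1 z).const_mul 2).add
      (hasFDerivAt_comp_snd h.isOpen_B h.smooth₃ hz)).const_mul (3 / 2 * c)
  have g4 := (hasFDerivAt_comp_fst h.isOpen_A hD4 hz).const_mul (3 / 2 * c)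
  have g2 := (hasFDerivAt_comp_snd h.isOpen_B hD2 hz).const_mul (3 / 2 * c)
  refine ⟨?_, ?_, ?_⟩
  · refine (dOne_fun_neg (α := fun y : R4 => (3 / 2 * c * (2 * y 0 + f₁ (y 2))) • dco 2) u v).trans
      ((congrArg _ (s 2 g0)).trans ?_)
    simp [wedge2]
    ring
  · refine (s 3 g1).trans ?_
    simp [wedge2]
    ring
  · refine (dOne_fun_sub (g4.differentiableAt.smul_const _) (g2.differentiableAt.smul_const _)
      u v).trans ?_
    rw [s 3 g4, s 2 g2]
    simp [wedge2, W]
    ring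

/-- The curvature tensor of the explicit structures. -/
theorem g_riem_eq (h : ExData A B c f₁ f₂ f₃ f₄) {z : R4} (hz : z ∈ exDomain A B) (u v w t : R4) :
    let θ := fun a => exCoframe c f₁ f₂ f₃ f₄ a z
    exMetric c f₁ f₂ f₃ f₄ z (riem (exMetric c f₁ f₂ f₃ f₄) z u v w) t =
      -(3 * c) * (wedge2 (θ 0) (θ 2) u v * wedge2 (θ 0) (θ 2) w t)
      - 3 * c * (wedge2 (θ 1) (θ 3) u v * wedge2 (θ 1) (θ 3) w t)
      - exPsi4 c f₁ f₂ f₃ f₄ z * (wedge2 (θ 1) (θ 2) u v * wedge2 (θ 1) (θ 2) w t) := by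
  intro θ
  obtain ⟨d00, d11, d01⟩ := h.dOne_connForm hz u v
  have hN := h.isNullFrame
  have hcz : ∀ a b, (∀ y ∈ exDomain A B, exConn c f₁ f₂ f₃ f₄ a b y = 0) →
      dOne (connForm (exMetric c f₁ f₂ f₃ f₄) (exFrame c f₁ f₂ f₃ f₄) a b) z u v = 0 := by
    intro a b hab
    have : connForm (exMetric c f₁ f₂ f₃ f₄) (exFrame c f₁ f₂ f₃ f₄) a b =ᶠ[nhds z] fun _ => 0 :=
      hN.eventually hz fun y hy => (h.connForm_eq hy a b).trans (hab y hy)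
    rw [this.dOne_eq, dOne_const]
  have hcn : ∀ a b a' b', (∀ y ∈ exDomain A B, exConn c f₁ f₂ f₃ f₄ a b y
        = -exConn c f₁ f₂ f₃ f₄ a' b' y) →
      dOne (connForm (exMetric c f₁ f₂ f₃ f₄) (exFrame c f₁ f₂ f₃ f₄) a b) z u v =
      -dOne (connForm (exMetric c f₁ f₂ f₃ f₄) (exFrame c f₁ f₂ f₃ f₄) a' b') z u v := by
    intro a b a' b' hab
    have : connForm (exMetric c f₁ f₂ f₃ f₄) (exFrame c f₁ f₂ f₃ f₄) a b =ᶠ[nhds z]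
        fun y => -connForm (exMetric c f₁ f₂ f₃ f₄) (exFrame c f₁ f₂ f₃ f₄) a' b' y :=
      hN.eventually hz fun y hy => (h.connForm_eq hy a b).trans
        ((hab y hy).trans (congrArg _ (h.connForm_eq hy a' b').symm))
    rw [this.dOne_eq, dOne_fun_neg]
  have d22 := hcn 2 2 0 0 fun y _ => rfl
  have d33 := hcn 3 3 1 1 fun y _ => rfl
  have d32 := hcn 3 2 0 1 fun y _ => rfl
  have z02 := hcz 0 2 fun y _ => rfl
  have z03 := hcz 0 3 fun y _ => rfl
  have z10 := hcz 1 0 fun y _ => rfl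
  have z12 := hcz 1 2 fun y _ => rfl
  have z13 := hcz 1 3 fun y _ => rfl
  have z20 := hcz 2 0 fun y _ => rfl
  have z21 := hcz 2 1 fun y _ => rfl
  have z23 := hcz 2 3 fun y _ => rfl
  have z30 := hcz 3 0 fun y _ => rfl
  have z31 := hcz 3 1 fun y _ => rfl
  rw [hN.g_riem hz]
  simp only [Fin.sum_univ_four, coframe_exFrame, h.connForm_eq hz, d22, d33, d32, d00, d11, d01,
    z02, z03, z10, z12, z13, z20, z21, z23, z30, z31]
  simp [dualIdx, θ, exConn, exCoframe_zero, exCoframe_one, exCoframe_two, exCoframe_three, wedge2,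
    exPsi4]
  ring

end ExData

/-! ### Root types of binary quartics -/

/-- The quartic `Ψ₄ (b' X + b Y)⁴ + 6 c (b' X + b Y)² (a' X + a Y)²` has one double root and two
simple roots. -/
theorem hasRootTypeII_of_eq {a b a' b' k c Ψ : ℝ} (hk : (a * b' - a' * b) * k = 1) (hc : c ≠ 0)
    (hΨ : Ψ ≠ 0) {q : Fin 5 → ℝ}
    (h0 : q 0 = k ^ 2 * (Ψ * b ^ 4 + 6 * c * a ^ 2 * b ^ 2))
    (h1 : q 1 = k ^ 2 * (Ψ * b ^ 3 * b' + 3 * c * a * b * (a * b' + a' * b)))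
    (h2 : q 2 = k ^ 2 * (Ψ * b ^ 2 * b' ^ 2
      + c * (a ^ 2 * b' ^ 2 + 4 * a * a' * b * b' + a' ^ 2 * b ^ 2)))
    (h3 : q 3 = k ^ 2 * (Ψ * b * b' ^ 3 + 3 * c * a' * b' * (a * b' + a' * b)))
    (h4 : q 4 = k ^ 2 * (Ψ * b' ^ 4 + 6 * c * a' ^ 2 * b' ^ 2)) : HasRootTypeII q := by
  -- With L = b'X + bY, M = a'X + aY and Ψs² = -6c, one has ΨL² + 6cM² = Ψ(L - sM)(L + sM). The root
  -- is complex, so the sign of c/Ψ plays no role.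
  obtain ⟨s, hs⟩ := IsAlgClosed.exists_pow_nat_eq (-(6 * c / Ψ) : ℂ) (n := 2) (by norm_num)
  have hΨ' : (Ψ : ℂ) ≠ 0 := by exact_mod_cast hΨ
  have hc' : (c : ℂ) ≠ 0 := by exact_mod_cast hc
  have hk' : ((a : ℂ) * b' - a' * b) * k = 1 := by exact_mod_cast hk
  have hk0 : (k : ℂ) ≠ 0 := right_ne_zero_of_mul_eq_one hk'
  have hΔ : (a : ℂ) * b' - a' * b ≠ 0 := left_ne_zero_of_mul_eq_one hk'
  have hsΨ : (Ψ : ℂ) * s ^ 2 = -(6 * c) := by rw [hs]; field_simp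
  have hs0 : s ≠ 0 := by
    rintro rfl
    simp [hc'] at hsΨ
  refine ⟨![b', b], ![k ^ 2 * Ψ * (b' - s * a'), k ^ 2 * Ψ * (b - s * a)],
    ![b' + s * a', b + s * a], ?_, ?_, ?_, fun X Y => ?_⟩
  · have : (k : ℂ) ^ 2 * Ψ * s * ((a : ℂ) * b' - a' * b) ≠ 0 := by simp [hk0, hΨ', hs0, hΔ]
    intro h
    simp only [Matrix.cons_val_zero, Matrix.cons_val_one] at h
    exact this (by linear_combination -h)
  · have : s * ((a : ℂ) * b' - a' * b) ≠ 0 := by simp [hs0, hΔ]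
    intro h
    simp only [Matrix.cons_val_zero, Matrix.cons_val_one] at h
    exact this (by linear_combination h)
  · have : (k : ℂ) ^ 2 * Ψ * s * ((a : ℂ) * b' - a' * b) ≠ 0 := by simp [hk0, hΨ', hs0, hΔ]
    intro h
    simp only [Matrix.cons_val_zero, Matrix.cons_val_one] at h
    exact this (by linear_combination h / 2)
  · rw [h0, h1, h2, h3, h4]
    push_cast
    linear_combination ((b' : ℂ) * X + b * Y) ^ 2 * (a' * X + a * Y) ^ 2 * (k : ℂ) ^ 2 * hsΨ

/-- The quartic 6cX²Y² has only two roots on the projective line, whereas the factors p, l, m have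
three distinct ones. -/
theorem not_hasRootTypeII {c : ℝ} (hc : c ≠ 0) {q : Fin 5 → ℝ} (h0 : q 0 = 0) (h1 : q 1 = 0)
    (h2 : q 2 = c) (h3 : q 3 = 0) (h4 : q 4 = 0) : ¬HasRootTypeII q := by
  rintro ⟨p, l, m, hpl, hpm, hlm, h⟩
  have hc' : (c : ℂ) ≠ 0 := by exact_mod_cast hc
  simp only [h0, h1, h2, h3, h4, Complex.ofReal_zero] at h
  -- Each linear factor is evaluated at its own zero.
  have e1 := h (p 1) (-p 0)
  have e2 := h (l 1) (-l 0)
  have e3 := h (m 1) (-m 0)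
  have z : ∀ t : Fin 2 → ℂ, 6 * (c : ℂ) * t 1 ^ 2 * t 0 ^ 2 = 0 → t 0 = 0 ∨ t 1 = 0 := by
    intro t ht
    simpa [hc', or_comm] using ht
  have k1 := z p (by linear_combination e1)
  have k2 := z l (by linear_combination e2)
  have k3 := z m (by linear_combination e3)
  rcases k1 with k1 | k1 <;> rcases k2 with k2 | k2 <;> rcases k3 with k3 | k3 <;>
    simp [k1, k2, k3] at hpl hpm hlm

/-! ### Weyl components and Petrov type of the explicit structures -/

namespace ExData

variable {A B : Set ℝ} {c : ℝ} {f₁ f₂ f₃ f₄ : ℝ → ℝ}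

theorem ricciComp_eq (h : ExData A B c f₁ f₂ f₃ f₄) {z : R4} (hz : z ∈ exDomain A B) (a b : Fin 4) :
    ricciComp (exMetric c f₁ f₂ f₃ f₄) z (fun a => exFrame c f₁ f₂ f₃ f₄ a z) a b
      = -3 * c * eta a b := by
  simp only [ricciComp, riemComp, h.g_riem_eq hz, wedge2, exCoframe_exFrame]
  fin_cases a <;> fin_cases b <;> simp [Fin.sum_univ_four, dualIdx, eta]

theorem isParallelFrame (h : ExData A B c f₁ f₂ f₃ f₄) :
    IsParallelFrame (exMetric c f₁ f₂ f₃ f₄) (exFrame c f₁ f₂ f₃ f₄) (exDomain A B) where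
  toIsNullFrame := h.isNullFrame
  conn_two_one z hz := by rw [h.connForm_eq hz]; rfl
  conn_zero_three z hz := by rw [h.connForm_eq hz]; rfl
  einstein := h.isNullFrame.isEinstein_of_ricciComp fun z hz => h.ricciComp_eq hz

/-- The Weyl tensor of the explicit structures in any adapted frame. -/
theorem weylComp_eq (h : ExData A B c f₁ f₂ f₃ f₄) {z : R4} (hz : z ∈ exDomain A B)
    {f : Fin 4 → R4} (hf : ∀ a b, exMetric c f₁ f₂ f₃ f₄ z (f a) (f b) = eta a b) (i j k l : Fin 4) :
    weylComp (exMetric c f₁ f₂ f₃ f₄) z f i j k l = riemComp (exMetric c f₁ f₂ f₃ f₄) z f i j k l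
      - c * (eta i l * eta j k - eta i k * eta j l) := by
  obtain ⟨r, hr⟩ := h.isNullFrame.exists_ricciComp_of_einstein h.isParallelFrame.einstein hz
  have h1 := hr _ (h.isNullFrame.orth z hz) 0 2
  rw [h.ricciComp_eq hz] at h1
  simp [eta, dualIdx] at h1
  rw [weylComp_of_ricciComp (hr f hf), ← h1]
  ring

/-- An adapted frame differs from the given one by a block diagonal matrix whose second block is the
inverse transpose of the first. -/
theorem adapted_apply (h : ExData A B c f₁ f₂ f₃ f₄) {z : R4} (hz : z ∈ exDomain A B)
    {f : Fin 4 → R4} (hf : IsAdaptedAt (exMetric c f₁ f₂ f₃ f₄) (exPara c f₁ f₂ f₃ f₄) z f) :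
    let θ := fun a b => exCoframe c f₁ f₂ f₃ f₄ a z (f b)
    θ 2 0 = 0 ∧ θ 3 0 = 0 ∧ θ 2 1 = 0 ∧ θ 3 1 = 0 ∧ θ 0 2 = 0 ∧ θ 1 2 = 0 ∧ θ 0 3 = 0 ∧ θ 1 3 = 0 ∧
    θ 0 0 * θ 2 2 + θ 1 0 * θ 3 2 = 1 ∧ θ 0 0 * θ 2 3 + θ 1 0 * θ 3 3 = 0 ∧
    θ 0 1 * θ 2 2 + θ 1 1 * θ 3 2 = 0 ∧ θ 0 1 * θ 2 3 + θ 1 1 * θ 3 3 = 1 := by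
  intro θ
  have hp : ∀ a b, paraSign a * θ b a = paraSign b * θ b a := by
    intro a b
    have h1 := h.isNullFrame.para_apply (fun x _ a => exPara_exFrame c f₁ f₂ f₃ f₄ x a) hz (f a) b
    rw [hf.2 a, map_smul, coframe_exFrame, smul_eq_mul] at h1
    exact h1
  have g := fun a b => (exMetric_apply c f₁ f₂ f₃ f₄ z (f a) (f b)).symm.trans (hf.1 a b)
  have z20 : θ 2 0 = 0 := by have := hp 0 2; simp [paraSign] at this; linarith
  have z30 : θ 3 0 = 0 := by have := hp 0 3; simp [paraSign] at this; linarith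
  have z21 : θ 2 1 = 0 := by have := hp 1 2; simp [paraSign] at this; linarith
  have z31 : θ 3 1 = 0 := by have := hp 1 3; simp [paraSign] at this; linarith
  have z02 : θ 0 2 = 0 := by have := hp 2 0; simp [paraSign] at this; linarith
  have z12 : θ 1 2 = 0 := by have := hp 2 1; simp [paraSign] at this; linarith
  have z03 : θ 0 3 = 0 := by have := hp 3 0; simp [paraSign] at this; linarith
  have z13 : θ 1 3 = 0 := by have := hp 3 1; simp [paraSign] at this; linarith
  have g02 := g 0 2
  have g03 := g 0 3
  have g12 := g 1 2
  have g13 := g 1 3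
  change ∑ a, θ a 0 * θ (dualIdx a) 2 = _ at g02
  change ∑ a, θ a 0 * θ (dualIdx a) 3 = _ at g03
  change ∑ a, θ a 1 * θ (dualIdx a) 2 = _ at g12
  change ∑ a, θ a 1 * θ (dualIdx a) 3 = _ at g13
  simp [Fin.sum_univ_four, dualIdx, eta, z20, z30, z21, z31] at g02 g03 g12 g13
  exact ⟨z20, z30, z21, z31, z02, z12, z03, z13, g02, g03, g12, g13⟩

/-- The three terms of the curvature tensor vanish on two vectors of the same null plane, so only
the trace part c is left. -/
theorem psi2'_eq (h : ExData A B c f₁ f₂ f₃ f₄) {z : R4} (hz : z ∈ exDomain A B)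
    {f : Fin 4 → R4} (hf : IsAdaptedAt (exMetric c f₁ f₂ f₃ f₄) (exPara c f₁ f₂ f₃ f₄) z f) :
    psi2' (exMetric c f₁ f₂ f₃ f₄) z f = c := by
  obtain ⟨z20, z30, z21, z31, z02, z12, z03, z13, -⟩ := h.adapted_apply hz hf
  rw [psi2', h.weylComp_eq hz hf.1, riemComp, h.g_riem_eq hz]
  simp [wedge2, z20, z30, z21, z31, z02, z12, z03, z13, eta, dualIdx]

theorem isAdaptedAt (h : ExData A B c f₁ f₂ f₃ f₄) {z : R4} (hz : z ∈ exDomain A B) :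
    IsAdaptedAt (exMetric c f₁ f₂ f₃ f₄) (exPara c f₁ f₂ f₃ f₄) z
      (fun a => exFrame c f₁ f₂ f₃ f₄ a z) :=
  ⟨h.isNullFrame.orth z hz, exPara_exFrame c f₁ f₂ f₃ f₄ z⟩

theorem psi_eq (h : ExData A B c f₁ f₂ f₃ f₄) {z : R4} (hz : z ∈ exDomain A B) :
    psi (exMetric c f₁ f₂ f₃ f₄) z (fun a => exFrame c f₁ f₂ f₃ f₄ a z) =
      ![0, 0, c, 0, exPsi4 c f₁ f₂ f₃ f₄ z] := by
  have hw := h.weylComp_eq hz (h.isNullFrame.orth z hz)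
  simp only [riemComp, h.g_riem_eq hz, wedge2, exCoframe_exFrame] at hw
  ext i
  fin_cases i <;> simp [psi, hw, eta, dualIdx]

theorem isPKE (h : ExData A B c f₁ f₂ f₃ f₄) (hc : c ≠ 0) :
    IsPKE (exMetric c f₁ f₂ f₃ f₄) (exPara c f₁ f₂ f₃ f₄) (exDomain A B) := by
  have hK : ∀ x ∈ exDomain A B, ∀ a, exPara c f₁ f₂ f₃ f₄ x (exFrame c f₁ f₂ f₃ f₄ a x)
      = paraSign a • exFrame c f₁ f₂ f₃ f₄ a x := fun x _ a => exPara_exFrame c f₁ f₂ f₃ f₄ x a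
  have hI := h.isParallelFrame.eigenIntegrable hK
  exact ⟨h.isNullFrame.isAlmostParaHermitian h.contDiffOn_exPara hK, hI.1, hI.2,
    h.isParallelFrame.fundamentalFormClosed hK, h.isParallelFrame.einstein,
    fun x hx f hf => by rwa [h.psi2'_eq hx hf]⟩

theorem isF6Section (h : ExData A B c f₁ f₂ f₃ f₄) (hc : c ≠ 0) :
    IsF6Section (exMetric c f₁ f₂ f₃ f₄) (exPara c f₁ f₂ f₃ f₄) (exDomain A B)
      (exFrame c f₁ f₂ f₃ f₄) :=
  ⟨h.contDiffOn_exFrame, fun z hz => ⟨h.isAdaptedAt hz, by simp [h.psi_eq hz],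
    by simp [h.psi_eq hz], by simp [h.psi_eq hz], by simpa [h.psi_eq hz] using hc⟩⟩

theorem ymConditions (h : ExData A B c f₁ f₂ f₃ f₄) {z : R4} (hz : z ∈ exDomain A B) :
    YMConditions (exMetric c f₁ f₂ f₃ f₄) (exFrame c f₁ f₂ f₃ f₄) z := by
  refine ⟨?_, ?_, ?_, ?_, ?_⟩
  · rw [h.psi2'_eq hz (h.isAdaptedAt hz), h.psi_eq hz]; rfl
  all_goals simp [J, h.connForm_eq hz, exConn, exFrame, dco]

theorem isPetrovII_iff (h : ExData A B c f₁ f₂ f₃ f₄) (hc : c ≠ 0) {z : R4}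
    (hz : z ∈ exDomain A B) :
    IsPetrovII (exMetric c f₁ f₂ f₃ f₄) (exPara c f₁ f₂ f₃ f₄) z ↔ exPsi4 c f₁ f₂ f₃ f₄ z ≠ 0 := by
  constructor
  · intro hII hΨ
    refine not_hasRootTypeII hc ?_ ?_ ?_ ?_ ?_ (hII _ (h.isAdaptedAt hz)) <;>
      simp [h.psi_eq hz, hΨ]
  · intro hΨ f hf
    obtain ⟨z20, z30, z21, z31, z02, z12, z03, z13, g02, g03, g12, g13⟩ := h.adapted_apply hz hf
    beta_reduce at z20 z30 z21 z31 z02 z12 z03 z13 g02 g03 g12 g13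
    have hw := h.weylComp_eq hz hf.1
    simp only [riemComp, h.g_riem_eq hz, wedge2] at hw
    generalize exPsi4 c f₁ f₂ f₃ f₄ z = Ψ at *
    generalize ha : exCoframe c f₁ f₂ f₃ f₄ 0 z (f 0) = a at *
    generalize hb : exCoframe c f₁ f₂ f₃ f₄ 1 z (f 0) = b at *
    generalize ha' : exCoframe c f₁ f₂ f₃ f₄ 0 z (f 1) = a' at *
    generalize hb' : exCoframe c f₁ f₂ f₃ f₄ 1 z (f 1) = b' at *
    generalize hp : exCoframe c f₁ f₂ f₃ f₄ 2 z (f 2) = p at *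
    generalize hq : exCoframe c f₁ f₂ f₃ f₄ 3 z (f 2) = q at *
    generalize hp' : exCoframe c f₁ f₂ f₃ f₄ 2 z (f 3) = p' at *
    generalize hq' : exCoframe c f₁ f₂ f₃ f₄ 3 z (f 3) = q' at *
    have hk : (a * b' - a' * b) * (p * q' - p' * q) = 1 := by
      linear_combination (a' * p' + b' * q') * g02 - (a' * p + b' * q) * g03 + g13
    -- k is the inverse of the determinant ab' - a'b, and Cramer's rule expresses the second block
    -- through the first.
    obtain ⟨k, hkd⟩ : ∃ k, k = p * q' - p' * q := ⟨_, rfl⟩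
    rw [← hkd] at hk
    have e1 : p = b' * k := by rw [hkd]; linear_combination -p * g13 + p' * g12
    have e2 : q = -a' * k := by rw [hkd]; linear_combination -q * g13 + q' * g12
    have e3 : p' = -b * k := by rw [hkd]; linear_combination p * g03 - p' * g02
    have e4 : q' = a * k := by rw [hkd]; linear_combination q * g03 - q' * g02
    refine hasRootTypeII_of_eq hk hc hΨ ?_ ?_ ?_ ?_ ?_ <;>
      simp [psi, hw, eta, dualIdx, z20, z30, z21, z31, z02, z12, z03, z13, ha, hb, ha', hb', hp, hq,
        hp', hq', e1, e2, e3, e4]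
    · ring
    · ring
    -- The trace part of C₁₄₂₃ is the bare constant c; with Δ = ab' - a'b and Δk = 1 it becomes the
    -- homogeneous term cΔ²k².
    · linear_combination (-c * ((a * b' - a' * b) * k + 1)) * hk
    · ring
    · ring

end ExData

theorem IsF6Section.isReduced {g : MetricField} {K : EndField} {e : FrameField} {V : Set R4}
    (he : IsF6Section g K V e) : IsParallelFrame.IsReduced g e V :=
  fun x hx => ⟨(he.2 x hx).2.1, (he.2 x hx).2.2.1, (he.2 x hx).2.2.2.1⟩

/-! ### Openness and density of the type II points -/

namespace ExData

variable {A B : Set ℝ} {c : ℝ} {f₁ f₂ f₃ f₄ : ℝ → ℝ}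

theorem continuousOn_exPsi4 (h : ExData A B c f₁ f₂ f₃ f₄) :
    ContinuousOn (exPsi4 c f₁ f₂ f₃ f₄) (exDomain A B) := by
  have d4 := h.smooth₄.deriv_of_isOpen h.isOpen_A (m := ∞) (by simp)
  have d2 := h.smooth₂.deriv_of_isOpen h.isOpen_B (m := ∞) (by simp)
  have dd4 := d4.deriv_of_isOpen h.isOpen_A (m := ∞) (by simp)
  have dd2 := d2.deriv_of_isOpen h.isOpen_B (m := ∞) (by simp)
  have k1 := (comp_fst (B := B) h.smooth₁).continuousOn
  have k3 := (comp_snd (A := A) h.smooth₃).continuousOn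
  have k4 := (comp_fst (B := B) d4).continuousOn
  have k2 := (comp_snd (A := A) d2).continuousOn
  have k44 := (comp_fst (B := B) dd4).continuousOn
  have k22 := (comp_snd (A := A) dd2).continuousOn
  have x := (continuous_apply (A := fun _ : Fin 4 => ℝ) 0).continuousOn (s := exDomain A B)
  have y := (continuous_apply (A := fun _ : Fin 4 => ℝ) 1).continuousOn (s := exDomain A B)
  have C (r : ℝ) : ContinuousOn (fun _ : R4 => r) (exDomain A B) := continuousOn_const
  exact ((((C _).mul (k22.add k44)).sub (((C _).mul (((C 2).mul x).add k1)).mul ((C _).mul k4))).sub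
    (((C _).mul (((C 2).mul y).add k3)).mul ((C _).mul k2)))

theorem isOpen_petrovII (h : ExData A B c f₁ f₂ f₃ f₄) (hc : c ≠ 0) :
    IsOpen {z | z ∈ exDomain A B ∧ IsPetrovII (exMetric c f₁ f₂ f₃ f₄) (exPara c f₁ f₂ f₃ f₄) z} := by
  have := h.continuousOn_exPsi4.isOpen_inter_preimage h.isNullFrame.isOpen
    (isOpen_compl_singleton (x := (0 : ℝ)))
  convert this using 1
  ext z
  exact and_congr_right fun hz => h.isPetrovII_iff hc hz

theorem subset_closure_petrovII (h : ExData A B c f₁ f₂ f₃ f₄) (hc : c ≠ 0)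
    (h4 : ∀ s ∈ A, deriv f₄ s ≠ 0) : exDomain A B ⊆
      closure {z | z ∈ exDomain A B ∧
        IsPetrovII (exMetric c f₁ f₂ f₃ f₄) (exPara c f₁ f₂ f₃ f₄) z} := by
  intro z hz
  by_cases h0 : exPsi4 c f₁ f₂ f₃ f₄ z = 0
  swap
  · exact subset_closure ⟨hz, (h.isPetrovII_iff hc hz).2 h0⟩
  -- A zero z of Ψ₄ is approached along the x-direction, which leaves a and b, hence the domain,
  -- unchanged.
  have hlim : Filter.Tendsto (fun t : ℝ => Function.update z 0 (z 0 + t)) (nhdsWithin 0 {0}ᶜ)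
      (nhds z) := by
    have : Continuous fun t : ℝ => Function.update z 0 (z 0 + t) := by fun_prop
    have := (this.tendsto 0).mono_left (nhdsWithin_le_nhds (s := {0}ᶜ))
    simpa using this
  refine mem_closure_of_tendsto hlim (eventually_mem_nhdsWithin.mono fun t ht => ?_)
  have hzt : Function.update z 0 (z 0 + t) ∈ exDomain A B := by simpa [exDomain] using hz
  refine ⟨hzt, (h.isPetrovII_iff hc hzt).2 fun h1 => ?_⟩
  -- Ψ₄ is affine in x with slope -(9/2)c²f₄'(a); a second zero on the same line would make this
  -- slope vanish.
  have h2 : 3 / 2 * c * (2 * t) * (3 / 2 * c * deriv f₄ (z 2)) = 0 := by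
    simp [exPsi4] at h0 h1
    linear_combination h0 - h1
  have ht' : t ≠ 0 := ht
  simp [hc, ht', h4 _ hz.1] at h2

end ExData

end PKE

end

/-! ### The theorem -/

theorem mainTheorem6 :
    (∀ (U : Set PKE.R4) (g : PKE.MetricField) (K : PKE.EndField), IsOpen U →
      PKE.IsPKE g K U → (∀ x ∈ U, PKE.IsPetrovII g K x) →
      ∀ (V : Set PKE.R4) (e : PKE.FrameField), IsOpen V → V ⊆ U → PKE.IsF6Section g K V e →
        (∀ x ∈ V,
          PKE.connForm g e 1 0 x
              = PKE.J g e x 0 • PKE.coframe g e 1 x + PKE.J g e x 1 • PKE.coframe g e 2 x ∧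
          PKE.connForm g e 0 1 x
              = -(PKE.J g e x 2 • PKE.coframe g e 0 x) + PKE.J g e x 5 • PKE.coframe g e 1 x
                + PKE.J g e x 4 • PKE.coframe g e 2 x + PKE.J g e x 3 • PKE.coframe g e 3 x) ∧
        (PKE.YangMills g e V ↔ ∀ x ∈ V, PKE.YMConditions g e x)) ∧
    (∀ (A B : Set ℝ) (c : ℝ) (f₁ f₂ f₃ f₄ : ℝ → ℝ), IsOpen A → IsOpen B → c ≠ 0 →
      ContDiffOn ℝ ∞ f₁ A → ContDiffOn ℝ ∞ f₂ B → ContDiffOn ℝ ∞ f₃ B → ContDiffOn ℝ ∞ f₄ A →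
      (∀ s ∈ B, deriv f₂ s ≠ 0) → (∀ s ∈ A, deriv f₄ s ≠ 0) →
      let D := PKE.exDomain A B
      let g := PKE.exMetric c f₁ f₂ f₃ f₄
      let K := PKE.exPara c f₁ f₂ f₃ f₄
      let e := PKE.exFrame c f₁ f₂ f₃ f₄
      let T := {z | z ∈ D ∧ PKE.IsPetrovII g K z}
      PKE.IsPKE g K D ∧ PKE.IsF6Section g K D e ∧
        (∀ z ∈ D, PKE.psi2' g z (fun a => e a z) = c) ∧
        (∀ z ∈ D, PKE.YMConditions g e z) ∧ PKE.YangMills g e D ∧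
        IsOpen T ∧ D ⊆ closure T) := by
  constructor
  · intro U g K _ hPKE _ V e hV hVU he
    have hf := hPKE.isParallelFrame hV hVU he
    have h0 := he.isReduced
    have hq : ∀ x ∈ V, PKE.psi g x (fun a => e a x) 2 ≠ 0 := fun x hx => (he.2 x hx).2.2.2.2
    exact ⟨fun x hx => ⟨hf.connForm_one_zero_eq h0 hx (hq x hx), PKE.IsParallelFrame.connForm_zero_one_eq hf.toIsNullFrame hx⟩,
      hf.yangMills_iff h0 hq fun x hx => hPKE.psi2'_ne_zero x (hVU hx) _ (he.2 x hx).1⟩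
  · intro A B c f₁ f₂ f₃ f₄ hA hB hc hf₁ hf₂ hf₃ hf₄ _ hd D g K e T
    have h : PKE.ExData A B c f₁ f₂ f₃ f₄ := ⟨hA, hB, hf₁, hf₂, hf₃, hf₄⟩
    have hF := h.isF6Section hc
    have hp : ∀ z ∈ D, PKE.psi2' g z (fun a => e a z) = c := fun z hz =>
      h.psi2'_eq hz (h.isAdaptedAt hz)
    exact ⟨h.isPKE hc, hF, hp, fun z hz => h.ymConditions hz,
      (h.isParallelFrame.yangMills_iff hF.isReduced (fun x hx => (hF.2 x hx).2.2.2.2)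
        fun x hx => (hp x hx).trans_ne hc).2 fun z hz => h.ymConditions hz,
      h.isOpen_petrovII hc, h.subset_closure_petrovII hc hd⟩
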